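/- Let $\mathbb T^3=(\mathbb R/2\pi\mathbb Z)^3$ (identified with $(-\pi,\pi]^3$, Lebesgue measure) and $\varepsilon(p)=\sum_{i=1}^3(1-\cos p^{(i)})$. Let $l_1,l_2,l_3>0$ and $\mu_1,\mu_2,\mu_3>0$, and write $\{\alpha,\beta,\gamma\}=\{1,2,3\}$, $\varepsilon_\alpha=l_\alpha\varepsilon$, $M=\sum_\alpha 1/l_\alpha$, $m_\alpha=1/(l_\alpha M)$, $l_{\gamma\beta}=l_\gamma/(l_\beta+l_\gamma)$. For $K\in\mathbb T^3$ let $p_1+p_2+p_3=0$ be the particle momenta relative to the centre of mass, and put $$E_{\alpha\beta}(K;p_\alpha,p_\beta)=\varepsilon_\alpha(m_\alpha K-p_\alpha)+\varepsilon_\beta(m_\beta K-p_\beta)+\varepsilon_\gamma(m_\gamma K+p_\alpha+p_\beta).$$ On $L_2((\mathbb T^3)^2)$, with coordinates $(p_1,p_2)$, let $H(K)=H_0(K)-V_1-V_2-V_3$, where $H_0(K)$ is multiplication by $E_{12}(K;p_1,p_2)$ and $V_\alpha$ is $\mu_\alpha$ times averaging over the fibres $p_\alpha=\mathrm{const}$;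 explicitly $(V_1f)(p_1,p_2)=\frac{\mu_1}{(2\pi)^3}\int f(p_1,s)\,ds$, $(V_2f)(p_1,p_2)=\frac{\mu_2}{(2\pi)^3}\int f(s,p_2)\,ds$, $(V_3f)(p_1,p_2)=\frac{\mu_3}{(2\pi)^3}\int f(p_1+s,p_2-s)\,ds$. Let $\tau_{ess}(K)=\inf\sigma_{ess}(H(K))$, and let $N(K,\tau_{ess}(K))$ be the number of eigenvalues of $H(K)$ below $\tau_{ess}(K)$, counted with multiplicity. For a bounded self-adjoint operator $A$ let $n(z,A)$ be the supremum of the dimensions of the subspaces on whose nonzero vectors $(Af,f)>z(f,f)$. Put $$\Delta_\alpha(k,z)=1-\frac{\mu_\alpha}{(2\pi)^3}\int_{\mathbb T^3}\frac{dq}{\varepsilon_\beta(l_{\gamma\beta}k+q)+\varepsilon_\gamma(l_{\beta\gamma}k-q)-z},$$ $$\Delta_\alpha(K,p,z)=\Delta_\alpha\big((m_\beta+m_\gamma)K+p,\;z-\varepsilon_\alpha(m_\alpha K-p)\big),$$ and let $T(K,z)$ be the operator on $L_2^{(3)}(\mathbb T^3)$ with entries $T_{\alpha\alpha}(K,z)=0$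 and, for $\alpha\ne\beta$, $$(T_{\alpha\beta}(K,z)w_\beta)(p_\alpha)=\frac{\sqrt{\mu_\alpha\mu_\beta}}{(2\pi)^3}\int_{\mathbb T^3}\frac{\Delta_\alpha^{-1/2}(K,p_\alpha,z)\,\Delta_\beta^{-1/2}(K,p_\beta,z)}{E_{\alpha\beta}(K;p_\alpha,p_\beta)-z}\,w_\beta(p_\beta)\,dp_\beta .$$ Set $\mu_\alpha^0=(l_\beta+l_\gamma)(2\pi)^3\big(\int_{\mathbb T^3}\varepsilon(q)^{-1}dq\big)^{-1}$ (the coupling at which the two-particle operator of the pair $\beta,\gamma$ has a zero energy resonance), and assume that $\mu_\alpha=\mu_\alpha^0$ for at least two of the indices and $\mu_\gamma\le\mu_\gamma^0$ for the remaining one. Then there is $\delta>0$ such that for all $K$ with $0<|K|<\delta$ the following holds. The operator $T(K,\tau_{ess}(K))$ is well defined ($\tau_{ess}(K)<E_{\alpha\beta}(K;p,q)$ for all $p,q$ and $\alpha\neq\beta$, and $\Delta_\alpha(K,p,\tau_{ess}(K))>0$ for almost every $p$ and every $\alpha$), and it is a self-adjoint compact operator of Hilbert–Schmidt class, i.e.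 its entries have square integrable kernels. The limit $\lim_{\gamma\to0+}n(1-\gamma,T(K,\tau_{ess}(K)))$ exists and is finite, and $$N(K,\tau_{ess}(K))=n\big(1,T(K,\tau_{ess}(K))\big)\le\lim_{\gamma\to 0+}n\big(1-\gamma,T(K,\tau_{ess}(K))\big).$$ -/

import Mathlib

open MeasureTheory Filter Topology
open scoped ENNReal

noncomputable section

/-! ### Integral operators on `L²` -/

namespace IntegralOperator

variable {X S : Type*} [MeasurableSpace X] [MeasurableSpace S]

/-- Cauchy-Schwarz bound for `x ↦ ∫ k (x, s) g s dν(s)`. -/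
theorem eLpNorm_integral_mul_le {μ : Measure X} {ν : Measure S} [SFinite ν]
    {k : X × S → ℂ} {g : S → ℂ} (hk : AEStronglyMeasurable k (μ.prod ν))
    (hg : AEStronglyMeasurable g ν) :
    eLpNorm (fun x => ∫ s, k (x, s) * g s ∂ν) 2 μ ≤ eLpNorm k 2 (μ.prod ν) * eLpNorm g 2 ν := by
  have h2 : (2 : ℝ≥0∞) ≠ 0 := by norm_num
  have h2' : (2 : ℝ≥0∞) ≠ ∞ := by norm_num
  have e2 : (2 : ℝ≥0∞).toReal = 2 := by norm_num
  have key : ∀ᵐ x ∂μ, ‖∫ s, k (x, s) * g s ∂ν‖ₑ ^ (2 : ℝ)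
      ≤ (∫⁻ s, ‖k (x, s)‖ₑ ^ (2 : ℝ) ∂ν) * (eLpNorm g 2 ν) ^ (2 : ℝ) := by
    filter_upwards [hk.prodMk_left] with x hx
    have h1 : ‖∫ s, k (x, s) * g s ∂ν‖ₑ ≤ ∫⁻ s, ‖k (x, s)‖ₑ * ‖g s‖ₑ ∂ν := by
      refine (enorm_integral_le_lintegral_enorm _).trans (le_of_eq ?_)
      simp [enorm_mul]
    have h3 := ENNReal.lintegral_mul_le_Lp_mul_Lq ν
      (Real.HolderConjugate.two_two) hx.enorm hg.enorm
    have h4 := h1.trans h3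
    have h5 := ENNReal.rpow_le_rpow h4 (show (0 : ℝ) ≤ 2 by norm_num)
    refine h5.trans (le_of_eq ?_)
    rw [ENNReal.mul_rpow_of_nonneg _ _ (by norm_num), ← ENNReal.rpow_mul,
      eLpNorm_eq_lintegral_rpow_enorm_toReal h2 h2', e2]
    norm_num
  have h6 : ∫⁻ x, ‖∫ s, k (x, s) * g s ∂ν‖ₑ ^ (2 : ℝ) ∂μ
      ≤ (eLpNorm k 2 (μ.prod ν)) ^ (2 : ℝ) * (eLpNorm g 2 ν) ^ (2 : ℝ) := by
    refine (lintegral_mono_ae key).trans ?_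
    rw [lintegral_mul_const'' _ (by
      exact (hk.enorm.pow_const _).lintegral_prod_right')]
    refine mul_le_mul_left ?_ _
    rw [eLpNorm_eq_lintegral_rpow_enorm_toReal h2 h2' (f := k), e2, ← ENNReal.rpow_mul]
    rw [lintegral_prod _ (hk.enorm.pow_const _)]
    norm_num
  rw [eLpNorm_eq_lintegral_rpow_enorm_toReal h2 h2', e2]
  refine (ENNReal.rpow_le_rpow h6 (by norm_num)).trans (le_of_eq ?_)
  rw [← ENNReal.mul_rpow_of_nonneg _ _ (by norm_num), ← ENNReal.rpow_mul]
  norm_num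

/-- `x ↦ ∫ k (x, s) g s dν(s)` is square integrable if `k` and `g` are. -/
theorem memLp_integral_mul {μ : Measure X} {ν : Measure S} [SFinite ν]
    {k : X × S → ℂ} {g : S → ℂ} (hk : MemLp k 2 (μ.prod ν)) (hg : MemLp g 2 ν) :
    MemLp (fun x => ∫ s, k (x, s) * g s ∂ν) 2 μ := by
  refine ⟨?_, (eLpNorm_integral_mul_le hk.1 hg.1).trans_lt (ENNReal.mul_lt_top hk.2 hg.2)⟩
  exact (hk.1.mul hg.1.comp_snd).integral_prod_right'

/-- The sections of a square integrable kernel are square integrable. -/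
theorem ae_memLp_section {μ : Measure X} {ν : Measure S} [SFinite ν]
    {k : X × S → ℂ} (hk : MemLp k 2 (μ.prod ν)) :
    ∀ᵐ x ∂μ, MemLp (fun s => k (x, s)) 2 ν := by
  have h2 : (2 : ℝ≥0∞) ≠ 0 := by norm_num
  have h2' : (2 : ℝ≥0∞) ≠ ∞ := by norm_num
  have h := lintegral_rpow_enorm_lt_top_of_eLpNorm_lt_top h2 h2' hk.2
  rw [lintegral_prod _ (hk.1.enorm.pow_const _)] at h
  have h' := ae_lt_top' ((hk.1.enorm.pow_const _).lintegral_prod_right') h.ne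
  filter_upwards [hk.1.prodMk_left, h'] with x hx hx'
  exact ⟨hx, (eLpNorm_lt_top_iff_lintegral_rpow_enorm_lt_top h2 h2').2 hx'⟩

/-- The integral operator `(T f)(x) = ∫ k (x, y) f y dμ(y)` on `L²(μ)` with a square integrable
(Hilbert-Schmidt) kernel `k`. -/
def ofKernel (μ : Measure X) [SFinite μ] (k : X × X → ℂ) (hk : MemLp k 2 (μ.prod μ)) :
    Lp ℂ 2 μ →L[ℂ] Lp ℂ 2 μ :=
  LinearMap.mkContinuous
    { toFun := fun f => (memLp_integral_mul hk (Lp.memLp f)).toLp _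
      map_add' := fun f g => by
        rw [← MemLp.toLp_add]
        refine MemLp.toLp_congr _ _ ?_
        filter_upwards [ae_memLp_section hk] with x hx
        have h1 : Integrable (fun y => k (x, y) * f y) μ := hx.integrable_mul (Lp.memLp f)
        have h2 : Integrable (fun y => k (x, y) * g y) μ := hx.integrable_mul (Lp.memLp g)
        rw [Pi.add_apply, ← integral_add h1 h2]
        refine integral_congr_ae ?_
        filter_upwards [Lp.coeFn_add f g] with y hy
        rw [hy, Pi.add_apply, mul_add]
      map_smul' := fun c f => by
        rw [RingHom.id_apply, ← MemLp.toLp_const_smul]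
        refine MemLp.toLp_congr _ _ (Eventually.of_forall fun x => ?_)
        simp only [Pi.smul_apply, smul_eq_mul]
        rw [← integral_const_mul]
        refine integral_congr_ae ?_
        filter_upwards [Lp.coeFn_smul c f] with y hy
        simp only [hy, Pi.smul_apply, smul_eq_mul]
        ring }
    (eLpNorm k 2 (μ.prod μ)).toReal
    (fun f => by
      simp only [LinearMap.coe_mk, AddHom.coe_mk]
      rw [Lp.norm_toLp, Lp.norm_def, ← ENNReal.toReal_mul]
      exact ENNReal.toReal_mono (ENNReal.mul_lt_top hk.2 (Lp.memLp f).2).ne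
        (eLpNorm_integral_mul_le hk.1 (Lp.memLp f).1))

theorem ofKernel_apply (μ : Measure X) [SFinite μ] (k : X × X → ℂ) (hk : MemLp k 2 (μ.prod μ))
    (f : Lp ℂ 2 μ) : ofKernel μ k hk f =ᵐ[μ] fun x => ∫ y, k (x, y) * f y ∂μ :=
  MemLp.coeFn_toLp (memLp_integral_mul hk (Lp.memLp f))

/-- If every `x ↦ Φ x s` preserves `μ`, then `(x, s) ↦ Φ x s` maps `μ × ν` to `ν(S) μ`. -/
theorem map_uncurry {μ : Measure X} [SFinite μ] {ν : Measure S} [SFinite ν] {Φ : X → S → X}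
    (hΦ : Measurable fun z : X × S => Φ z.1 z.2)
    (hp : ∀ s, MeasurePreserving (fun x => Φ x s) μ μ) :
    (μ.prod ν).map (fun z : X × S => Φ z.1 z.2) = ν Set.univ • μ := by
  have h1 : MeasurePreserving (fun z : S × X => (z.1, Φ z.2 z.1)) (ν.prod μ) (ν.prod μ) :=
    (MeasurePreserving.id ν).skew_product (g := fun s x => Φ x s)
      (hΦ.comp measurable_swap) (Eventually.of_forall fun s => (hp s).map_eq)
  have h2 : (fun z : X × S => Φ z.1 z.2)
      = (Prod.snd ∘ fun z : S × X => (z.1, Φ z.2 z.1)) ∘ Prod.swap := rfl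
  rw [h2, ← Measure.map_map (measurable_snd.comp h1.measurable) measurable_swap,
    Measure.prod_swap, ← Measure.map_map measurable_snd h1.measurable, h1.map_eq,
    Measure.map_snd_prod]

theorem memLp_comp {μ : Measure X} [SFinite μ] {ν : Measure S} [IsFiniteMeasure ν] {Φ : X → S → X}
    (hΦ : Measurable fun z : X × S => Φ z.1 z.2)
    (hp : ∀ s, MeasurePreserving (fun x => Φ x s) μ μ) {f : X → ℂ} (hf : MemLp f 2 μ) :
    MemLp (fun z : X × S => f (Φ z.1 z.2)) 2 (μ.prod ν) := by
  refine MemLp.comp_of_map (g := f) ?_ hΦ.aemeasurable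
  rw [map_uncurry hΦ hp]
  exact hf.smul_measure (measure_ne_top _ _)

theorem memLp_average {μ : Measure X} [SFinite μ] {ν : Measure S} [IsFiniteMeasure ν]
    {Φ : X → S → X} (hΦ : Measurable fun z : X × S => Φ z.1 z.2)
    (hp : ∀ s, MeasurePreserving (fun x => Φ x s) μ μ) {f : X → ℂ} (hf : MemLp f 2 μ) :
    MemLp (fun x => ∫ s, f (Φ x s) ∂ν) 2 μ := by
  simpa using memLp_integral_mul (memLp_comp (ν := ν) hΦ hp hf) (memLp_const (1 : ℂ))

theorem ae_average_congr {μ : Measure X} [SFinite μ] {ν : Measure S} [IsFiniteMeasure ν]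
    {Φ : X → S → X} (hΦ : Measurable fun z : X × S => Φ z.1 z.2)
    (hp : ∀ s, MeasurePreserving (fun x => Φ x s) μ μ) {f g : X → ℂ} (hfg : f =ᵐ[μ] g) :
    ∀ᵐ x ∂μ, (fun s => f (Φ x s)) =ᵐ[ν] fun s => g (Φ x s) := by
  have h : ∀ᵐ y ∂((μ.prod ν).map fun z : X × S => Φ z.1 z.2), f y = g y := by
    rw [map_uncurry hΦ hp]
    exact Measure.ae_smul_measure hfg _
  exact Measure.ae_ae_of_ae_prod (ae_of_ae_map hΦ.aemeasurable h)

/-- The operator `(V f)(x) = ∫ f (Φ x s) dν(s)` on `L²(μ)`, for a family `Φ · s` of measure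
preserving maps and a finite measure `ν`. -/
def average (μ : Measure X) [SFinite μ] (ν : Measure S) [IsFiniteMeasure ν] (Φ : X → S → X)
    (hΦ : Measurable fun z : X × S => Φ z.1 z.2)
    (hp : ∀ s, MeasurePreserving (fun x => Φ x s) μ μ) :
    Lp ℂ 2 μ →L[ℂ] Lp ℂ 2 μ :=
  LinearMap.mkContinuous
    { toFun := fun f => (memLp_average (ν := ν) hΦ hp (Lp.memLp f)).toLp _
      map_add' := fun f g => by
        rw [← MemLp.toLp_add]
        refine MemLp.toLp_congr _ _ ?_
        filter_upwards [ae_memLp_section (memLp_comp (ν := ν) hΦ hp (Lp.memLp f)),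
          ae_memLp_section (memLp_comp (ν := ν) hΦ hp (Lp.memLp g)),
          ae_average_congr (ν := ν) hΦ hp (Lp.coeFn_add f g)] with x hf hg hfg
        rw [Pi.add_apply, ← integral_add (hf.integrable (by norm_num))
          (hg.integrable (by norm_num))]
        exact integral_congr_ae hfg
      map_smul' := fun c f => by
        rw [RingHom.id_apply, ← MemLp.toLp_const_smul]
        refine MemLp.toLp_congr _ _ ?_
        filter_upwards [ae_average_congr (ν := ν) hΦ hp (Lp.coeFn_smul c f)] with x hx
        rw [Pi.smul_apply, smul_eq_mul, ← integral_const_mul]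
        exact integral_congr_ae hx }
    ((ν Set.univ ^ (1 / (2 : ℝ))).toReal * (eLpNorm (fun _ : S => (1 : ℂ)) 2 ν).toReal)
    (fun f => by
      have h1 := eLpNorm_integral_mul_le (g := fun _ => (1 : ℂ))
        (memLp_comp (ν := ν) hΦ hp (Lp.memLp f)).1 aestronglyMeasurable_const
      have h2 : eLpNorm (fun z : X × S => f (Φ z.1 z.2)) 2 (μ.prod ν)
          = ν Set.univ ^ (1 / (2 : ℝ)) * eLpNorm f 2 μ := by
        have h3 := eLpNorm_map_measure (p := 2) (μ := μ.prod ν)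
          (f := fun z : X × S => Φ z.1 z.2) (g := f) (by
            rw [map_uncurry hΦ hp]
            exact (Lp.aestronglyMeasurable f).smul_measure _) hΦ.aemeasurable
        rw [map_uncurry hΦ hp, eLpNorm_smul_measure_of_ne_top (by norm_num)] at h3
        simpa [Function.comp_def] using h3.symm
      have h4 : ν Set.univ ^ (1 / (2 : ℝ)) ≠ ∞ :=
        (ENNReal.rpow_lt_top_of_nonneg (by norm_num) (measure_ne_top _ _)).ne
      rw [h2] at h1
      simp only [mul_one] at h1
      simp only [LinearMap.coe_mk, AddHom.coe_mk]
      rw [Lp.norm_toLp, Lp.norm_def, ← ENNReal.toReal_mul, ← ENNReal.toReal_mul]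
      refine ENNReal.toReal_mono ?_ (h1.trans (le_of_eq (by ring)))
      exact ENNReal.mul_ne_top (ENNReal.mul_ne_top h4 (memLp_const (1 : ℂ)).2.ne)
        (Lp.memLp f).2.ne)

theorem average_apply (μ : Measure X) [SFinite μ] (ν : Measure S) [IsFiniteMeasure ν]
    (Φ : X → S → X) (hΦ : Measurable fun z : X × S => Φ z.1 z.2)
    (hp : ∀ s, MeasurePreserving (fun x => Φ x s) μ μ) (f : Lp ℂ 2 μ) :
    average μ ν Φ hΦ hp f =ᵐ[μ] fun x => ∫ s, f (Φ x s) ∂ν :=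
  MemLp.coeFn_toLp (memLp_average hΦ hp (Lp.memLp f))

/-- The operator of multiplication by an essentially bounded function on `L²(μ)`. -/
def multiplication (μ : Measure X) (φ : X → ℂ) (hφ : MemLp φ ∞ μ) :
    Lp ℂ 2 μ →L[ℂ] Lp ℂ 2 μ :=
  (ContinuousLinearMap.mul ℂ ℂ).holderL μ ∞ 2 2 (hφ.toLp φ)

theorem multiplication_apply (μ : Measure X) (φ : X → ℂ) (hφ : MemLp φ ∞ μ) (f : Lp ℂ 2 μ) :
    multiplication μ φ hφ f =ᵐ[μ] fun x => φ x * f x := by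
  have h := ContinuousLinearMap.coeFn_holder (r := 2) (ContinuousLinearMap.mul ℂ ℂ) (hφ.toLp φ) f
  filter_upwards [h, hφ.coeFn_toLp] with x hx hx'
  rw [hx'] at hx
  exact hx

end IntegralOperator

/-! ### Counting functions and essential spectrum of a bounded self-adjoint operator -/

section Spectral

variable {H : Type*} [NormedAddCommGroup H] [InnerProductSpace ℂ H]

/-- `n(z, A)`: the supremum of the dimensions of the subspaces on whose nonzero vectors
`(A f, f) > z (f, f)`. -/
def countAbove (z : ℝ) (A : H →L[ℂ] H) : ℕ∞ :=
  ⨆ S : {S : Submodule ℂ H // ∀ f ∈ S, f ≠ 0 → z * ‖f‖ ^ 2 < (inner ℂ (A f) f : ℂ).re},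
    Cardinal.toENat (Module.rank ℂ S.1)

/-- The eigenspace of `A` for the real number `t`. -/
def realEigenspace (A : H →L[ℂ] H) (t : ℝ) : Submodule ℂ H :=
  Module.End.eigenspace (A : H →ₗ[ℂ] H) (t : ℂ)

/-- The number of eigenvalues of the self-adjoint operator `A` below `z`, counted with
multiplicity: the dimension of the linear span of the eigenvectors with eigenvalue `< z`. -/
def numEigenvaluesBelow (A : H →L[ℂ] H) (z : ℝ) : ℕ∞ :=
  Cardinal.toENat (Module.rank ℂ ↥(⨆ t : Set.Iio z, realEigenspace A t))

/-- The (real) spectrum of a self-adjoint operator. -/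
def realSpectrum (A : H →L[ℂ] H) : Set ℝ := {t | (t : ℂ) ∈ spectrum ℂ A}

/-- The essential spectrum of a self-adjoint operator: the spectrum without the isolated points
that are eigenvalues of finite multiplicity. -/
def essSpectrum (A : H →L[ℂ] H) : Set ℝ :=
  {t ∈ realSpectrum A | AccPt t (𝓟 (realSpectrum A)) ∨
    ¬ FiniteDimensional ℂ (realEigenspace A t)}

end Spectral

/-! ### The three-particle lattice Hamiltonian -/

namespace LatticeThreeBody

instance twoPiPos : Fact (0 < 2 * Real.pi) := ⟨Real.two_pi_pos⟩

/-- The torus `𝕋³ = (ℝ / 2πℤ)³`; its `volume` is Lebesgue measure, of total mass `(2π)³`. -/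
abbrev Torus : Type := Fin 3 → AddCircle (2 * Real.pi)

/-- The class of a vector of `ℝ³` in the torus. -/
def toTorus (x : EuclideanSpace ℝ (Fin 3)) : Torus := fun i => (x i : AddCircle (2 * Real.pi))

/-- Cosine as a function on the circle. -/
def cosCircle : AddCircle (2 * Real.pi) → ℝ := Real.cos_periodic.lift

/-- `ε(p) = ∑ᵢ (1 - cos pᵢ)`. -/
def disp (p : Torus) : ℝ := ∑ i, (1 - cosCircle (p i))

theorem continuous_disp : Continuous disp := by
  have h : Continuous cosCircle := continuous_coinduced_dom.mpr Real.continuous_cos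
  unfold disp
  fun_prop

/-- The total mass `M = ∑ 1 / l_α`. -/
def totalMass (l : Fin 3 → ℝ) : ℝ := ∑ a, 1 / l a

/-- The mass ratios `m_α = 1 / (l_α M)`. -/
def massRatio (l : Fin 3 → ℝ) (a : Fin 3) : ℝ := 1 / (l a * totalMass l)

/-- For `α ≠ β`, the third index `γ`. -/
def third (a b : Fin 3) : Fin 3 := -(a + b)

/-- The kinetic energy at total quasi-momentum `K` in terms of the momenta `p_α`, `p_β` of two
particles in the centre of mass frame. The quasi-momenta of the particles are
`m_α K - p_α`, `m_β K - p_β`, `m_γ K - p_γ`, where `p_α + p_β + p_γ = 0`. -/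
def kinetic (l : Fin 3 → ℝ) (K : EuclideanSpace ℝ (Fin 3)) (a b : Fin 3) (p q : Torus) : ℝ :=
  l a * disp (toTorus (massRatio l a • K) - p) + l b * disp (toTorus (massRatio l b • K) - q)
    + l (third a b) * disp (toTorus (massRatio l (third a b) • K) + p + q)

theorem continuous_kinetic (l : Fin 3 → ℝ) (K : EuclideanSpace ℝ (Fin 3)) (a b : Fin 3) :
    Continuous fun z : Torus × Torus => kinetic l K a b z.1 z.2 := by
  have := continuous_disp
  unfold kinetic
  fun_prop

/-- The Hilbert space `L²((𝕋³)²)`, in the coordinates `(p₁, p₂)` (with `p₃ = - p₁ - p₂`); the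
particles `1, 2, 3` have the indices `0, 1, 2 : Fin 3`. -/
abbrev L2Pair : Type := Lp ℂ 2 (volume : Measure (Torus × Torus))

theorem memLp_kinetic (l : Fin 3 → ℝ) (K : EuclideanSpace ℝ (Fin 3)) :
    MemLp (fun z : Torus × Torus => (kinetic l K 0 1 z.1 z.2 : ℂ)) ∞ volume := by
  have hc : Continuous fun z : Torus × Torus => (kinetic l K 0 1 z.1 z.2 : ℂ) :=
    Complex.continuous_ofReal.comp (continuous_kinetic l K 0 1)
  obtain ⟨C, hC⟩ := isCompact_univ.exists_bound_of_continuousOn hc.continuousOn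
  exact memLp_top_of_bound hc.aestronglyMeasurable C (Eventually.of_forall fun z => hC z trivial)

/-- The free operator `H₀(K)`: multiplication by the kinetic energy. -/
def freeHamiltonian (l : Fin 3 → ℝ) (K : EuclideanSpace ℝ (Fin 3)) : L2Pair →L[ℂ] L2Pair :=
  IntegralOperator.multiplication volume _ (memLp_kinetic l K)

/-- The direction, in the coordinates `(p₁, p₂)`, of the motions that keep `p_α` fixed:
`(0, s)`, `(s, 0)` and `(s, -s)` for `α = 1, 2, 3`. -/
def direction (a : Fin 3) (s : Torus) : Torus × Torus := ![(0, s), (s, 0), (s, -s)] a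

instance secondCountable_circle : SecondCountableTopology (AddCircle (2 * Real.pi)) :=
  inferInstanceAs (SecondCountableTopology (ℝ ⧸ AddSubgroup.zmultiples (2 * Real.pi)))

theorem measurable_direction (a : Fin 3) : Measurable (direction a) := by
  have h0 : Measurable fun s : Torus => ((0, s) : Torus × Torus) := by fun_prop
  have h1 : Measurable fun s : Torus => ((s, 0) : Torus × Torus) := by fun_prop
  have h2 : Measurable fun s : Torus => ((s, -s) : Torus × Torus) :=
    (continuous_id.prodMk continuous_neg).measurable
  fin_cases a
  exacts [h0, h1, h2]


theorem measurePreserving_direction (a : Fin 3) (s : Torus) :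
    MeasurePreserving (fun z : Torus × Torus => z + direction a s) volume volume :=
  (measurePreserving_add_right (volume : Measure Torus) (direction a s).1).prod
    (measurePreserving_add_right (volume : Measure Torus) (direction a s).2)

/-- The interaction `V_α` of the particles `β`, `γ`, i.e.
`(V_α f)(q_α, p_α) = μ_α (2π)⁻³ ∫ f(q', p_α) dq'`: the integral runs over the fibre on which `p_α`
is fixed. On such a fibre `q_α` is, up to sign and a translation, the momentum `p_β`, so this is
`μ_α (2π)⁻³ ∫ f(z + direction α s) ds`, see `interaction_apply`. -/
def interaction (mu : Fin 3 → ℝ) (a : Fin 3) : L2Pair →L[ℂ] L2Pair :=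
  ((mu a / (2 * Real.pi) ^ 3 : ℝ) : ℂ) •
    IntegralOperator.average volume (volume : Measure Torus) (fun z s => z + direction a s)
      (measurable_fst.add ((measurable_direction a).comp measurable_snd))
      (measurePreserving_direction a)

/-- `(V₁ f)(p₁, p₂) = μ₁ (2π)⁻³ ∫ f(p₁, s) ds`, and similarly for `V₂`, `V₃`. -/
theorem interaction_apply (mu : Fin 3 → ℝ) (a : Fin 3) (f : L2Pair) :
    interaction mu a f =ᵐ[volume] fun z =>
      ((mu a / (2 * Real.pi) ^ 3 : ℝ) : ℂ) * ∫ s : Torus, f (z + direction a s) := by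
  have h1 := Lp.coeFn_smul ((mu a / (2 * Real.pi) ^ 3 : ℝ) : ℂ)
    (IntegralOperator.average volume (volume : Measure Torus) (fun z s => z + direction a s)
      (measurable_fst.add ((measurable_direction a).comp measurable_snd))
      (measurePreserving_direction a) f)
  filter_upwards [h1, IntegralOperator.average_apply volume (volume : Measure Torus)
      (fun z s => z + direction a s)
      (measurable_fst.add ((measurable_direction a).comp measurable_snd))
      (measurePreserving_direction a) f] with z h1 h2
  rw [Pi.smul_apply, h2] at h1
  exact h1

/-- The three-particle discrete Schrödinger operator `H(K) = H₀(K) - V₁ - V₂ - V₃`. -/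
def hamiltonian (l mu : Fin 3 → ℝ) (K : EuclideanSpace ℝ (Fin 3)) : L2Pair →L[ℂ] L2Pair :=
  freeHamiltonian l K - interaction mu 0 - interaction mu 1 - interaction mu 2

/-- `τ_ess(K)`, the bottom of the essential spectrum of `H(K)`. -/
def tauEss (l mu : Fin 3 → ℝ) (K : EuclideanSpace ℝ (Fin 3)) : ℝ :=
  sInf (essSpectrum (hamiltonian l mu K))

/-- The critical coupling `μ_α⁰ = (l_β + l_γ) (2π)³ (∫ dq / ε(q))⁻¹`, at which the two-particle
operator `h_α(0)` has a zero energy resonance. -/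
def criticalCoupling (l : Fin 3 → ℝ) (a : Fin 3) : ℝ :=
  (l (a + 1) + l (a + 2)) * (2 * Real.pi) ^ 3 * (∫ q : Torus, (disp q)⁻¹)⁻¹

/-- The Fredholm determinant `Δ_α(k, z)` of the two-particle operator `h_α(k)`. The variable of
integration is the quasi-momentum of the particle `β`, which is a translate of `q_α`
(see `fredholmDet_toTorus`). -/
def fredholmDet (l mu : Fin 3 → ℝ) (a : Fin 3) (k : Torus) (z : ℝ) : ℝ :=
  1 - mu a / (2 * Real.pi) ^ 3 *
    ∫ q : Torus, (l (a + 1) * disp q + l (a + 2) * disp (k - q) - z)⁻¹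

/-- The two-particle dispersion `E_k(q) = ε_β(l_γβ k + q) + ε_γ(l_βγ k - q)`, where
`l_γβ = l_γ / (l_β + l_γ)`. -/
def pairEnergy (l : Fin 3 → ℝ) (a : Fin 3) (k : EuclideanSpace ℝ (Fin 3)) (q : Torus) : ℝ :=
  l (a + 1) * disp (toTorus ((l (a + 2) / (l (a + 1) + l (a + 2))) • k) + q)
    + l (a + 2) * disp (toTorus ((l (a + 1) / (l (a + 1) + l (a + 2))) • k) - q)

theorem toTorus_add (x y : EuclideanSpace ℝ (Fin 3)) :
    toTorus (x + y) = toTorus x + toTorus y := by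
  ext i
  simp [toTorus]

/-- `Δ_α(k, z) = 1 - μ_α (2π)⁻³ ∫ dq / (E_k(q) - z)`. -/
theorem fredholmDet_toTorus (l mu : Fin 3 → ℝ) (hl : ∀ a, 0 < l a) (a : Fin 3)
    (k : EuclideanSpace ℝ (Fin 3)) (z : ℝ) :
    fredholmDet l mu a (toTorus k) z
      = 1 - mu a / (2 * Real.pi) ^ 3 * ∫ q : Torus, (pairEnergy l a k q - z)⁻¹ := by
  have hs : l (a + 1) + l (a + 2) ≠ 0 := (add_pos (hl _) (hl _)).ne'
  have hk : toTorus k = toTorus ((l (a + 2) / (l (a + 1) + l (a + 2))) • k)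
      + toTorus ((l (a + 1) / (l (a + 1) + l (a + 2))) • k) := by
    rw [← toTorus_add, ← add_smul, ← add_div, add_comm (l (a + 2)), div_self hs, one_smul]
  unfold fredholmDet pairEnergy
  rw [← integral_add_left_eq_self (μ := (volume : Measure Torus))
    (fun q => (l (a + 1) * disp q + l (a + 2) * disp (toTorus k - q) - z)⁻¹)
    (toTorus ((l (a + 2) / (l (a + 1) + l (a + 2))) • k))]
  rw [hk]
  simp only [add_sub_add_left_eq_sub]

/-- `Δ_α(K, p, z) = Δ_α((m_β + m_γ) K + p, z - ε_α(m_α K - p))`. -/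
def channelDet (l mu : Fin 3 → ℝ) (a : Fin 3) (K : EuclideanSpace ℝ (Fin 3)) (p : Torus)
    (z : ℝ) : ℝ :=
  fredholmDet l mu a (toTorus ((massRatio l (a + 1) + massRatio l (a + 2)) • K) + p)
    (z - l a * disp (toTorus (massRatio l a • K) - p))

/-- The kernel of the entry `T_{αβ}(K, z)` of the Faddeev type operator (zero for `α = β`). -/
def faddeevKernel (l mu : Fin 3 → ℝ) (K : EuclideanSpace ℝ (Fin 3)) (z : ℝ) (a b : Fin 3)
    (p : Torus × Torus) : ℂ :=
  if a = b then 0 else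
    ((√(mu a * mu b) / (2 * Real.pi) ^ 3 *
      ((√(channelDet l mu a K p.1 z))⁻¹ * (√(channelDet l mu b K p.2 z))⁻¹) /
        (kinetic l K a b p.1 p.2 - z) : ℝ) : ℂ)

/-- `L²(𝕋³)`. -/
abbrev L2Torus : Type := Lp ℂ 2 (volume : Measure Torus)

/-- The Hilbert space `L₂⁽³⁾(𝕋³)` of vector functions `(w₁, w₂, w₃)`, `w_α ∈ L²(𝕋³)`. -/
abbrev L2Vec : Type := PiLp 2 (fun _ : Fin 3 => L2Torus)

open Classical in
/-- The entry `T_{αβ}(K, z)`, for a square integrable kernel. -/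
def faddeevEntry (l mu : Fin 3 → ℝ) (K : EuclideanSpace ℝ (Fin 3)) (z : ℝ) (a b : Fin 3) :
    L2Torus →L[ℂ] L2Torus :=
  if h : MemLp (faddeevKernel l mu K z a b) 2 ((volume : Measure Torus).prod volume) then
    IntegralOperator.ofKernel volume _ h
  else 0

/-- The Faddeev type operator `T(K, z)`, `(T w)_α = ∑_β T_{αβ} w_β`. -/
def faddeev (l mu : Fin 3 → ℝ) (K : EuclideanSpace ℝ (Fin 3)) (z : ℝ) : L2Vec →L[ℂ] L2Vec :=
  ((PiLp.continuousLinearEquiv 2 ℂ (fun _ : Fin 3 => L2Torus)).symm :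
      (Fin 3 → L2Torus) →L[ℂ] L2Vec).comp
    (ContinuousLinearMap.pi fun a => ∑ b, (faddeevEntry l mu K z a b).comp
      (PiLp.proj 2 (fun _ : Fin 3 => L2Torus) b))

theorem faddeev_apply (l mu : Fin 3 → ℝ) (K : EuclideanSpace ℝ (Fin 3)) (z : ℝ) (w : L2Vec)
    (a : Fin 3) : faddeev l mu K z w a = ∑ b, faddeevEntry l mu K z a b (w b) := by
  simp [faddeev]

/-- The entries of `T(K, z)` are square integrable kernels, i.e. `T(K, z)` is a Hilbert-Schmidt
operator. -/
def HilbertSchmidtKernels (l mu : Fin 3 → ℝ) (K : EuclideanSpace ℝ (Fin 3)) (z : ℝ) : Prop :=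
  ∀ a b, MemLp (faddeevKernel l mu K z a b) 2 ((volume : Measure Torus).prod volume)

end LatticeThreeBody

end

open LatticeThreeBody

/-!
For `ζ` below the kinetic energy `E` write `H(K) - ζ = (E - ζ) - C C*`, where `C` maps
`(w₁, w₂, w₃)` to `∑ √(μ_a (2π)⁻³) w_a(p_a)`. By the Birman-Schwinger principle the negative
directions of `H(K) - ζ` correspond to the positive ones of `C* (E - ζ)⁻¹ C - 1`. The diagonal
blocks of this operator are multiplication by `-Δ_a(K, ·, ζ)` and its off-diagonal blocks are
`√Δ_a T_{ab} √Δ_b`, so it equals `√Δ (T(K, ζ) - 1) √Δ` and has as many positive directions as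
`T(K, ζ) - 1` when `Δ_a > 0` almost everywhere (`countBelow_hamiltonian_eq_countAbove`). If some
`Δ_a` is negative somewhere, there are infinitely many negative directions. Hence, if this happens
for some `ζ` below the free spectrum, `τ_ess(K)` is the largest `τ` such that all `Δ_a(K, ·, τ)` are
nonnegative (`tauEss_spec`). Below the essential spectrum negative directions are counted by
eigenvalues (`numEigenvaluesBelow_eq_countBelow`), so the theorem reduces to two facts about small
`K ≠ 0`: some `Δ_a` is negative below the free spectrum, and `1 / Δ_a(K, ·, τ_ess(K))` is
integrable for each `a`. The latter makes the kernels of `T` square integrable, and `T` a norm limit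
of operators of finite rank.

Let the particle `a` have quasi-momentum `κ`. On this fibre `E` is, up to a translation,
`∑ (s - R_i cos q_i) + l_a ε(κ)` with `s = l_β + l_γ` and amplitudes `R_i ≤ s`, where `R_i = s` only
if the `i`-th component of `K - κ` vanishes; critical coupling means that `μ_a (2π)⁻³` times
`∫ (s ε)⁻¹` equals `1`. The minimum of `E` is not attained at `κ = K`
(`exists_energy_lt_disp`), so at the minimum some `R_i < s`, and the resolvent integral at the
threshold exceeds the one with all amplitudes equal to `s`; this is the first fact
(`exists_channelDet_neg`).

For the second fact, the resolvent integral increases with the amplitudes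
(`integral_inv_sub_cos_le`), so a zero of `Δ_a(K, ·, τ)` forces `l_a ε(κ) ≤ τ`, whence `κ = O(K)`
and the distance `f` of `τ` to the fibre threshold is `O(K²)`. The zero is a minimum of `Δ_a`.
Expanding the resolvent integral around it, with `A = ∫ (E - τ)⁻²`, the terms `g_i(h_i)` of first
order in the perturbation are nonnegative by minimality. The strict convexity of `l_a (1 - cos κ)`
and the concavity of `R` give `g_i(h) ≥ 2 g_i(h / 2) + (l_a / 20) A h²`, hence
`g_i(h) ≥ (l_a / 20) A h²`. The remainder is at most `g_i / 2` plus a multiple of `K² A h²`; here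
`f A² ≥ const`, which holds in dimension three, is used (`le_integral_inv_sub`). So for small `K`
every zero is a nondegenerate minimum (`exists_mul_disp_le_channelDet`), and `1 / Δ_a` is
integrable because `1 / ε` is (`ae_pos_and_integrable_inv`).
-/

/-! ### Dimensions of positive subspaces -/

section PositiveIndex

universe u

variable {H H' : Type u} [NormedAddCommGroup H] [InnerProductSpace ℂ H]
  [NormedAddCommGroup H'] [InnerProductSpace ℂ H']

/-- The supremum of the dimensions of the subspaces on whose nonzero vectors the function `q`
(in practice a quadratic form) is positive. -/
noncomputable def posIndex (q : H → ℝ) : ℕ∞ :=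
  ⨆ S : {S : Submodule ℂ H // ∀ f ∈ S, f ≠ 0 → 0 < q f}, Cardinal.toENat (Module.rank ℂ S.1)

theorem countAbove_eq_posIndex (z : ℝ) (A : H →L[ℂ] H) :
    countAbove z A = posIndex fun f => (inner ℂ (A f) f : ℂ).re - z * ‖f‖ ^ 2 := by
  unfold countAbove posIndex
  have h : ∀ f : H, z * ‖f‖ ^ 2 < (inner ℂ (A f) f : ℂ).re ↔
      0 < (inner ℂ (A f) f : ℂ).re - z * ‖f‖ ^ 2 := fun f => sub_pos.symm
  exact (Equiv.subtypeEquivRight fun S => forall₃_congr fun f _ _ => h f).iSup_congr fun _ => rfl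

theorem toENat_rank_le_posIndex {q : H → ℝ} (S : Submodule ℂ H)
    (hS : ∀ f ∈ S, f ≠ 0 → 0 < q f) : Cardinal.toENat (Module.rank ℂ S) ≤ posIndex q :=
  le_iSup (fun S : {S : Submodule ℂ H // ∀ f ∈ S, f ≠ 0 → 0 < q f} =>
    Cardinal.toENat (Module.rank ℂ S.1)) ⟨S, hS⟩

theorem posIndex_mono {q q' : H → ℝ} (h : ∀ f, f ≠ 0 → 0 < q f → 0 < q' f) :
    posIndex q ≤ posIndex q' :=
  iSup_le fun S => toENat_rank_le_posIndex S.1 fun f hf h0 => h f h0 (S.2 f hf h0)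

/-- A linear map that preserves positivity of vectors is injective on positive subspaces. -/
theorem posIndex_le_of_map {q : H → ℝ} {q' : H' → ℝ} (L : H →ₗ[ℂ] H')
    (h : ∀ f, f ≠ 0 → 0 < q f → 0 < q' (L f)) (h0 : q' 0 ≤ 0) : posIndex q ≤ posIndex q' := by
  refine iSup_le fun S => ?_
  have hinj : Function.Injective (L.domRestrict S.1) := by
    rw [← LinearMap.ker_eq_bot, LinearMap.ker_eq_bot']
    intro f hf
    by_contra hne
    have h1 : (f : H) ≠ 0 := fun h => hne (Subtype.ext h)
    have h2 := h f h1 (S.2 f f.2 h1)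
    have h3 : L f = 0 := hf
    rw [h3] at h2
    exact absurd h2 h0.not_gt
  have h1 : Module.rank ℂ S.1 ≤ Module.rank ℂ (S.1.map L) := by
    have hm : ∀ x : S.1, L x ∈ S.1.map L := fun x => ⟨x, x.2, rfl⟩
    refine LinearMap.rank_le_of_injective ((L.domRestrict S.1).codRestrict _ hm) ?_
    intro x y hxy
    exact hinj (congrArg Subtype.val hxy)
  refine (OrderHomClass.mono Cardinal.toENat h1).trans (toENat_rank_le_posIndex _ ?_)
  rintro _ ⟨f, hf, rfl⟩ hne
  have hf0 : f ≠ 0 := fun h => hne (by rw [h, map_zero])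
  exact h f hf0 (S.2 f hf hf0)

/-- A subspace on which `q` is positive meets the kernel of `L` trivially as soon as `q ≤ 0`
there, so the positive index is at most the rank of `L`. -/
theorem posIndex_le_rank_range {q : H → ℝ} (L : H →ₗ[ℂ] H') (W : Submodule ℂ H')
    (hW : ∀ f, L f ∈ W) (h : ∀ f, L f = 0 → q f ≤ 0) :
    posIndex q ≤ Cardinal.toENat (Module.rank ℂ W) := by
  refine iSup_le fun S => OrderHomClass.mono Cardinal.toENat ?_
  refine LinearMap.rank_le_of_injective ((L.domRestrict S.1).codRestrict _ fun x => hW x) ?_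
  rw [← LinearMap.ker_eq_bot, LinearMap.ker_eq_bot']
  intro f hf
  by_contra hne
  have h1 : (f : H) ≠ 0 := fun h => hne (Subtype.ext h)
  have h3 : L f = 0 := congrArg Subtype.val hf
  exact absurd (S.2 f f.2 h1) (h f h3).not_gt

theorem posIndex_eq_top_of_linearIndependent {q : H → ℝ} (S : Submodule ℂ H)
    (hS : ∀ f ∈ S, f ≠ 0 → 0 < q f) (v : ℕ → H) (hv : LinearIndependent ℂ v)
    (hvS : ∀ n, v n ∈ S) : posIndex q = ⊤ := by
  have h1 : LinearIndependent ℂ (fun n => (⟨v n, hvS n⟩ : S)) :=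
    LinearIndependent.of_comp S.subtype hv
  have h2 := h1.aleph0_le_rank
  exact top_le_iff.1 ((Cardinal.toENat_eq_top.2 h2).ge.trans (toENat_rank_le_posIndex S hS))

/-- Positivity of a continuous quadratic form on a finite dimensional subspace is an open
condition, so the positive index can be computed on the range of a map with dense range. -/
theorem posIndex_le_comp_of_denseRange {q : H → ℝ} (hq : Continuous q)
    (hom : ∀ (c : ℂ) f, q (c • f) = ‖c‖ ^ 2 * q f) (M : H' →L[ℂ] H) (hM : DenseRange M) :
    posIndex q ≤ posIndex fun w => q (M w) := by
  refine iSup_le fun S => ENat.forall_natCast_le_iff_le.1 fun n hn => ?_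
  obtain ⟨v, hv⟩ : ∃ v : Fin n → S.1, LinearIndependent ℂ v := by
    have h1 : (n : Cardinal) ≤ Module.rank ℂ S.1 := by simpa using hn
    obtain ⟨s, hs, hli⟩ := le_rank_iff_exists_linearIndependent.1 h1
    have e := (Cardinal.mk_eq_nat_iff.1 hs).some.symm
    exact ⟨_, hli.comp _ e.injective⟩
  have hv' : LinearIndependent ℂ (fun i => (v i : H)) :=
    hv.map' S.1.subtype (Submodule.ker_subtype _)
  have hpos : ∀ c ∈ Metric.sphere (0 : Fin n → ℂ) 1, ∀ᶠ z in 𝓝 ((fun i => (v i : H)), c),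
      0 < q (∑ i, z.2 i • z.1 i) := by
    intro c hc
    have hcont : Continuous fun z : (Fin n → H) × (Fin n → ℂ) => q (∑ i, z.2 i • z.1 i) := by
      fun_prop
    refine hcont.continuousAt.eventually (lt_mem_nhds ?_)
    refine S.2 _ (S.1.sum_mem fun i _ => S.1.smul_mem _ (v i).2) fun h0 => ?_
    have h1 := Fintype.linearIndependent_iff.1 hv' c h0
    have h2 : c = 0 := funext h1
    rw [h2] at hc
    simp at hc
  have hev := (isCompact_sphere (0 : Fin n → ℂ) 1).eventually_forall_of_forall_eventually
    (P := fun (y : Fin n → H) c => 0 < q (∑ i, c i • y i)) hpos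
  have hd : DenseRange (Pi.map fun _ : Fin n => (M : H' → H)) := DenseRange.piMap fun _ => hM
  obtain ⟨O, hO, hOo, hvO⟩ := eventually_nhds_iff.1 hev
  obtain ⟨w, hw⟩ := hd.exists_mem_open hOo ⟨_, hvO⟩
  have key : ∀ c : Fin n → ℂ, c ≠ 0 → 0 < q (M (∑ i, c i • w i)) := by
    intro c hc
    have hn : 0 < ‖c‖ := norm_pos_iff.2 hc
    have h1 := hO _ hw ((‖c‖⁻¹ : ℂ) • c) (by simp [norm_smul, hn.ne'])
    have h2 : ∑ i, ((‖c‖⁻¹ : ℂ) • c) i • Pi.map (fun _ : Fin n => (M : H' → H)) w i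
        = (‖c‖⁻¹ : ℂ) • M (∑ i, c i • w i) := by
      simp [map_sum, Finset.smul_sum, smul_smul]
    rw [h2, hom] at h1
    exact pos_of_mul_pos_right h1 (by positivity)
  have hq0 : q 0 = 0 := by simpa using hom 0 0
  have hwi : LinearIndependent ℂ w := by
    refine Fintype.linearIndependent_iff.2 fun c hc => ?_
    by_contra hne
    have : c ≠ 0 := fun h => hne (by simp [h])
    have h3 := key c this
    rw [hc, map_zero, hq0] at h3
    exact h3.false
  have hfd : FiniteDimensional ℂ (Submodule.span ℂ (Set.range w)) :=
    FiniteDimensional.span_of_finite ℂ (Set.finite_range w)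
  have h4 : Module.rank ℂ (Submodule.span ℂ (Set.range w)) = n := by
    rw [← Module.finrank_eq_rank, finrank_span_eq_card hwi, Fintype.card_fin]
  refine le_trans ?_ (toENat_rank_le_posIndex (Submodule.span ℂ (Set.range w)) ?_)
  · rw [h4]; simp
  · intro f hf hf0
    obtain ⟨c, rfl⟩ := (Submodule.mem_span_range_iff_exists_fun ℂ).1 hf
    exact key c fun h => hf0 (by simp [h])

end PositiveIndex

/-! ### Discrete spectrum and negative subspaces -/

section SpectralCount

universe u

variable {H : Type u} [NormedAddCommGroup H] [InnerProductSpace ℂ H]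

/-- The supremum of the dimensions of the subspaces on whose nonzero vectors
`(A f, f) < z (f, f)`. -/
noncomputable def countBelow (A : H →L[ℂ] H) (z : ℝ) : ℕ∞ :=
  posIndex fun f => z * ‖f‖ ^ 2 - (inner ℂ (A f) f : ℂ).re

variable [CompleteSpace H]

omit [CompleteSpace H] in
theorem mem_realSpectrum_iff {A : H →L[ℂ] H} {t : ℝ} :
    t ∈ realSpectrum A ↔ t ∈ spectrum ℝ A := by
  have := spectrum.algebraMap_mem_iff (R := ℝ) ℂ (A := H →L[ℂ] H) (a := A) (r := t)
  simpa [realSpectrum] using this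

omit [CompleteSpace H] in
theorem realSpectrum_eq {A : H →L[ℂ] H} : realSpectrum A = spectrum ℝ A :=
  Set.ext fun _ => mem_realSpectrum_iff

theorem re_inner_cfc_nonneg {A : H →L[ℂ] H} {f : ℝ → ℝ}
    (hf : ∀ x ∈ spectrum ℝ A, 0 ≤ f x) (v : H) : 0 ≤ (inner ℂ (cfc f A v) v : ℂ).re := by
  have h : (0 : H →L[ℂ] H) ≤ cfc f A := cfc_nonneg hf
  exact (ContinuousLinearMap.nonneg_iff_isPositive _ |>.1 h).re_inner_nonneg_left v

omit [CompleteSpace H] in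
theorem mem_realEigenspace_iff {A : H →L[ℂ] H} {t : ℝ} {v : H} :
    v ∈ realEigenspace A t ↔ A v = (t : ℂ) • v := Module.End.mem_eigenspace_iff

omit [CompleteSpace H] in
theorem inner_sum_orthogonal {ι : Type*} {V : ι → Submodule ℂ H}
    (hV : OrthogonalFamily ℂ (fun i => V i) fun i => (V i).subtypeₗᵢ) (f g : ι → H)
    (hf : ∀ i, f i ∈ V i) (hg : ∀ i, g i ∈ V i) (s : Finset ι) :
    inner ℂ (∑ i ∈ s, f i) (∑ i ∈ s, g i) = ∑ i ∈ s, inner ℂ (f i) (g i) := by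
  rw [sum_inner]
  refine Finset.sum_congr rfl fun i hi => ?_
  rw [inner_sum]
  refine Finset.sum_eq_single i (fun j _ hj => ?_) (fun h => absurd hi h)
  exact hV hj.symm ⟨f i, hf i⟩ ⟨g j, hg j⟩

/-- On sums of eigenvectors with eigenvalues below `z` the form of `A` is less than `z`. -/
theorem numEigenvaluesBelow_le_countBelow {A : H →L[ℂ] H} (hA : IsSelfAdjoint A) (z : ℝ) :
    numEigenvaluesBelow A z ≤ countBelow A z := by
  refine toENat_rank_le_posIndex _ fun f hf hf0 => ?_
  have hsym : (A : H →ₗ[ℂ] H).IsSymmetric := hA.isSymmetric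
  have horth : OrthogonalFamily ℂ (fun t : Set.Iio z => realEigenspace A t)
      fun t => (realEigenspace A t).subtypeₗᵢ :=
    hsym.orthogonalFamily_eigenspaces.comp (f := fun t : Set.Iio z => ((t : ℝ) : ℂ))
      (fun a b h => Subtype.ext (Complex.ofReal_injective h))
  obtain ⟨g, hg, rfl⟩ := (Submodule.mem_iSup_iff_exists_finsupp _ _).1 hf
  have hAg : A (g.sum fun _ x => x) = ∑ t ∈ g.support, ((t : ℝ) : ℂ) • g t := by
    rw [Finsupp.sum, map_sum]
    exact Finset.sum_congr rfl fun t _ => mem_realEigenspace_iff.1 (hg t)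
  have h1 := inner_sum_orthogonal horth (fun t => ((t : ℝ) : ℂ) • g t) g
    (fun t => (realEigenspace A t).smul_mem _ (hg t)) hg g.support
  have h2 := inner_sum_orthogonal horth g g hg hg g.support
  have h3 : ‖g.sum fun _ x => x‖ ^ 2 = ∑ t ∈ g.support, ‖g t‖ ^ 2 := by
    have h := congrArg Complex.re h2
    rw [Complex.re_sum] at h
    have e : ∀ x : H, (inner ℂ x x : ℂ).re = ‖x‖ ^ 2 := fun x => by
      rw [← inner_self_eq_norm_sq (𝕜 := ℂ) x]; rfl
    simp only [e] at h
    exact h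
  have h4 : (inner ℂ (A (g.sum fun _ x => x)) (g.sum fun _ x => x) : ℂ).re
      = ∑ t ∈ g.support, (t : ℝ) * ‖g t‖ ^ 2 := by
    rw [hAg, Finsupp.sum, h1, Complex.re_sum]
    refine Finset.sum_congr rfl fun t _ => ?_
    rw [inner_smul_left, Complex.conj_ofReal, Complex.re_ofReal_mul,
      ← inner_self_eq_norm_sq (𝕜 := ℂ) (g t)]
    rfl
  rw [h3, h4, Finset.mul_sum, ← Finset.sum_sub_distrib]
  have hne : g.support.Nonempty := by
    by_contra h
    rw [Finset.not_nonempty_iff_eq_empty, Finsupp.support_eq_empty] at h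
    exact hf0 (by simp [h])
  refine Finset.sum_pos (fun t ht => ?_) hne
  have : 0 < ‖g t‖ := norm_pos_iff.2 (Finsupp.mem_support_iff.1 ht)
  have ht' : (t : ℝ) < z := t.2
  nlinarith [sq_pos_of_pos this]

/-- The indicator of a point that is not an accumulation point of `σ` is continuous on `σ`, so the
continuous functional calculus yields the spectral projection of an isolated point. -/
theorem continuousOn_indicator_of_not_accPt {σ : Set ℝ} {t : ℝ} (ht : ¬ AccPt t (𝓟 σ)) :
    ContinuousOn (fun x => if x = t then (1 : ℝ) else 0) σ := by
  intro x hx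
  by_cases h : x = t
  · subst h
    have h1 : 𝓝[σ] x ≤ pure x := by
      have : 𝓝[≠] x ⊓ 𝓟 σ = ⊥ := by
        rw [AccPt, neBot_iff, not_not] at ht
        exact ht
      have h2 : 𝓝[σ \ {x}] x = ⊥ := by
        rw [← this, nhdsWithin, nhdsWithin, inf_assoc, inf_principal, Set.inter_comm]; rfl
      have h3 : σ ⊆ (σ \ {x}) ∪ {x} := fun y hy => by
        by_cases e : y = x
        · right; exact e
        · left; exact ⟨hy, e⟩
      calc 𝓝[σ] x ≤ 𝓝[(σ \ {x}) ∪ {x}] x := nhdsWithin_mono _ h3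
        _ = pure x := by rw [nhdsWithin_union, h2, nhdsWithin_singleton, bot_sup_eq]
    exact (tendsto_pure_nhds _ x).mono_left h1
  · have : ∀ᶠ y in 𝓝 x, (fun x => if x = t then (1 : ℝ) else 0) y = 0 := by
      filter_upwards [isOpen_ne.mem_nhds h] with y hy
      exact if_neg hy
    exact (continuousAt_const.congr (f := fun _ => (0 : ℝ))
      (this.mono fun y hy => hy.symm)).continuousWithinAt

theorem cfc_indicator_apply_mem_realEigenspace {A : H →L[ℂ] H} (hA : IsSelfAdjoint A) {t : ℝ}
    (ht : ¬ AccPt t (𝓟 (spectrum ℝ A))) (v : H) :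
    cfc (fun x => if x = t then (1 : ℝ) else 0) A v ∈ realEigenspace A t := by
  rw [mem_realEigenspace_iff]
  have hc := continuousOn_indicator_of_not_accPt ht
  have h1 : A * cfc (fun x => if x = t then (1 : ℝ) else 0) A
      = t • cfc (fun x => if x = t then (1 : ℝ) else 0) A := by
    conv_lhs => rw [← cfc_id' ℝ A]
    rw [← cfc_const_mul t _ A hc]
    conv_lhs => rw [cfc_id' ℝ A]
    nth_rewrite 1 [← cfc_id' ℝ A]
    rw [← cfc_mul _ _ A (by fun_prop) hc]
    refine cfc_congr fun x _ => ?_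
    by_cases h : x = t <;> simp [h]
  have h2 := congrArg (fun B : H →L[ℂ] H => B v) h1
  simpa using h2

/-- Isolated points of the spectrum of a self-adjoint operator are eigenvalues. -/
theorem realEigenspace_ne_bot {A : H →L[ℂ] H} (hA : IsSelfAdjoint A) {t : ℝ}
    (hs : t ∈ spectrum ℝ A) (ht : ¬ AccPt t (𝓟 (spectrum ℝ A))) : realEigenspace A t ≠ ⊥ := by
  intro hbot
  have hc := continuousOn_indicator_of_not_accPt ht
  have h0 : cfc (fun x => if x = t then (1 : ℝ) else 0) A = cfc (fun _ => (0 : ℝ)) A := by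
    rw [cfc_const_zero]
    ext v
    have := cfc_indicator_apply_mem_realEigenspace hA ht v
    rw [hbot] at this
    simpa using this
  have h1 := eqOn_of_cfc_eq_cfc h0 hc continuousOn_const hA hs
  simp at h1

/-- If the spectrum below `z` is finite, the eigenvectors below `z` span a subspace on whose
orthogonal complement `A ≥ z`. -/
theorem countBelow_le_numEigenvaluesBelow {A : H →L[ℂ] H} (hA : IsSelfAdjoint A) {z : ℝ}
    (hfin : (spectrum ℝ A ∩ Set.Iio z).Finite)
    (hiso : ∀ t ∈ spectrum ℝ A, t < z → ¬ AccPt t (𝓟 (spectrum ℝ A))) :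
    countBelow A z ≤ numEigenvaluesBelow A z := by
  classical
  set F := hfin.toFinset with hF
  have hmemF : ∀ t, t ∈ F ↔ t ∈ spectrum ℝ A ∧ t < z := fun t => by simp [hF]
  have hcont : ∀ t ∈ F, ContinuousOn (fun x => if x = t then (1 : ℝ) else 0) (spectrum ℝ A) :=
    fun t ht => continuousOn_indicator_of_not_accPt (hiso t ((hmemF t).1 ht).1 ((hmemF t).1 ht).2)
  set P : H →L[ℂ] H := ∑ t ∈ F, cfc (fun x => if x = t then (1 : ℝ) else 0) A with hP
  have hcs : ContinuousOn (∑ t ∈ F, fun x => if x = t then (1 : ℝ) else 0) (spectrum ℝ A) := by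
    have := continuousOn_finsetSum F hcont
    convert this using 1
    ext x; simp
  have hPc : P = cfc (∑ t ∈ F, fun x => if x = t then (1 : ℝ) else 0) A := (cfc_sum _ A F hcont).symm
  refine posIndex_le_rank_range (P : H →ₗ[ℂ] H) _ (fun f => ?_) fun f hf => ?_
  · simp only [hP, ContinuousLinearMap.coe_coe, sum_apply]
    refine Submodule.sum_mem _ fun t ht => ?_
    have h1 := (hmemF t).1 ht
    exact Submodule.mem_iSup_of_mem (⟨t, h1.2⟩ : Set.Iio z)
      (cfc_indicator_apply_mem_realEigenspace hA (hiso t h1.1 h1.2) f)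
  · have h2 : cfc (fun x => (x - z) * (1 - (∑ t ∈ F, fun x => if x = t then (1 : ℝ) else 0) x)) A
        = (A - algebraMap ℝ (H →L[ℂ] H) z) * (1 - P) := by
      rw [cfc_mul _ _ A (by fun_prop) (by fun_prop), cfc_sub _ _ A (by fun_prop) (by fun_prop),
        cfc_sub _ _ A (by fun_prop) hcs, cfc_id' ℝ A, cfc_const z A, cfc_const 1 A, map_one, hPc]
    have h3 := re_inner_cfc_nonneg (A := A)
      (f := fun x => (x - z) * (1 - (∑ t ∈ F, fun x => if x = t then (1 : ℝ) else 0) x)) ?_ f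
    · rw [h2] at h3
      have h4 : P f = 0 := hf
      have h5 : ((A - algebraMap ℝ (H →L[ℂ] H) z) * (1 - P)) f = A f - (z : ℂ) • f := by
        simp [h4, Algebra.algebraMap_eq_smul_one]
      rw [h5, inner_sub_left, inner_smul_left, Complex.sub_re, Complex.conj_ofReal,
        Complex.re_ofReal_mul] at h3
      have h6 : (inner ℂ f f : ℂ).re = ‖f‖ ^ 2 := inner_self_eq_norm_sq (𝕜 := ℂ) f
      rw [h6] at h3
      linarith
    · intro x hx
      have e : (∑ t ∈ F, fun x => if x = t then (1 : ℝ) else 0) x = if x ∈ F then 1 else 0 := by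
        simp [Finset.sum_apply]
      rw [e]
      by_cases h : x ∈ F
      · simp [h]
      · have : z ≤ x := by
          by_contra h'
          exact h ((hmemF x).2 ⟨hx, not_le.1 h'⟩)
        simp [h, this]

/-- Below the essential spectrum, eigenvalues are counted by negative subspaces. -/
theorem numEigenvaluesBelow_eq_countBelow {A : H →L[ℂ] H} (hA : IsSelfAdjoint A) {z : ℝ}
    (hz : ∀ t ∈ essSpectrum A, z ≤ t) : numEigenvaluesBelow A z = countBelow A z := by
  refine le_antisymm (numEigenvaluesBelow_le_countBelow hA z) ?_
  by_cases hN : numEigenvaluesBelow A z = ⊤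
  · rw [hN]; exact le_top
  have hiso : ∀ t ∈ spectrum ℝ A, t < z → ¬ AccPt t (𝓟 (spectrum ℝ A)) := by
    intro t ht htz hacc
    refine (hz t ⟨mem_realSpectrum_iff.2 ht, Or.inl ?_⟩).not_gt htz
    rwa [realSpectrum_eq]
  refine countBelow_le_numEigenvaluesBelow hA ?_ hiso
  by_contra hinf
  have hinf' : (spectrum ℝ A ∩ Set.Iio z).Infinite := hinf
  refine hN ?_
  set e := hinf'.natEmbedding with he
  have hsym : (A : H →ₗ[ℂ] H).IsSymmetric := hA.isSymmetric
  have hex : ∀ n, ∃ v ∈ realEigenspace A (e n), v ≠ 0 := fun n =>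
    Submodule.exists_mem_ne_zero_of_ne_bot
      (realEigenspace_ne_bot hA (e n).2.1 (hiso _ (e n).2.1 (e n).2.2))
  choose v hv hv0 using hex
  have hlin : LinearIndependent ℂ v := by
    refine linearIndependent_of_ne_zero_of_inner_eq_zero hv0 fun i j hij => ?_
    have hne : ((e i : ℝ) : ℂ) ≠ ((e j : ℝ) : ℂ) := fun h =>
      hij (e.injective (Subtype.ext (Complex.ofReal_injective h)))
    exact hsym.orthogonalFamily_eigenspaces hne ⟨v i, hv i⟩ ⟨v j, hv j⟩
  have h1 : LinearIndependent ℂ (fun n => (⟨v n, Submodule.mem_iSup_of_mem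
      (⟨(e n : ℝ), (e n).2.2⟩ : Set.Iio z) (hv n)⟩ :
      ↥(⨆ t : Set.Iio z, realEigenspace A t))) :=
    LinearIndependent.of_comp (Submodule.subtype _) hlin
  exact Cardinal.toENat_eq_top.2 h1.aleph0_le_rank

/-- If `A` has infinitely many negative directions relative to `z`, then the essential spectrum
meets `(-∞, z]`. -/
theorem exists_essSpectrum_le_of_countBelow_eq_top {A : H →L[ℂ] H} (hA : IsSelfAdjoint A) {z : ℝ}
    (hz : countBelow A z = ⊤) : ∃ t ∈ essSpectrum A, t ≤ z := by
  by_contra! hno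
  have hiso : ∀ t ∈ spectrum ℝ A, t ≤ z → ¬ AccPt t (𝓟 (spectrum ℝ A)) := by
    intro t ht htz hacc
    refine (hno t ⟨mem_realSpectrum_iff.2 ht, Or.inl ?_⟩).not_ge htz
    rwa [realSpectrum_eq]
  have hcpt : IsCompact (spectrum ℝ A ∩ Set.Iic z) :=
    (ContinuousFunctionalCalculus.isCompact_spectrum (R := ℝ) A).inter_right isClosed_Iic
  have hfin : (spectrum ℝ A ∩ Set.Iic z).Finite := by
    by_contra hinf
    obtain ⟨t, ht, hacc⟩ := Set.Infinite.exists_accPt_of_subset_isCompact hinf hcpt subset_rfl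
    exact hiso t ht.1 ht.2 (hacc.mono (principal_mono.2 Set.inter_subset_left))
  have hfin' : (spectrum ℝ A ∩ Set.Iio z).Finite :=
    hfin.subset (Set.inter_subset_inter_right _ Set.Iio_subset_Iic_self)
  have h1 := countBelow_le_numEigenvaluesBelow hA hfin' fun t ht h => hiso t ht h.le
  rw [hz, top_le_iff, numEigenvaluesBelow] at h1
  have h2 := Cardinal.toENat_eq_top.1 h1
  have hsup : (⨆ t : Set.Iio z, realEigenspace A t)
      ≤ ⨆ t : ↥(spectrum ℝ A ∩ Set.Iio z), realEigenspace A t := by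
    refine iSup_le fun t => ?_
    by_cases ht : (t : ℝ) ∈ spectrum ℝ A
    · exact le_iSup (fun t : ↥(spectrum ℝ A ∩ Set.Iio z) => realEigenspace A t) ⟨t, ht, t.2⟩
    · suffices realEigenspace A t = ⊥ by rw [this]; exact bot_le
      by_contra hne
      refine ht (mem_realSpectrum_iff.1 ?_)
      have hev : Module.End.HasEigenvalue (A : H →ₗ[ℂ] H) ((t : ℝ) : ℂ) := hne
      have hmem := hev.mem_spectrum
      rw [realSpectrum, Set.mem_ofPred_eq, ContinuousLinearMap.spectrum_eq]
      exact hmem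
  have hfd : FiniteDimensional ℂ ↥(⨆ t : ↥(spectrum ℝ A ∩ Set.Iio z), realEigenspace A t) := by
    have : Finite ↥(spectrum ℝ A ∩ Set.Iio z) := hfin'
    have : ∀ t : ↥(spectrum ℝ A ∩ Set.Iio z), FiniteDimensional ℂ (realEigenspace A t) := by
      intro t
      by_contra h
      exact (hno t ⟨mem_realSpectrum_iff.2 t.2.1, Or.inr h⟩).not_ge (le_of_lt t.2.2)
    exact Submodule.finiteDimensional_iSup _
  have h3 := Submodule.finiteDimensional_of_le hsup
  exact h2.not_gt (Module.rank_lt_aleph0 ℂ _)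

/-- If `A` has finitely many negative directions relative to `z`, then the essential spectrum
does not meet `(-∞, z)`: for `t < z' < z` the range of `(z' - A)₊` is finite dimensional, so a
polynomial annihilates it and the spectrum below `z'` is finite. -/
theorem le_of_mem_essSpectrum_of_countBelow_ne_top {A : H →L[ℂ] H} (hA : IsSelfAdjoint A) {z : ℝ}
    (hz : countBelow A z ≠ ⊤) : ∀ t ∈ essSpectrum A, z ≤ t := by
  intro t ht
  by_contra! htz
  obtain ⟨z', htz', hz'⟩ := exists_between htz
  set g : ℝ → ℝ := fun x => max (z' - x) 0 with hg
  have hgc : Continuous g := by fun_prop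
  set G := cfc g A with hG
  set S := LinearMap.range (G : H →ₗ[ℂ] H) with hS
  have hGsa : IsSelfAdjoint G := cfc_predicate g A
  have hSrank : FiniteDimensional ℂ S := by
    by_contra hinf
    have h0 : ∀ f ∈ S, f ≠ 0 → 0 < z * ‖f‖ ^ 2 - (inner ℂ (A f) f : ℂ).re := by
      rintro _ ⟨u, rfl⟩ hne
      have h1 : cfc (fun x => g x * ((z' - x) * g x)) A
          = G * ((algebraMap ℝ (H →L[ℂ] H) z' - A) * G) := by
        rw [cfc_mul _ _ A (by fun_prop) (by fun_prop), cfc_mul _ _ A (by fun_prop) (by fun_prop),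
          cfc_sub _ _ A (by fun_prop) (by fun_prop), cfc_const z' A, cfc_id' ℝ A]
      have h2 := re_inner_cfc_nonneg (A := A) (f := fun x => g x * ((z' - x) * g x)) (by
        intro x _
        simp only [hg]
        rcases le_total (z' - x) 0 with h | h
        · simp [h]
        · rw [max_eq_left h]; positivity) u
      rw [h1] at h2
      have h3 : (inner ℂ ((G * ((algebraMap ℝ (H →L[ℂ] H) z' - A) * G)) u) u : ℂ)
          = inner ℂ ((z' : ℂ) • G u - A (G u)) (G u) := by
        have := hGsa.isSymmetric ((z' : ℂ) • G u - A (G u)) u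
        simp only [ContinuousLinearMap.coe_coe] at this
        rw [← this]
        congr 1
      rw [h3, inner_sub_left, inner_smul_left, Complex.sub_re, Complex.conj_ofReal,
        Complex.re_ofReal_mul] at h2
      have h6 : (inner ℂ (G u) (G u) : ℂ).re = ‖G u‖ ^ 2 := inner_self_eq_norm_sq (𝕜 := ℂ) (G u)
      rw [h6] at h2
      have h7 : 0 < ‖G u‖ ^ 2 := by
        have : G u ≠ 0 := hne
        positivity
      simp only [ContinuousLinearMap.coe_coe]
      nlinarith
    have h1 := toENat_rank_le_posIndex (q := fun f => z * ‖f‖ ^ 2 - (inner ℂ (A f) f : ℂ).re) S h0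
    have h2 : Cardinal.toENat (Module.rank ℂ S) = ⊤ := by
      refine Cardinal.toENat_eq_top.2 ?_
      by_contra h
      exact hinf (Module.rank_lt_aleph0_iff.1 (not_le.1 h))
    rw [h2, top_le_iff] at h1
    exact hz h1
  have hcomm : A * G = G * A := by
    have := cfc_commute_cfc (id : ℝ → ℝ) g A
    rw [cfc_id ℝ A] at this
    exact this
  rcases ht.2 with hacc | hinf
  -- An accumulation point: the characteristic polynomial of `A` on the range of `G` annihilates
  -- the spectrum below `z'`.
  · have hAS : ∀ x ∈ S, (A : H →ₗ[ℂ] H) x ∈ S := by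
      rintro _ ⟨u, rfl⟩
      exact ⟨A u, (congrArg (fun B : H →L[ℂ] H => B u) hcomm).symm⟩
    obtain ⟨p, hp0, hpS⟩ : ∃ p : Polynomial ℝ, p ≠ 0 ∧
        Polynomial.aeval ((A : H →ₗ[ℂ] H).restrict hAS) p = 0 := by
      have hfd : Module.Finite ℝ S := Module.Finite.trans ℂ S
      set A' : S →ₗ[ℝ] S := ((A : H →ₗ[ℂ] H).restrict hAS).restrictScalars ℝ
      refine ⟨LinearMap.charpoly A', (LinearMap.charpoly_monic A').ne_zero, ?_⟩
      have h := LinearMap.aeval_self_charpoly A'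
      have hpow : ∀ (n : ℕ) (x : S), (A' ^ n) x = (((A : H →ₗ[ℂ] H).restrict hAS) ^ n) x := by
        intro n
        induction n with
        | zero => intro x; rfl
        | succ n ih => intro x; rw [pow_succ, pow_succ]; exact ih _
      ext1 x
      have hx := congrArg (fun B : S →ₗ[ℝ] S => B x) h
      simp only [Polynomial.aeval_eq_sum_range, LinearMap.sum_apply, LinearMap.smul_apply,
        hpow] at hx ⊢
      exact hx
    have hpA : Polynomial.aeval A p * G = 0 := by
      ext u
      have h1 : ∀ (n : ℕ) (x : S), ((((A : H →ₗ[ℂ] H).restrict hAS) ^ n) x : H) = (A ^ n) x := by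
        intro n
        induction n with
        | zero => intro x; rfl
        | succ n ih => intro x; rw [pow_succ, pow_succ]; exact ih _
      have h2 := congrArg (fun B : S →ₗ[ℂ] S => (B ⟨G u, u, rfl⟩ : H)) hpS
      simp only [Polynomial.aeval_eq_sum_range, LinearMap.sum_apply, LinearMap.smul_apply,
        Submodule.coe_sum, LinearMap.zero_apply, Submodule.coe_zero] at h2
      rw [zero_apply, ← h2, Polynomial.aeval_eq_sum_range, mul_apply_eq_comp,
        sum_apply]
      exact Finset.sum_congr rfl fun n _ => by
        rw [Submodule.coe_smul_of_tower, h1]; rfl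
    have h3 : cfc (fun x => p.eval x * g x) A = cfc (fun _ => (0 : ℝ)) A := by
      rw [cfc_mul _ _ A p.continuous.continuousOn hgc.continuousOn, cfc_const_zero]
      have := cfc_polynomial p A
      rw [this]
      exact hpA
    have h4 := eqOn_of_cfc_eq_cfc h3 (by fun_prop) continuousOn_const hA
    have hsub : spectrum ℝ A ∩ Set.Iio z' ⊆ p.rootSet ℝ := by
      rintro x ⟨hx, hxz⟩
      have h5 := h4 hx
      have h6 : g x ≠ 0 := by
        have : 0 < z' - x := sub_pos.2 hxz
        simp only [hg]
        rw [max_eq_left this.le]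
        exact this.ne'
      have h7 : p.eval x = 0 := by simpa [h6] using h5
      rw [Polynomial.mem_rootSet]
      exact ⟨hp0, by simpa using h7⟩
    have hfin : (spectrum ℝ A ∩ Set.Iio z').Finite := (p.rootSet_finite ℝ).subset hsub
    rw [realSpectrum_eq, accPt_iff_frequently_nhdsNE] at hacc
    have h8 : ∃ᶠ y in 𝓝[≠] t, y ∈ spectrum ℝ A ∩ Set.Iio z' :=
      hacc.and_eventually (nhdsWithin_le_nhds (Iio_mem_nhds htz'))
    refine h8 ?_
    have h9 : ((spectrum ℝ A ∩ Set.Iio z') \ {t})ᶜ ∈ 𝓝 t :=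
      hfin.sdiff.isClosed.isOpen_compl.mem_nhds fun h => h.2 rfl
    filter_upwards [nhdsWithin_le_nhds h9, self_mem_nhdsWithin] with y hy hyt hyF
    exact hy ⟨hyF, hyt⟩
  · have h0 : ∀ f ∈ realEigenspace A t, f ≠ 0 → 0 < z * ‖f‖ ^ 2 - (inner ℂ (A f) f : ℂ).re := by
      intro f hf hne
      have h6 : (inner ℂ f f : ℂ).re = ‖f‖ ^ 2 := inner_self_eq_norm_sq (𝕜 := ℂ) f
      rw [mem_realEigenspace_iff.1 hf, inner_smul_left, Complex.conj_ofReal,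
        Complex.re_ofReal_mul, h6]
      have : 0 < ‖f‖ ^ 2 := by positivity
      nlinarith
    have h1 := toENat_rank_le_posIndex (q := fun f => z * ‖f‖ ^ 2 - (inner ℂ (A f) f : ℂ).re)
      (realEigenspace A t) h0
    have h2 : Cardinal.toENat (Module.rank ℂ (realEigenspace A t)) = ⊤ := by
      refine Cardinal.toENat_eq_top.2 ?_
      by_contra h
      exact hinf (Module.rank_lt_aleph0_iff.1 (not_le.1 h))
    rw [h2, top_le_iff] at h1
    exact hz h1

end SpectralCount

/-! ### Norm limits of finite rank operators -/

section FiniteRank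

universe u

variable {H H' : Type u} [NormedAddCommGroup H] [InnerProductSpace ℂ H]
  [NormedAddCommGroup H'] [InnerProductSpace ℂ H']

/-- The subspace of the bounded operators of finite rank. -/
def finiteRankOperators (H H' : Type u) [NormedAddCommGroup H] [InnerProductSpace ℂ H]
    [NormedAddCommGroup H'] [InnerProductSpace ℂ H'] : Submodule ℂ (H →L[ℂ] H') where
  carrier := {F | FiniteDimensional ℂ (LinearMap.range (F : H →ₗ[ℂ] H'))}
  zero_mem' := by
    have : LinearMap.range ((0 : H →L[ℂ] H') : H →ₗ[ℂ] H') = ⊥ := by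
      rw [LinearMap.range_eq_bot]; rfl
    rw [Set.mem_ofPred_eq, this]
    infer_instance
  add_mem' := by
    intro F G hF hG
    rw [Set.mem_ofPred_eq] at hF hG ⊢
    refine Submodule.finiteDimensional_of_le (S₂ := LinearMap.range (F : H →ₗ[ℂ] H')
      ⊔ LinearMap.range (G : H →ₗ[ℂ] H')) ?_
    rintro _ ⟨x, rfl⟩
    exact Submodule.add_mem_sup ⟨x, rfl⟩ ⟨x, rfl⟩
  smul_mem' := by
    intro c F hF
    rw [Set.mem_ofPred_eq] at hF ⊢
    refine Submodule.finiteDimensional_of_le (S₂ := LinearMap.range (F : H →ₗ[ℂ] H')) ?_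
    rintro _ ⟨x, rfl⟩
    exact Submodule.smul_mem _ c ⟨x, rfl⟩

theorem mem_finiteRankOperators_of_forall_mem {F : H →L[ℂ] H'} (W : Submodule ℂ H')
    [FiniteDimensional ℂ W] (h : ∀ f, F f ∈ W) : F ∈ finiteRankOperators H H' :=
  Submodule.finiteDimensional_of_le (S₂ := W) (by rintro _ ⟨x, rfl⟩; exact h x)

theorem comp_comp_mem_closure_finiteRankOperators {K K' : Type u} [NormedAddCommGroup K]
    [InnerProductSpace ℂ K] [NormedAddCommGroup K'] [InnerProductSpace ℂ K'] (P : H' →L[ℂ] K')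
    (Q : K →L[ℂ] H) {F : H →L[ℂ] H'}
    (hF : F ∈ (finiteRankOperators H H').topologicalClosure) :
    P.comp (F.comp Q) ∈ (finiteRankOperators K K').topologicalClosure := by
  have hc : Continuous fun F : H →L[ℂ] H' => P.comp (F.comp Q) := by fun_prop
  refine map_mem_closure (f := fun F : H →L[ℂ] H' => P.comp (F.comp Q)) hc hF fun G hG => ?_
  have hfd : FiniteDimensional ℂ (LinearMap.range (G : H →ₗ[ℂ] H')) := hG
  refine mem_finiteRankOperators_of_forall_mem
    ((LinearMap.range (G : H →ₗ[ℂ] H')).map (P : H' →ₗ[ℂ] K')) fun f => ?_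
  exact ⟨G (Q f), ⟨Q f, rfl⟩, rfl⟩

theorem isCompactOperator_of_mem_closure_finiteRankOperators [CompleteSpace H']
    {F : H →L[ℂ] H'} (hF : F ∈ (finiteRankOperators H H').topologicalClosure) :
    IsCompactOperator F := by
  refine closure_minimal ?_ isClosed_setOfPred_isCompactOperator hF
  intro G hG
  have hfd : FiniteDimensional ℂ (LinearMap.range (G : H →ₗ[ℂ] H')) := hG
  have hlc : ProperSpace (LinearMap.range (G : H →ₗ[ℂ] H')) := FiniteDimensional.proper ℂ _
  set G' : H →L[ℂ] LinearMap.range (G : H →ₗ[ℂ] H') :=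
    G.codRestrict _ fun x => ⟨x, rfl⟩
  have h1 : IsCompactOperator (id : LinearMap.range (G : H →ₗ[ℂ] H') → _) :=
    isCompactOperator_id
  exact ((h1.comp_clm G').clm_comp (LinearMap.range (G : H →ₗ[ℂ] H')).subtypeL)

/-- On the kernel of an operator `F` of finite rank with `‖T - F‖ < z` the form of `T` is at most
`z`. -/
theorem countAbove_ne_top_of_mem_closure_finiteRankOperators {T : H →L[ℂ] H}
    (hT : T ∈ (finiteRankOperators H H).topologicalClosure) {z : ℝ} (hz : 0 < z) :
    countAbove z T ≠ ⊤ := by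
  obtain ⟨F, hF, hd⟩ := Metric.mem_closure_iff.1 hT z hz
  have hfd : FiniteDimensional ℂ (LinearMap.range (F : H →ₗ[ℂ] H)) := hF
  rw [countAbove_eq_posIndex]
  have h1 := posIndex_le_rank_range (q := fun f => (inner ℂ (T f) f : ℂ).re - z * ‖f‖ ^ 2)
    (F : H →ₗ[ℂ] H) (LinearMap.range (F : H →ₗ[ℂ] H)) (fun f => ⟨f, rfl⟩) (fun f hf => by
      have e : F f = 0 := hf
      have h2 : T f = (T - F) f := by simp [e]
      have h3 : (inner ℂ (T f) f : ℂ).re ≤ ‖T - F‖ * ‖f‖ * ‖f‖ := by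
        rw [h2]
        refine (Complex.re_le_norm _).trans ((norm_inner_le_norm _ _).trans ?_)
        gcongr
        exact (T - F).le_opNorm f
      rw [dist_eq_norm] at hd
      nlinarith [mul_nonneg (sub_nonneg.2 hd.le) (sq_nonneg ‖f‖)])
  intro htop
  rw [htop, top_le_iff] at h1
  exact (Cardinal.toENat_eq_top.1 h1).not_gt (Module.rank_lt_aleph0 ℂ _)

theorem countAbove_anti (T : H →L[ℂ] H) {y z : ℝ} (h : y ≤ z) :
    countAbove z T ≤ countAbove y T := by
  rw [countAbove_eq_posIndex, countAbove_eq_posIndex]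
  refine posIndex_mono fun f _ hf => ?_
  nlinarith [sq_nonneg ‖f‖]

/-- A nonincreasing sequence of natural numbers is eventually constant, so the counting function
has a left limit at `1` as soon as it is finite. -/
theorem exists_tendsto_countAbove {T : H →L[ℂ] H} (hT : ∀ z, 0 < z → countAbove z T ≠ ⊤) :
    ∃ L : ℕ, Tendsto (fun γ : ℝ => countAbove (1 - γ) T) (𝓝[>] 0) (𝓝 (L : ℕ∞)) ∧
      countAbove 1 T ≤ L := by
  classical
  have hex : ∃ n : ℕ, ∃ γ : ℝ, 0 < γ ∧ γ < 1 ∧ countAbove (1 - γ) T = n := by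
    obtain ⟨n, hn⟩ := ENat.ne_top_iff_exists.1 (hT (1 - 1 / 2) (by norm_num))
    exact ⟨n, 1 / 2, by norm_num, by norm_num, hn.symm⟩
  obtain ⟨γ, h0, h1, hγ⟩ := Nat.find_spec hex
  refine ⟨Nat.find hex, ?_, ?_⟩
  · refine tendsto_const_nhds.congr' ?_
    filter_upwards [Ioo_mem_nhdsGT h0] with x hx
    refine le_antisymm ?_ ?_
    · obtain ⟨n, hn⟩ := ENat.ne_top_iff_exists.1 (hT (1 - x) (by linarith [hx.2]))
      rw [← hn]
      exact_mod_cast Nat.find_min' hex ⟨x, hx.1, hx.2.trans h1, hn.symm⟩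
    · rw [← hγ]
      exact countAbove_anti T (by linarith [hx.2])
  · rw [← hγ]
    exact countAbove_anti T (by linarith)

end FiniteRank

/-! ### The Birman-Schwinger principle -/

section BirmanSchwinger

universe u

variable {H H' : Type u} [NormedAddCommGroup H] [InnerProductSpace ℂ H] [CompleteSpace H]
  [NormedAddCommGroup H'] [InnerProductSpace ℂ H'] [CompleteSpace H']

/-- The Birman-Schwinger principle for `B = z + A - C C*` with `A ≥ 0` invertible and `G = A⁻¹`.
The maps `f ↦ C* f` and `w ↦ G C w` carry negative subspaces of `B - z` to positive subspaces of
`C* G C - 1` and back. -/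
theorem countBelow_eq_posIndex_of_factor {A G B : H →L[ℂ] H} {C : H' →L[ℂ] H} {z : ℝ}
    (hsym : ∀ f g, inner ℂ (A f) g = inner ℂ f (A g)) (hA : ∀ f, 0 ≤ (inner ℂ (A f) f : ℂ).re)
    (hGA : ∀ f, A (G f) = f)
    (hB : ∀ f, B f = A f + (z : ℂ) • f - C (ContinuousLinearMap.adjoint C f)) :
    countBelow B z = posIndex fun w => (inner ℂ (G (C w)) (C w) : ℂ).re - ‖w‖ ^ 2 := by
  set D := ContinuousLinearMap.adjoint C with hD
  have hsq : ∀ f, (inner ℂ (C (D f)) f : ℂ).re = ‖D f‖ ^ 2 := fun f => by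
    rw [← ContinuousLinearMap.adjoint_inner_right]
    exact inner_self_eq_norm_sq (𝕜 := ℂ) (D f)
  have hq : ∀ f, z * ‖f‖ ^ 2 - (inner ℂ (B f) f : ℂ).re
      = ‖D f‖ ^ 2 - (inner ℂ (A f) f : ℂ).re := fun f => by
    have h6 : (inner ℂ f f : ℂ).re = ‖f‖ ^ 2 := inner_self_eq_norm_sq (𝕜 := ℂ) f
    rw [hB, inner_sub_left, inner_add_left, inner_smul_left, Complex.sub_re, Complex.add_re,
      Complex.conj_ofReal, Complex.re_ofReal_mul, h6, hsq]
    ring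
  have hre : ∀ x y : H, (inner ℂ x y : ℂ).re = (inner ℂ y x : ℂ).re := fun x y => by
    rw [← inner_conj_symm, Complex.conj_re]
  unfold countBelow
  refine le_antisymm (posIndex_le_of_map (D : H →ₗ[ℂ] H') (fun f _ hf => ?_) (by simp))
    (posIndex_le_of_map ((G.comp C : H' →L[ℂ] H) : H' →ₗ[ℂ] H) (fun w _ hw => ?_) (by simp))
  · rw [hq] at hf
    simp only [ContinuousLinearMap.coe_coe]
    have h1 := hA (f - G (C (D f)))
    rw [map_sub, hGA, inner_sub_left, inner_sub_right, inner_sub_right, hsym f (G _), hGA] at h1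
    simp only [Complex.sub_re] at h1
    rw [hre f (C (D f)), hsq, hre (C (D f)) (G _)] at h1
    linarith
  · rw [hq]
    simp only [ContinuousLinearMap.coe_coe, ContinuousLinearMap.comp_apply]
    rw [hGA, hre (C w)]
    have h1 : 0 ≤ ‖D (G (C w)) - w‖ ^ 2 := by positivity
    rw [@norm_sub_sq ℂ] at h1
    have h2 : RCLike.re (inner ℂ (D (G (C w))) w : ℂ) = (inner ℂ (G (C w)) (C w) : ℂ).re := by
      rw [ContinuousLinearMap.adjoint_inner_left]; rfl
    rw [h2] at h1
    linarith

omit [CompleteSpace H'] in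
/-- If the form of `C* G C - 1` is that of `M (T - 1) M`, where `M` has dense range, then both
have equally many positive directions. -/
theorem posIndex_eq_countAbove {q : H' → ℝ} {M T : H' →L[ℂ] H'} (hM : DenseRange M)
    (hq : ∀ w, q w = (inner ℂ (T (M w)) (M w) : ℂ).re - ‖M w‖ ^ 2) :
    posIndex q = countAbove 1 T := by
  rw [countAbove_eq_posIndex]
  simp only [one_mul]
  refine le_antisymm (posIndex_le_of_map (M : H' →ₗ[ℂ] H') (fun f _ hf => ?_) (by simp)) ?_
  · rw [hq] at hf
    exact hf
  · have h := posIndex_le_comp_of_denseRange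
      (q := fun f : H' => (inner ℂ (T f) f : ℂ).re - ‖f‖ ^ 2) (by fun_prop) (fun c f => by
        rw [map_smul, inner_smul_left, inner_smul_right, norm_smul, ← mul_assoc, Complex.conj_mul',
          ← Complex.ofReal_pow, Complex.re_ofReal_mul]
        ring) M hM
    simpa only [← hq] using h

end BirmanSchwinger

/-! ### Pullbacks and integral operators on `L²` -/

namespace IntegralOperator

variable {X Y : Type*} [MeasurableSpace X] [MeasurableSpace Y]

theorem eLpNorm_comp_of_map_eq_smul {μ : Measure X} {ν : Measure Y} {π : X → Y} {c : ℝ≥0∞}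
    (hπ : Measurable π) (h : μ.map π = c • ν) {f : Y → ℂ} (hf : AEStronglyMeasurable f ν) :
    eLpNorm (fun x => f (π x)) 2 μ = c ^ (1 / (2 : ℝ)) * eLpNorm f 2 ν := by
  have h3 := eLpNorm_map_measure (p := 2) (μ := μ) (f := π) (g := f) (by
    rw [h]; exact hf.smul_measure _) hπ.aemeasurable
  rw [h, eLpNorm_smul_measure_of_ne_top (by norm_num)] at h3
  simpa [Function.comp_def] using h3.symm

theorem memLp_comp_of_map_eq_smul {μ : Measure X} {ν : Measure Y} {π : X → Y} {c : ℝ≥0∞}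
    (hπ : Measurable π) (h : μ.map π = c • ν) (hc : c ≠ ∞) {f : Y → ℂ} (hf : MemLp f 2 ν) :
    MemLp (fun x => f (π x)) 2 μ := by
  refine MemLp.comp_of_map (g := f) ?_ hπ.aemeasurable
  rw [h]
  exact hf.smul_measure hc

theorem ae_comp_of_map_eq_smul {μ : Measure X} {ν : Measure Y} {π : X → Y} {c : ℝ≥0∞}
    (hπ : Measurable π) (h : μ.map π = c • ν) {P : Y → Prop} (hP : ∀ᵐ y ∂ν, P y) :
    ∀ᵐ x ∂μ, P (π x) := by
  refine ae_of_ae_map hπ.aemeasurable ?_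
  rw [h]
  exact Measure.ae_smul_measure hP _

/-- The operator `f ↦ f ∘ π` from `L²(ν)` to `L²(μ)`, for a map `π` under which the image of `μ`
is a finite multiple of `ν`. -/
noncomputable def pullback {μ : Measure X} {ν : Measure Y} {π : X → Y} {c : ℝ≥0∞}
    (hπ : Measurable π) (h : μ.map π = c • ν) (hc : c ≠ ∞) : Lp ℂ 2 ν →L[ℂ] Lp ℂ 2 μ :=
  LinearMap.mkContinuous
    { toFun := fun f => (memLp_comp_of_map_eq_smul hπ h hc (Lp.memLp f)).toLp _
      map_add' := fun f g => by
        rw [← MemLp.toLp_add]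
        exact MemLp.toLp_congr _ _ (ae_comp_of_map_eq_smul hπ h (Lp.coeFn_add f g))
      map_smul' := fun r f => by
        rw [RingHom.id_apply, ← MemLp.toLp_const_smul]
        exact MemLp.toLp_congr _ _ (ae_comp_of_map_eq_smul hπ h (Lp.coeFn_smul r f)) }
    (c ^ (1 / (2 : ℝ))).toReal
    (fun f => by
      simp only [LinearMap.coe_mk, AddHom.coe_mk]
      rw [Lp.norm_toLp, Lp.norm_def, ← ENNReal.toReal_mul,
        eLpNorm_comp_of_map_eq_smul hπ h (Lp.aestronglyMeasurable f)])

theorem pullback_apply {μ : Measure X} {ν : Measure Y} {π : X → Y} {c : ℝ≥0∞}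
    (hπ : Measurable π) (h : μ.map π = c • ν) (hc : c ≠ ∞) (f : Lp ℂ 2 ν) :
    pullback hπ h hc f =ᵐ[μ] fun x => f (π x) :=
  MemLp.coeFn_toLp (memLp_comp_of_map_eq_smul hπ h hc (Lp.memLp f))

/-- The operator norm is bounded by the Hilbert-Schmidt norm. -/
theorem norm_ofKernel_sub_le {μ : Measure X} [SFinite μ] {k k' : X × X → ℂ}
    (hk : MemLp k 2 (μ.prod μ)) (hk' : MemLp k' 2 (μ.prod μ)) :
    ‖ofKernel μ k hk - ofKernel μ k' hk'‖ ≤ (eLpNorm (k - k') 2 (μ.prod μ)).toReal := by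
  refine ContinuousLinearMap.opNorm_le_bound _ ENNReal.toReal_nonneg fun f => ?_
  have hae : (ofKernel μ k hk - ofKernel μ k' hk') f
      =ᵐ[μ] fun x => ∫ y, (k - k') (x, y) * f y ∂μ := by
    rw [sub_apply]
    filter_upwards [Lp.coeFn_sub (ofKernel μ k hk f) (ofKernel μ k' hk' f),
      ofKernel_apply μ k hk f, ofKernel_apply μ k' hk' f, ae_memLp_section hk,
      ae_memLp_section hk'] with x h1 h2 h3 h4 h5
    have i1 : Integrable (fun y => k (x, y) * f y) μ := h4.integrable_mul (Lp.memLp f)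
    have i2 : Integrable (fun y => k' (x, y) * f y) μ := h5.integrable_mul (Lp.memLp f)
    rw [h1, Pi.sub_apply, h2, h3, ← integral_sub i1 i2]
    refine integral_congr_ae (Eventually.of_forall fun y => ?_)
    simp only [Pi.sub_apply]
    ring
  rw [Lp.norm_def, Lp.norm_def, ← ENNReal.toReal_mul, eLpNorm_congr_ae hae]
  exact ENNReal.toReal_mono (ENNReal.mul_lt_top (hk.sub hk').2 (Lp.memLp f).2).ne
    (eLpNorm_integral_mul_le (hk.1.sub hk'.1) (Lp.memLp f).1)

theorem memLp_tensor {μ : Measure X} {ν : Measure Y} [SFinite μ] [SFinite ν] {u : X → ℂ}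
    {v : Y → ℂ} (hu : MemLp u 2 μ) (hv : MemLp v 2 ν) :
    MemLp (fun z : X × Y => u z.1 * v z.2) 2 (μ.prod ν) := by
  have h1 := hu.1.comp_fst (ν := ν)
  have h2 := hv.1.comp_snd (μ := μ)
  refine ⟨h1.mul h2, ?_⟩
  rw [eLpNorm_lt_top_iff_lintegral_rpow_enorm_lt_top (by norm_num) (by norm_num)]
  have e : ∀ z : X × Y, ‖u z.1 * v z.2‖ₑ ^ (2 : ℝ≥0∞).toReal
      = ‖u z.1‖ₑ ^ (2 : ℝ≥0∞).toReal * ‖v z.2‖ₑ ^ (2 : ℝ≥0∞).toReal := fun z => by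
    rw [enorm_mul, ENNReal.mul_rpow_of_nonneg _ _ (by norm_num)]
  simp only [e]
  rw [lintegral_prod_mul (hu.1.enorm.pow_const _) (hv.1.enorm.pow_const _)]
  exact ENNReal.mul_lt_top
    (lintegral_rpow_enorm_lt_top_of_eLpNorm_lt_top (by norm_num) (by norm_num) hu.2)
    (lintegral_rpow_enorm_lt_top_of_eLpNorm_lt_top (by norm_num) (by norm_num) hv.2)

/-- The adjoint of an integral operator has the conjugate transposed kernel. -/
theorem inner_ofKernel_left {μ : Measure X} [SFinite μ] {k k' : X × X → ℂ}
    (hk : MemLp k 2 (μ.prod μ)) (hk' : MemLp k' 2 (μ.prod μ))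
    (h : ∀ x y, k' (y, x) = (starRingEnd ℂ) (k (x, y))) (f g : Lp ℂ 2 μ) :
    inner ℂ (ofKernel μ k hk f) g = inner ℂ f (ofKernel μ k' hk' g) := by
  have hint : Integrable (Function.uncurry fun x y =>
      (starRingEnd ℂ) (k (x, y)) * (g x * (starRingEnd ℂ) (f y))) (μ.prod μ) := by
    have h1 : MemLp (fun z : X × X => g z.1 * (starRingEnd ℂ) (f z.2)) 2 (μ.prod μ) :=
      memLp_tensor (Lp.memLp g) (Lp.memLp f).star
    exact MemLp.integrable_mul (MemLp.star hk) h1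
  have e1 : inner ℂ (ofKernel μ k hk f) g
      = ∫ x, ∫ y, (starRingEnd ℂ) (k (x, y)) * (g x * (starRingEnd ℂ) (f y)) ∂μ ∂μ := by
    rw [L2.inner_def]
    refine integral_congr_ae ?_
    filter_upwards [ofKernel_apply μ k hk f] with x hx
    rw [hx, RCLike.inner_apply, ← integral_conj, ← integral_const_mul]
    refine integral_congr_ae (Eventually.of_forall fun y => ?_)
    simp only [map_mul]
    ring
  have e2 : inner ℂ f (ofKernel μ k' hk' g)
      = ∫ y, ∫ x, (starRingEnd ℂ) (k (x, y)) * (g x * (starRingEnd ℂ) (f y)) ∂μ ∂μ := by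
    rw [L2.inner_def]
    refine integral_congr_ae ?_
    filter_upwards [ofKernel_apply μ k' hk' g] with y hy
    rw [hy, RCLike.inner_apply, ← integral_mul_const]
    refine integral_congr_ae (Eventually.of_forall fun x => ?_)
    simp only [h]
    ring
  rw [e1, e2, integral_integral_swap hint]

/-- An integral operator with kernel `u(x) v(y) g(x, y)`, where `u`, `v` are square integrable and
`g` is continuous, is a norm limit of operators of finite rank: `g(x, y)` is replaced by
`g(P x, y)`, where `P` takes finitely many values and is close to the identity. -/
theorem ofKernel_mem_closure_finiteRankOperators {X : Type*} [PseudoMetricSpace X] [CompactSpace X]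
    [SecondCountableTopology X] [Nonempty X] [MeasurableSpace X] [BorelSpace X] {μ : Measure X}
    [IsFiniteMeasure μ]
    {u v : X → ℂ} (hu : MemLp u 2 μ) (hv : MemLp v 2 μ) {g : X × X → ℂ} (hg : Continuous g)
    {k : X × X → ℂ} (hk : MemLp k 2 (μ.prod μ)) (hkg : ∀ z, k z = u z.1 * v z.2 * g z) :
    ofKernel μ k hk ∈ (finiteRankOperators (Lp ℂ 2 μ) (Lp ℂ 2 μ)).topologicalClosure := by
  classical
  have huv := memLp_tensor hu hv
  refine Metric.mem_closure_iff.2 fun ε hε => ?_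
  set N := (eLpNorm (fun z : X × X => u z.1 * v z.2) 2 (μ.prod μ)).toReal with hN
  have hN0 : 0 ≤ N := ENNReal.toReal_nonneg
  obtain ⟨ε', hε', hεN⟩ : ∃ ε' : ℝ, 0 < ε' ∧ ε' * N < ε := by
    refine ⟨ε / (N + 1), by positivity, ?_⟩
    rw [div_mul_eq_mul_div, div_lt_iff₀ (by positivity)]
    nlinarith
  obtain ⟨η, hη, hgη⟩ := Metric.uniformContinuous_iff.1
    (CompactSpace.uniformContinuous_of_continuous hg) ε' hε'
  obtain ⟨P, hP⟩ : ∃ P : SimpleFunc X X, ∀ x, dist (P x) x < η := by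
    set e := TopologicalSpace.denseSeq X
    have hcov : (Set.univ : Set X) ⊆ ⋃ n, Metric.ball (e n) η := fun x _ => by
      obtain ⟨_, ⟨n, rfl⟩, hn⟩ :=
        Metric.mem_closure_iff.1 (TopologicalSpace.denseRange_denseSeq X x) η hη
      exact Set.mem_iUnion.2 ⟨n, Metric.mem_ball.2 hn⟩
    obtain ⟨t, ht⟩ := isCompact_univ.elim_finite_subcover _ (fun n => Metric.isOpen_ball) hcov
    refine ⟨SimpleFunc.nearestPt e (t.sup id), fun x => ?_⟩
    obtain ⟨n, hn, hxn⟩ := Set.mem_iUnion₂.1 (ht (Set.mem_univ x))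
    have h1 := SimpleFunc.edist_nearestPt_le e x (Finset.le_sup (f := id) hn)
    simp only [id] at h1
    rw [edist_dist, edist_dist, ENNReal.ofReal_le_ofReal_iff dist_nonneg] at h1
    refine h1.trans_lt ?_
    rw [dist_comm]
    exact Metric.mem_ball.1 hxn
  have hgP : Measurable fun z : X × X => g (P z.1, z.2) :=
    hg.measurable.comp ((P.measurable.comp measurable_fst).prodMk measurable_snd)
  obtain ⟨B, hB⟩ := isCompact_univ.exists_bound_of_continuousOn hg.continuousOn
  set k' : X × X → ℂ := fun z => u z.1 * v z.2 * g (P z.1, z.2) with hk'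
  have hk'L : MemLp k' 2 (μ.prod μ) := by
    refine MemLp.of_le_mul (c := B) huv (huv.1.mul hgP.aestronglyMeasurable)
      (Eventually.of_forall fun z => ?_)
    rw [hk', norm_mul, mul_comm]
    exact mul_le_mul_of_nonneg_right (hB _ trivial) (norm_nonneg _)
  refine ⟨ofKernel μ k' hk'L, ?_, ?_⟩
  -- The range is spanned by `u` times the indicators of the level sets of `P`.
  · have hmem : ∀ y : X, MemLp (fun x => u x * (P ⁻¹' {y}).indicator (fun _ => (1 : ℂ)) x) 2 μ := by
      intro y
      have hm : Measurable ((P ⁻¹' {y}).indicator fun _ => (1 : ℂ)) :=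
        measurable_const.indicator (P.measurableSet_preimage _)
      refine hu.of_le (hu.1.mul hm.aestronglyMeasurable) (Eventually.of_forall fun x => ?_)
      rw [norm_mul]
      refine mul_le_of_le_one_right (norm_nonneg _) ?_
      by_cases h : x ∈ P ⁻¹' {y} <;> simp [h]
    set b : P.range → Lp ℂ 2 μ := fun y => (hmem y).toLp _ with hb
    have hfd : FiniteDimensional ℂ (Submodule.span ℂ (Set.range b)) :=
      FiniteDimensional.span_of_finite ℂ (Set.finite_range b)
    refine mem_finiteRankOperators_of_forall_mem (Submodule.span ℂ (Set.range b)) fun f => ?_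
    have heq : ofKernel μ k' hk'L f = ∑ y : P.range, (∫ s, v s * g (y, s) * f s ∂μ) • b y := by
      refine Lp.ext ?_
      have h1 : ∀ᵐ x ∂μ, ∀ y : P.range, b y x
          = u x * (P ⁻¹' {(y : X)}).indicator (fun _ => (1 : ℂ)) x :=
        ae_all_iff.2 fun y => (hmem y).coeFn_toLp
      have h2 : ∀ᵐ x ∂μ, ∀ y : P.range, ((∫ s, v s * g (y, s) * f s ∂μ) • b y : Lp ℂ 2 μ) x
          = (∫ s, v s * g (y, s) * f s ∂μ) * b y x :=
        ae_all_iff.2 fun y => Lp.coeFn_smul _ _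
      have h3 := Lp.coeFn_finsetSum (Finset.univ : Finset P.range)
        (fun y => (∫ s, v s * g (y, s) * f s ∂μ) • b y)
      filter_upwards [ofKernel_apply μ k' hk'L f, h1, h2, h3] with x hx h1 h2 h3
      rw [hx, h3]
      simp only [Finset.sum_apply, h2, h1]
      rw [Finset.sum_eq_single (⟨P x, P.mem_range_self x⟩ : P.range)]
      · simp only [hk']
        rw [Set.indicator_of_mem (by simp), mul_one, mul_comm, ← integral_const_mul]
        exact integral_congr_ae (Eventually.of_forall fun s => by ring)
      · intro y _ hy
        rw [Set.indicator_of_notMem]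
        · simp
        · intro h
          exact hy (Subtype.ext (by simpa using h.symm))
      · simp
    rw [heq]
    exact Submodule.sum_mem _ fun y _ =>
      Submodule.smul_mem _ _ (Submodule.subset_span ⟨y, rfl⟩)
  · rw [dist_eq_norm]
    refine (norm_ofKernel_sub_le hk hk'L).trans_lt (lt_of_le_of_lt ?_ hεN)
    have h1 : eLpNorm (k - k') 2 (μ.prod μ)
        ≤ ENNReal.ofReal ε' * eLpNorm (fun z : X × X => u z.1 * v z.2) 2 (μ.prod μ) := by
      refine eLpNorm_le_mul_eLpNorm_of_ae_le_mul (Eventually.of_forall fun z => ?_) 2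
      have e : (k - k') z = u z.1 * v z.2 * (g z - g (P z.1, z.2)) := by
        simp only [Pi.sub_apply, hkg, hk']; ring
      rw [e, norm_mul, mul_comm]
      refine mul_le_mul_of_nonneg_right ?_ (norm_nonneg _)
      rw [← dist_eq_norm]
      refine (hgη ?_).le
      rw [Prod.dist_eq]
      simp only [dist_self]
      rw [max_eq_left dist_nonneg, dist_comm]
      exact hP z.1
    refine (ENNReal.toReal_mono (ENNReal.mul_lt_top ENNReal.ofReal_lt_top huv.2).ne h1).trans ?_
    rw [ENNReal.toReal_mul, ENNReal.toReal_ofReal hε'.le]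

end IntegralOperator

/-! ### Particle coordinates on the pair torus -/

namespace LatticeThreeBody

/-- The momentum `p_c` of the particle `c`, as a function of `(p₁, p₂)`. -/
noncomputable def coord (c : Fin 3) (z : Torus × Torus) : Torus := ![z.1, z.2, -(z.1 + z.2)] c

/-- The coordinate `p_c` of the configuration with `p_a = y.1` and `p_b = y.2`. -/
noncomputable def pairCoord (a b c : Fin 3) (y : Torus × Torus) : Torus :=
  if c = a then y.1 else if c = b then y.2 else -(y.1 + y.2)

/-- The configuration with `p_a = y.1` and `p_b = y.2`, in the coordinates `(p₁, p₂)`. -/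
noncomputable def pairPoint (a b : Fin 3) (y : Torus × Torus) : Torus × Torus :=
  (pairCoord a b 0 y, pairCoord a b 1 y)

theorem coord_pairPoint {a b : Fin 3} (hab : a ≠ b) (c : Fin 3) (y : Torus × Torus) :
    coord c (pairPoint a b y) = pairCoord a b c y := by
  fin_cases a <;> fin_cases b <;> first | exact absurd rfl hab | skip
  all_goals fin_cases c <;> simp [coord, pairPoint, pairCoord, -neg_add_rev]
  all_goals abel

theorem coord_pairPoint_left {a b : Fin 3} (hab : a ≠ b) (y : Torus × Torus) :
    coord a (pairPoint a b y) = y.1 := by rw [coord_pairPoint hab, pairCoord, if_pos rfl]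

theorem coord_pairPoint_right {a b : Fin 3} (hab : a ≠ b) (y : Torus × Torus) :
    coord b (pairPoint a b y) = y.2 := by
  rw [coord_pairPoint hab, pairCoord, if_neg hab.symm, if_pos rfl]

theorem continuous_coord (c : Fin 3) : Continuous (coord c) := by
  fin_cases c
  · exact continuous_fst
  · exact continuous_snd
  · exact (continuous_fst.add continuous_snd).neg

theorem measurable_coord (c : Fin 3) : Measurable (coord c) := (continuous_coord c).measurable

theorem continuous_pairPoint (a b : Fin 3) : Continuous (pairPoint a b) := by
  have h : ∀ c, Continuous (pairCoord a b c) := fun c => by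
    unfold pairCoord
    split_ifs
    · exact continuous_fst
    · exact continuous_snd
    · exact (continuous_fst.add continuous_snd).neg
  exact (h 0).prodMk (h 1)

theorem measurePreserving_pairPoint {a b : Fin 3} (hab : a ≠ b) :
    MeasurePreserving (pairPoint a b) ((volume : Measure Torus).prod volume) volume := by
  have hswap : MeasurePreserving (Prod.swap : Torus × Torus → Torus × Torus)
      ((volume : Measure Torus).prod volume) ((volume : Measure Torus).prod volume) :=
    Measure.measurePreserving_swap
  have hS : MeasurePreserving (fun y : Torus × Torus => (y.1, -(y.1 + y.2)))
      ((volume : Measure Torus).prod volume) ((volume : Measure Torus).prod volume) :=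
    (MeasurePreserving.id (volume : Measure Torus)).skew_product (g := fun x y => -(x + y))
      (measurable_fst.add measurable_snd).neg
      (Eventually.of_forall fun x => ((Measure.measurePreserving_neg (volume : Measure Torus)).comp
        (measurePreserving_add_left (volume : Measure Torus) x)).map_eq)
  fin_cases a <;> fin_cases b <;> first | exact absurd rfl hab | skip
  · exact MeasurePreserving.id _
  · exact hS
  · exact hswap
  · exact hswap.comp hS
  · have e : pairPoint 2 0 = (fun y : Torus × Torus => (y.1, -(y.1 + y.2))) ∘ Prod.swap := by
      ext1 y
      simp [pairPoint, pairCoord, add_comm]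
    exact e ▸ hS.comp hswap
  · have e : pairPoint 2 1
        = (Prod.swap ∘ fun y : Torus × Torus => (y.1, -(y.1 + y.2))) ∘ Prod.swap := by
      ext1 y
      simp [pairPoint, pairCoord, add_comm]
    exact e ▸ (hswap.comp hS).comp hswap

theorem integral_pairPoint {a b : Fin 3} (hab : a ≠ b) {f : Torus × Torus → ℂ}
    (hf : AEStronglyMeasurable f volume) :
    ∫ z, f z = ∫ y, f (pairPoint a b y) ∂(volume : Measure Torus).prod volume := by
  have hmp := measurePreserving_pairPoint hab
  rw [← integral_map hmp.measurable.aemeasurable (by rwa [hmp.map_eq]), hmp.map_eq]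

/-- The kinetic energy is symmetric in the particles, whichever two momenta are chosen as
coordinates. -/
theorem kinetic_eq_sum (l : Fin 3 → ℝ) (K : EuclideanSpace ℝ (Fin 3)) {a b : Fin 3} (hab : a ≠ b)
    (y : Torus × Torus) : kinetic l K a b y.1 y.2
      = ∑ c, l c * disp (toTorus (massRatio l c • K) - pairCoord a b c y) := by
  fin_cases a <;> fin_cases b <;> first | exact absurd rfl hab | skip
  all_goals
    have h : ∀ x : Torus, x + y.1 + y.2 = x - -(y.1 + y.2) := fun x => by abel
    have e1 : (-1 : Fin 3) = 2 := rfl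
    have e2 : (-2 : Fin 3) = 1 := rfl
    have e3 : (1 : Fin 3) + 2 = 0 := rfl
    have e4 : (2 : Fin 3) + 1 = 0 := rfl
    simp [kinetic, third, pairCoord, Fin.sum_univ_three, h, e1, e2, -neg_add_rev,
      -sub_neg_eq_add]
  all_goals ring

/-- The kinetic energy as a function on the pair torus. -/
noncomputable def energy (l : Fin 3 → ℝ) (K : EuclideanSpace ℝ (Fin 3)) (z : Torus × Torus) : ℝ :=
  kinetic l K 0 1 z.1 z.2

theorem continuous_energy (l : Fin 3 → ℝ) (K : EuclideanSpace ℝ (Fin 3)) :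
    Continuous (energy l K) := continuous_kinetic l K 0 1

theorem energy_pairPoint (l : Fin 3 → ℝ) (K : EuclideanSpace ℝ (Fin 3)) {a b : Fin 3}
    (hab : a ≠ b) (y : Torus × Torus) : energy l K (pairPoint a b y) = kinetic l K a b y.1 y.2 := by
  rw [kinetic_eq_sum l K hab, energy, kinetic_eq_sum l K (by decide)]
  refine Finset.sum_congr rfl fun c _ => ?_
  rw [← coord_pairPoint hab c, ← coord_pairPoint (a := 0) (b := 1) (by decide)]
  rfl

theorem ne_add_one (a : Fin 3) : a ≠ a + 1 := by fin_cases a <;> decide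

/-- The Fredholm determinant in the channel `a` is an integral over the fibre `p_a = p`. -/
theorem channelDet_eq (l mu : Fin 3 → ℝ) (a : Fin 3) (K : EuclideanSpace ℝ (Fin 3)) (p : Torus)
    (z : ℝ) : channelDet l mu a K p z = 1 - mu a / (2 * Real.pi) ^ 3 *
      ∫ s : Torus, (energy l K (pairPoint a (a + 1) (p, s)) - z)⁻¹ := by
  unfold channelDet fredholmDet
  rw [← integral_sub_left_eq_self _ (volume : Measure Torus)
    (toTorus (massRatio l (a + 1) • K))]
  congr 3
  ext s
  have h3 : third a (a + 1) = a + 2 := by fin_cases a <;> rfl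
  rw [energy_pairPoint l K (ne_add_one a), kinetic, h3]
  have e : toTorus ((massRatio l (a + 1) + massRatio l (a + 2)) • K) + p
      - (toTorus (massRatio l (a + 1) • K) - s) = toTorus (massRatio l (a + 2) • K) + p + s := by
    rw [add_smul, toTorus_add]
    abel
  rw [e]
  congr 1
  ring

/-! ### Factorization of the interaction -/

theorem map_coord (c : Fin 3) : (volume : Measure (Torus × Torus)).map (coord c)
    = (volume : Measure Torus) Set.univ • (volume : Measure Torus) := by
  have h := measurePreserving_pairPoint (ne_add_one c)
  rw [← h.map_eq, Measure.map_map (measurable_coord c) h.measurable]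
  have e : coord c ∘ pairPoint c (c + 1) = Prod.fst :=
    funext fun y => coord_pairPoint_left (ne_add_one c) y
  rw [e, Measure.map_fst_prod]

/-- The embedding `w ↦ w(p_c)` of the functions of `p_c` into `L²((𝕋³)²)`. -/
noncomputable def liftCoord (c : Fin 3) : L2Torus →L[ℂ] L2Pair :=
  IntegralOperator.pullback (measurable_coord c) (map_coord c) (measure_ne_top _ _)

theorem liftCoord_apply (c : Fin 3) (w : L2Torus) :
    liftCoord c w =ᵐ[volume] fun z => w (coord c z) :=
  IntegralOperator.pullback_apply _ _ _ w

theorem ae_coord (c : Fin 3) {P : Torus → Prop} (hP : ∀ᵐ p, P p) :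
    ∀ᵐ z : Torus × Torus, P (coord c z) :=
  IntegralOperator.ae_comp_of_map_eq_smul (measurable_coord c) (map_coord c) hP

theorem memLp_pairPoint {a b : Fin 3} (hab : a ≠ b) (f : L2Pair) :
    MemLp (fun y => f (pairPoint a b y)) 2 ((volume : Measure Torus).prod volume) :=
  (Lp.memLp f).comp_measurePreserving (measurePreserving_pairPoint hab)

theorem memLp_fibreIntegral {a b : Fin 3} (hab : a ≠ b) (f : L2Pair) :
    MemLp (fun p : Torus => ∫ s : Torus, f (pairPoint a b (p, s))) 2 volume := by
  simpa using IntegralOperator.memLp_integral_mul (memLp_pairPoint hab f) (memLp_const (1 : ℂ))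

/-- The adjoint of `liftCoord a` integrates over the fibres `p_a = p`, which are parametrized by any
second momentum `p_b`. -/
theorem adjoint_liftCoord {a b : Fin 3} (hab : a ≠ b) (f : L2Pair) :
    ContinuousLinearMap.adjoint (liftCoord a) f = (memLp_fibreIntegral hab f).toLp _ := by
  refine ext_inner_left ℂ fun w => ?_
  rw [ContinuousLinearMap.adjoint_inner_right, L2.inner_def, L2.inner_def]
  have h1 : ∫ z, inner ℂ (liftCoord a w z) (f z)
      = ∫ z : Torus × Torus, inner ℂ (w (coord a z)) (f z) := by
    refine integral_congr_ae ?_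
    filter_upwards [liftCoord_apply a w] with z hz
    rw [hz]
  have hmp := measurePreserving_pairPoint hab
  have hint : Integrable (fun z : Torus × Torus => inner ℂ (w (coord a z)) (f z)) volume := by
    refine (L2.integrable_inner (𝕜 := ℂ) (liftCoord a w) f).congr ?_
    filter_upwards [liftCoord_apply a w] with z hz
    rw [hz]
  have hint' : Integrable (fun y : Torus × Torus =>
      inner ℂ (w y.1) (f (pairPoint a b y))) ((volume : Measure Torus).prod volume) := by
    have := hmp.integrable_comp_of_integrable hint
    refine this.congr (Eventually.of_forall fun y => ?_)
    simp only [Function.comp_apply, coord_pairPoint_left hab]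
  rw [h1, integral_pairPoint hab hint.1]
  simp only [coord_pairPoint_left hab]
  rw [integral_prod _ hint']
  refine integral_congr_ae ?_
  filter_upwards [(memLp_fibreIntegral hab f).coeFn_toLp] with p hp
  rw [hp]
  simp only [RCLike.inner_apply]
  rw [integral_mul_const]

theorem interaction_eq (mu : Fin 3 → ℝ) (a : Fin 3) (f : L2Pair) :
    interaction mu a f = ((mu a / (2 * Real.pi) ^ 3 : ℝ) : ℂ) •
      liftCoord a (ContinuousLinearMap.adjoint (liftCoord a) f) := by
  -- moving `p_b` with the sign of `direction` parametrizes the fibre through `z`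
  obtain ⟨b, hab, hb⟩ : ∃ b, a ≠ b ∧ ∀ (z : Torus × Torus) (s : Torus),
      pairPoint a b (coord a z, s) = z + direction a (s - coord b z) := by
    fin_cases a
    · refine ⟨1, by decide, fun z s => ?_⟩
      ext1 <;> simp [pairPoint, pairCoord, coord, direction]
    · refine ⟨0, by decide, fun z s => ?_⟩
      ext1 <;> simp [pairPoint, pairCoord, coord, direction]
    · refine ⟨0, by decide, fun z s => ?_⟩
      ext1 <;> simp [pairPoint, pairCoord, coord, direction]
      abel
  refine Lp.ext ?_
  rw [adjoint_liftCoord hab]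
  filter_upwards [interaction_apply mu a f, Lp.coeFn_smul ((mu a / (2 * Real.pi) ^ 3 : ℝ) : ℂ)
    (liftCoord a ((memLp_fibreIntegral hab f).toLp _)), liftCoord_apply a
    ((memLp_fibreIntegral hab f).toLp _), ae_coord a (memLp_fibreIntegral hab f).coeFn_toLp]
    with z h1 h2 h3 h4
  rw [h1, h2, Pi.smul_apply, h3, h4, smul_eq_mul]
  congr 1
  simp only [hb]
  exact (integral_sub_right_eq_self (fun s => f (z + direction a s)) (coord b z)).symm

/-- The coupling constant `μ_a / (2π)³`. -/
noncomputable def coupling (mu : Fin 3 → ℝ) (a : Fin 3) : ℝ := mu a / (2 * Real.pi) ^ 3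

theorem coupling_pos {mu : Fin 3 → ℝ} (hmu : ∀ a, 0 < mu a) (a : Fin 3) : 0 < coupling mu a :=
  div_pos (hmu a) (by positivity)

/-- The operator `C` with `C C* = V₁ + V₂ + V₃`. -/
noncomputable def couplingMap (mu : Fin 3 → ℝ) : L2Vec →L[ℂ] L2Pair :=
  ∑ a, ((√(coupling mu a) : ℝ) : ℂ) • (liftCoord a).comp (PiLp.proj 2 (fun _ : Fin 3 => L2Torus) a)

theorem couplingMap_apply (mu : Fin 3 → ℝ) (w : L2Vec) :
    couplingMap mu w = ∑ a, ((√(coupling mu a) : ℝ) : ℂ) • liftCoord a (w a) := by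
  rw [couplingMap, sum_apply]
  rfl

theorem adjoint_couplingMap (mu : Fin 3 → ℝ) (f : L2Pair) (a : Fin 3) :
    ContinuousLinearMap.adjoint (couplingMap mu) f a
      = ((√(coupling mu a) : ℝ) : ℂ) • ContinuousLinearMap.adjoint (liftCoord a) f := by
  have h : ContinuousLinearMap.adjoint (couplingMap mu) f = WithLp.toLp 2 fun a =>
      ((√(coupling mu a) : ℝ) : ℂ) • ContinuousLinearMap.adjoint (liftCoord a) f := by
    refine ext_inner_left ℂ fun w => ?_
    rw [ContinuousLinearMap.adjoint_inner_right, PiLp.inner_apply, couplingMap_apply, sum_inner]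
    refine Finset.sum_congr rfl fun c _ => ?_
    simp only
    rw [inner_smul_left, inner_smul_right, ContinuousLinearMap.adjoint_inner_right,
      Complex.conj_ofReal]
  rw [h]

theorem couplingMap_adjoint {mu : Fin 3 → ℝ} (hmu : ∀ a, 0 < mu a) (f : L2Pair) :
    couplingMap mu (ContinuousLinearMap.adjoint (couplingMap mu) f)
      = interaction mu 0 f + interaction mu 1 f + interaction mu 2 f := by
  have h : ∀ a, ((√(coupling mu a) : ℝ) : ℂ) • liftCoord a
      (ContinuousLinearMap.adjoint (couplingMap mu) f a) = interaction mu a f := fun a => by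
    rw [adjoint_couplingMap, map_smul, smul_smul, ← Complex.ofReal_mul,
      Real.mul_self_sqrt (coupling_pos hmu a).le, interaction_eq]
    rfl
  rw [couplingMap_apply, Fin.sum_univ_three, h, h, h]

end LatticeThreeBody

/-! ### Multiplication by real functions -/

namespace IntegralOperator

variable {X : Type*} [MeasurableSpace X] {μ : Measure X}

theorem inner_multiplication_left {φ : X → ℝ} (hφ : MemLp (fun x => (φ x : ℂ)) ∞ μ)
    (f g : Lp ℂ 2 μ) :
    inner ℂ (multiplication μ _ hφ f) g = ∫ x, (φ x : ℂ) * inner ℂ (f x) (g x) ∂μ := by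
  rw [L2.inner_def]
  refine integral_congr_ae ?_
  filter_upwards [multiplication_apply μ _ hφ f] with x hx
  simp only [hx, RCLike.inner_apply, map_mul, Complex.conj_ofReal]
  ring

theorem inner_multiplication_comm {φ : X → ℝ} (hφ : MemLp (fun x => (φ x : ℂ)) ∞ μ)
    (f g : Lp ℂ 2 μ) :
    inner ℂ (multiplication μ _ hφ f) g = inner ℂ f (multiplication μ _ hφ g) := by
  rw [inner_multiplication_left, L2.inner_def]
  refine integral_congr_ae ?_
  filter_upwards [multiplication_apply μ _ hφ g] with x hx
  simp only [hx, RCLike.inner_apply]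
  ring

theorem inner_multiplication_self {φ : X → ℝ} (hφ : MemLp (fun x => (φ x : ℂ)) ∞ μ)
    (f : Lp ℂ 2 μ) :
    inner ℂ (multiplication μ _ hφ f) f = ((∫ x, φ x * ‖f x‖ ^ 2 ∂μ : ℝ) : ℂ) := by
  rw [inner_multiplication_left, ← integral_complex_ofReal]
  refine integral_congr_ae (Eventually.of_forall fun x => ?_)
  simp only [RCLike.inner_apply, Complex.mul_conj', Complex.ofReal_mul, Complex.ofReal_pow]

theorem denseRange_multiplication {φ : X → ℝ} (hφ : MemLp (fun x => (φ x : ℂ)) ∞ μ)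
    (h0 : ∀ᵐ x ∂μ, φ x ≠ 0) : DenseRange (multiplication μ _ hφ) := by
  have h : (LinearMap.range (multiplication μ _ hφ : Lp ℂ 2 μ →ₗ[ℂ] Lp ℂ 2 μ)).topologicalClosure
      = ⊤ := by
    rw [Submodule.topologicalClosure_eq_top_iff, Submodule.eq_bot_iff]
    intro f hf
    rw [Submodule.mem_orthogonal] at hf
    have h1 : multiplication μ _ hφ f = 0 := by
      rw [← inner_self_eq_zero (𝕜 := ℂ), inner_multiplication_comm, ← inner_conj_symm]
      exact (congrArg (starRingEnd ℂ) (hf _ ⟨_, rfl⟩)).trans (map_zero _)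
    refine Lp.ext ?_
    have h2 := multiplication_apply μ _ hφ f
    rw [h1] at h2
    filter_upwards [h2, h0, Lp.coeFn_zero ℂ 2 μ] with x hx hx0 hz
    rw [hz] at hx ⊢
    have h3 : (φ x : ℂ) ≠ 0 := by exact_mod_cast hx0
    simpa [h3] using hx.symm
  have h2 := Submodule.dense_iff_topologicalClosure_eq_top.2 h
  exact h2

end IntegralOperator

namespace LatticeThreeBody

variable {l mu : Fin 3 → ℝ} {K : EuclideanSpace ℝ (Fin 3)} {ζ : ℝ}

theorem integrable_of_continuous {X E : Type*} [TopologicalSpace X] [CompactSpace X]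
    [MeasurableSpace X] [BorelSpace X] [NormedAddCommGroup E] [SecondCountableTopologyEither X E]
    {μ : Measure X} [IsFiniteMeasure μ] {f : X → E} (hf : Continuous f) : Integrable f μ := by
  obtain ⟨C, hC⟩ := isCompact_univ.exists_bound_of_continuousOn hf.continuousOn
  exact Integrable.of_bound hf.aestronglyMeasurable C (Eventually.of_forall fun z => hC z trivial)

theorem integral_pos_of_ae_pos {X : Type*} [MeasurableSpace X] {μ : Measure X} [NeZero μ]
    {f : X → ℝ} (hf : Integrable f μ) (h : ∀ᵐ x ∂μ, 0 < f x) : 0 < ∫ x, f x ∂μ := by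
  rw [integral_pos_iff_support_of_nonneg_ae (h.mono fun _ hx => hx.le) hf]
  have h1 : μ (Function.support f)ᶜ = 0 := h.mono fun _ hx => hx.ne'
  refine pos_iff_ne_zero.2 fun h2 => NeZero.ne μ (Measure.measure_univ_eq_zero.1 ?_)
  rw [← Set.union_compl_self (Function.support f)]
  exact measure_union_null h2 h1

theorem memLp_top_ofReal {X : Type*} [TopologicalSpace X] [CompactSpace X]
    [MeasurableSpace X] [BorelSpace X] {μ : Measure X} {φ : X → ℝ} (hφ : Continuous φ) :
    MemLp (fun x => (φ x : ℂ)) ∞ μ := by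
  have hc := Complex.continuous_ofReal.comp hφ
  obtain ⟨C, hC⟩ := isCompact_univ.exists_bound_of_continuousOn hc.continuousOn
  exact memLp_top_of_bound hc.aestronglyMeasurable C (Eventually.of_forall fun z => hC z trivial)

theorem continuous_inv_energy (hζ : ∀ z, ζ < energy l K z) :
    Continuous fun z => (energy l K z - ζ)⁻¹ :=
  ((continuous_energy l K).sub continuous_const).inv₀ fun z => (sub_pos.2 (hζ z)).ne'

theorem continuous_channelDet (hζ : ∀ z, ζ < energy l K z) (a : Fin 3) :
    Continuous fun p => channelDet l mu a K p ζ := by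
  simp only [channelDet_eq]
  have h : Continuous (Function.uncurry fun p s : Torus =>
      (energy l K (pairPoint a (a + 1) (p, s)) - ζ)⁻¹) :=
    (continuous_inv_energy hζ).comp (continuous_pairPoint a (a + 1))
  have h1 := continuous_parametric_integral_of_continuous (μ := (volume : Measure Torus)) h
    isCompact_univ
  simp only [Measure.restrict_univ] at h1
  exact continuous_const.sub (continuous_const.mul h1)

theorem integrable_fibre (hζ : ∀ z, ζ < energy l K z) (a : Fin 3) (p : Torus) :
    Integrable fun s : Torus => (energy l K (pairPoint a (a + 1) (p, s)) - ζ)⁻¹ :=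
  integrable_of_continuous ((continuous_inv_energy hζ).comp
    ((continuous_pairPoint a (a + 1)).comp (continuous_const.prodMk continuous_id)))

/-! ### The Birman-Schwinger principle for the lattice Hamiltonian -/

/-- The free resolvent: multiplication by `1 / (E - ζ)`. -/
noncomputable def freeResolvent (hζ : ∀ z, ζ < energy l K z) : L2Pair →L[ℂ] L2Pair :=
  IntegralOperator.multiplication volume _
    (memLp_top_ofReal (φ := fun z => (energy l K z - ζ)⁻¹) (continuous_inv_energy hζ))

theorem countBelow_hamiltonian_eq_posIndex (hmu : ∀ a, 0 < mu a) (hζ : ∀ z, ζ < energy l K z) :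
    countBelow (hamiltonian l mu K) ζ = posIndex fun w : L2Vec =>
      (inner ℂ (freeResolvent hζ (couplingMap mu w)) (couplingMap mu w) : ℂ).re - ‖w‖ ^ 2 := by
  have hA := memLp_top_ofReal (μ := (volume : Measure (Torus × Torus)))
    (φ := fun z => energy l K z - ζ) ((continuous_energy l K).sub continuous_const)
  refine countBelow_eq_posIndex_of_factor (A := IntegralOperator.multiplication volume _ hA)
    (IntegralOperator.inner_multiplication_comm hA) (fun f => ?_) (fun f => ?_) (fun f => ?_)
  · rw [IntegralOperator.inner_multiplication_self, Complex.ofReal_re]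
    exact integral_nonneg fun z => mul_nonneg (sub_nonneg.2 (hζ z).le) (sq_nonneg _)
  · refine Lp.ext ?_
    filter_upwards [IntegralOperator.multiplication_apply volume _ hA (freeResolvent hζ f),
      IntegralOperator.multiplication_apply volume _ (memLp_top_ofReal
        (φ := fun z => (energy l K z - ζ)⁻¹) (continuous_inv_energy hζ)) f] with z h1 h2
    have h0 : ((energy l K z - ζ : ℝ) : ℂ) ≠ 0 := by
      exact_mod_cast (sub_pos.2 (hζ z)).ne'
    rw [h1, freeResolvent, h2, Complex.ofReal_inv, mul_inv_cancel_left₀ h0]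
  · rw [couplingMap_adjoint hmu]
    have h : freeHamiltonian l K f
        = IntegralOperator.multiplication volume _ hA f + (ζ : ℂ) • f := by
      refine Lp.ext ?_
      filter_upwards [IntegralOperator.multiplication_apply volume _ hA f,
        IntegralOperator.multiplication_apply volume _ (memLp_kinetic l K) f,
        Lp.coeFn_add (IntegralOperator.multiplication volume _ hA f) ((ζ : ℂ) • f),
        Lp.coeFn_smul (ζ : ℂ) f] with z h1 h2 h3 h4
      rw [freeHamiltonian, h2, h3, Pi.add_apply, h1, h4, Pi.smul_apply, smul_eq_mul, energy]
      push_cast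
      ring
    simp only [hamiltonian, sub_apply, h]
    abel

theorem inner_freeResolvent_liftCoord (hζ : ∀ z, ζ < energy l K z) (a b : Fin 3)
    (u v : L2Torus) : inner ℂ (freeResolvent hζ (liftCoord a u)) (liftCoord b v)
      = ∫ z, (((energy l K z - ζ)⁻¹ : ℝ) : ℂ) * inner ℂ (u (coord a z)) (v (coord b z)) := by
  rw [freeResolvent, IntegralOperator.inner_multiplication_left]
  refine integral_congr_ae ?_
  filter_upwards [liftCoord_apply a u, liftCoord_apply b v] with z h1 h2
  rw [h1, h2]

theorem integrable_inner_coord (hζ : ∀ z, ζ < energy l K z) (a b : Fin 3) (u v : L2Torus) :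
    Integrable fun z => (((energy l K z - ζ)⁻¹ : ℝ) : ℂ)
      * inner ℂ (u (coord a z)) (v (coord b z)) := by
  have h : Integrable fun z : Torus × Torus => inner ℂ (u (coord a z)) (v (coord b z)) := by
    refine (L2.integrable_inner (𝕜 := ℂ) (liftCoord a u) (liftCoord b v)).congr ?_
    filter_upwards [liftCoord_apply a u, liftCoord_apply b v] with z h1 h2
    rw [h1, h2]
  have hc := Complex.continuous_ofReal.comp (continuous_inv_energy hζ)
  obtain ⟨C, hC⟩ := isCompact_univ.exists_bound_of_continuousOn hc.continuousOn
  exact h.bdd_mul hc.aestronglyMeasurable (Eventually.of_forall fun z => hC z trivial)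

theorem sq_norm_eq_integral {X : Type*} [MeasurableSpace X] {μ : Measure X} (f : Lp ℂ 2 μ) :
    ‖f‖ ^ 2 = ∫ x, ‖f x‖ ^ 2 ∂μ := by
  have h : (inner ℂ f f : ℂ).re = ‖f‖ ^ 2 := inner_self_eq_norm_sq (𝕜 := ℂ) f
  have h2 : (inner ℂ f f : ℂ) = ((∫ x, ‖f x‖ ^ 2 ∂μ : ℝ) : ℂ) := by
    rw [L2.inner_def, ← integral_complex_ofReal]
    refine integral_congr_ae (Eventually.of_forall fun x => ?_)
    simp only [RCLike.inner_apply, Complex.mul_conj', Complex.ofReal_pow]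
  rw [← h, h2, Complex.ofReal_re]

theorem integrable_sq_norm {X : Type*} [MeasurableSpace X] {μ : Measure X} (f : Lp ℂ 2 μ) :
    Integrable (fun x => ‖f x‖ ^ 2) μ := (Lp.memLp f).integrable_norm_pow (by norm_num)

/-- The diagonal blocks of `C* (H₀ - ζ)⁻¹ C` are multiplication by `1 - Δ_a`. -/
theorem inner_freeResolvent_diag (hζ : ∀ z, ζ < energy l K z) (a : Fin 3) (u : L2Torus) :
    (coupling mu a : ℂ) * inner ℂ (freeResolvent hζ (liftCoord a u)) (liftCoord a u)
      = ((‖u‖ ^ 2 - ∫ p, channelDet l mu a K p ζ * ‖u p‖ ^ 2 : ℝ) : ℂ) := by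
  have hint := integrable_inner_coord hζ a a u u
  have hmp := measurePreserving_pairPoint (ne_add_one a)
  have hint' := hmp.integrable_comp_of_integrable hint
  simp only [Function.comp_def, coord_pairPoint_left (ne_add_one a)] at hint'
  rw [inner_freeResolvent_liftCoord, integral_pairPoint (ne_add_one a) hint.1]
  simp only [coord_pairPoint_left (ne_add_one a)]
  rw [integral_prod _ hint']
  have h1 : ∀ p : Torus, ∫ s : Torus, (((energy l K (pairPoint a (a + 1) (p, s)) - ζ)⁻¹ : ℝ) : ℂ)
      * inner ℂ (u p) (u p)
      = (((∫ s : Torus, (energy l K (pairPoint a (a + 1) (p, s)) - ζ)⁻¹) * ‖u p‖ ^ 2 : ℝ) : ℂ) := by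
    intro p
    rw [integral_mul_const, integral_complex_ofReal]
    simp only [RCLike.inner_apply, Complex.mul_conj', Complex.ofReal_mul, Complex.ofReal_pow]
  simp only [h1]
  rw [integral_complex_ofReal, ← Complex.ofReal_mul, ← integral_const_mul, sq_norm_eq_integral u,
    ← integral_sub (integrable_sq_norm u)]
  · congr 1
    refine integral_congr_ae (Eventually.of_forall fun p => ?_)
    simp only [channelDet_eq, coupling]
    ring
  · obtain ⟨C, hC⟩ := isCompact_univ.exists_bound_of_continuousOn
      (continuous_channelDet (mu := mu) hζ a).continuousOn
    exact (integrable_sq_norm u).bdd_mul (continuous_channelDet hζ a).aestronglyMeasurable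
      (Eventually.of_forall fun z => hC z trivial)

/-- Multiplication by `√Δ_a`. -/
noncomputable def sqrtDet (mu : Fin 3 → ℝ) (hζ : ∀ z, ζ < energy l K z) (a : Fin 3) :
    L2Torus →L[ℂ] L2Torus :=
  IntegralOperator.multiplication volume _
    (memLp_top_ofReal (φ := fun p => √(channelDet l mu a K p ζ))
      (continuous_channelDet hζ a).sqrt)

theorem sqrtDet_apply (hζ : ∀ z, ζ < energy l K z) (a : Fin 3) (u : L2Torus) :
    sqrtDet mu hζ a u =ᵐ[volume] fun p => ((√(channelDet l mu a K p ζ) : ℝ) : ℂ) * u p :=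
  IntegralOperator.multiplication_apply volume _ _ u

theorem sq_norm_sqrtDet (hζ : ∀ z, ζ < energy l K z) {a : Fin 3}
    (hΔ : ∀ᵐ p, 0 < channelDet l mu a K p ζ) (u : L2Torus) :
    ‖sqrtDet mu hζ a u‖ ^ 2 = ∫ p, channelDet l mu a K p ζ * ‖u p‖ ^ 2 := by
  rw [sq_norm_eq_integral]
  refine integral_congr_ae ?_
  filter_upwards [sqrtDet_apply hζ a u, hΔ] with p hp h0
  rw [hp, norm_mul, mul_pow, Complex.norm_real, Real.norm_eq_abs, sq_abs, Real.sq_sqrt h0.le]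

theorem faddeevEntry_self (l mu : Fin 3 → ℝ) (K : EuclideanSpace ℝ (Fin 3)) (ζ : ℝ) (a : Fin 3)
    (u : L2Torus) : faddeevEntry l mu K ζ a a u = 0 := by
  unfold faddeevEntry
  split_ifs with h
  · refine Lp.ext ?_
    filter_upwards [IntegralOperator.ofKernel_apply volume _ h u,
      Lp.coeFn_zero ℂ 2 (volume : Measure Torus)] with x hx h0
    rw [hx, h0]
    simp [faddeevKernel]
  · rfl

theorem faddeevEntry_apply (hHS : HilbertSchmidtKernels l mu K ζ) (a b : Fin 3) (u : L2Torus) :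
    faddeevEntry l mu K ζ a b u =ᵐ[volume] fun p => ∫ q, faddeevKernel l mu K ζ a b (p, q) * u q := by
  unfold faddeevEntry
  rw [dif_pos (hHS a b)]
  exact IntegralOperator.ofKernel_apply volume _ (hHS a b) u

/-- The off-diagonal blocks of `C* (H₀ - ζ)⁻¹ C` are `√Δ_b T_{ba} √Δ_a`. -/
theorem inner_freeResolvent_offDiag (hmu : ∀ a, 0 < mu a) (hζ : ∀ z, ζ < energy l K z)
    (hΔ : ∀ a, ∀ᵐ p, 0 < channelDet l mu a K p ζ) (hHS : HilbertSchmidtKernels l mu K ζ)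
    {a b : Fin 3} (hab : a ≠ b) (u v : L2Torus) :
    ((√(coupling mu a) : ℝ) : ℂ) * ((√(coupling mu b) : ℝ) : ℂ)
        * inner ℂ (freeResolvent hζ (liftCoord a u)) (liftCoord b v)
      = inner ℂ (faddeevEntry l mu K ζ b a (sqrtDet mu hζ a u)) (sqrtDet mu hζ b v) := by
  have hint := integrable_inner_coord hζ a b u v
  have hmp := measurePreserving_pairPoint hab.symm
  have hint' := hmp.integrable_comp_of_integrable hint
  simp only [Function.comp_def, coord_pairPoint_left hab.symm,
    coord_pairPoint_right hab.symm] at hint'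
  rw [inner_freeResolvent_liftCoord, integral_pairPoint hab.symm hint.1]
  simp only [coord_pairPoint_left hab.symm, coord_pairPoint_right hab.symm]
  rw [integral_prod _ hint', ← integral_const_mul, L2.inner_def]
  refine integral_congr_ae ?_
  filter_upwards [faddeevEntry_apply hHS b a (sqrtDet mu hζ a u), sqrtDet_apply hζ b v,
    hΔ b] with p h1 h2 h3
  have hk : ∀ᵐ q : Torus, faddeevKernel l mu K ζ b a (p, q) * sqrtDet mu hζ a u q
      = (((√(channelDet l mu b K p ζ))⁻¹ * (√(coupling mu a) * √(coupling mu b)) : ℝ) : ℂ)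
        * ((((energy l K (pairPoint b a (p, q)) - ζ)⁻¹ : ℝ) : ℂ) * u q) := by
    filter_upwards [sqrtDet_apply hζ a u, hΔ a] with q h4 h5
    have h6 : ((√(channelDet l mu a K q ζ) : ℝ) : ℂ) ≠ 0 := by
      exact_mod_cast (Real.sqrt_pos.2 h5).ne'
    have h7 : √(coupling mu a) * √(coupling mu b) = √(mu b * mu a) / (2 * Real.pi) ^ 3 := by
      have h8 : (0 : ℝ) < (2 * Real.pi) ^ 3 := by positivity
      rw [coupling, coupling, Real.sqrt_div (hmu a).le, Real.sqrt_div (hmu b).le,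
        Real.sqrt_mul (hmu b).le, div_mul_div_comm, Real.mul_self_sqrt h8.le, mul_comm (√(mu a))]
    rw [h4, faddeevKernel, if_neg hab.symm, h7, energy_pairPoint l K hab.symm]
    push_cast
    field_simp
  have h3' : ((√(channelDet l mu b K p ζ) : ℝ) : ℂ) ≠ 0 := by
    exact_mod_cast (Real.sqrt_pos.2 h3).ne'
  rw [h1, integral_congr_ae hk, integral_const_mul, h2]
  simp only [RCLike.inner_apply, map_mul, ← integral_conj, Complex.conj_ofReal]
  have h9 : ∀ q : Torus, (((energy l K (pairPoint b a (p, q)) - ζ)⁻¹ : ℝ) : ℂ)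
      * (v p * (starRingEnd ℂ) (u q))
      = v p * ((((energy l K (pairPoint b a (p, q)) - ζ)⁻¹ : ℝ) : ℂ) * (starRingEnd ℂ) (u q)) :=
    fun q => by ring
  simp only [h9, integral_const_mul]
  push_cast
  field_simp

/-- The diagonal operator `diag(√Δ_a)`. -/
noncomputable def sqrtDetVec (mu : Fin 3 → ℝ) (hζ : ∀ z, ζ < energy l K z) : L2Vec →L[ℂ] L2Vec :=
  ((PiLp.continuousLinearEquiv 2 ℂ (fun _ : Fin 3 => L2Torus)).symm :
      (Fin 3 → L2Torus) →L[ℂ] L2Vec).comp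
    (ContinuousLinearMap.pi fun a => (sqrtDet mu hζ a).comp
      (PiLp.proj 2 (fun _ : Fin 3 => L2Torus) a))

theorem sqrtDetVec_apply (hζ : ∀ z, ζ < energy l K z) (w : L2Vec) (a : Fin 3) :
    sqrtDetVec mu hζ w a = sqrtDet mu hζ a (w a) := by
  simp [sqrtDetVec]

theorem denseRange_sqrtDetVec (hζ : ∀ z, ζ < energy l K z)
    (hΔ : ∀ a, ∀ᵐ p, 0 < channelDet l mu a K p ζ) : DenseRange (sqrtDetVec mu hζ) := by
  have h1 : DenseRange (Pi.map fun a => (sqrtDet mu hζ a : L2Torus → L2Torus)) :=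
    DenseRange.piMap fun a => IntegralOperator.denseRange_multiplication _ (by
      filter_upwards [hΔ a] with p hp
      exact (Real.sqrt_pos.2 hp).ne')
  have h2 := (PiLp.continuousLinearEquiv 2 ℂ (fun _ : Fin 3 => L2Torus)).symm.surjective.denseRange.comp
    h1 (PiLp.continuousLinearEquiv 2 ℂ (fun _ : Fin 3 => L2Torus)).symm.continuous
  refine h2.mono ?_
  rintro _ ⟨w, rfl⟩
  refine ⟨(PiLp.continuousLinearEquiv 2 ℂ (fun _ : Fin 3 => L2Torus)).symm w, ?_⟩
  ext1 a
  rw [sqrtDetVec_apply]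
  rfl

/-- `C* (E - ζ)⁻¹ C - 1 = √Δ (T(K, ζ) - 1) √Δ`, as quadratic forms. -/
theorem birmanSchwinger_form (hmu : ∀ a, 0 < mu a) (hζ : ∀ z, ζ < energy l K z)
    (hΔ : ∀ a, ∀ᵐ p, 0 < channelDet l mu a K p ζ) (hHS : HilbertSchmidtKernels l mu K ζ)
    (w : L2Vec) :
    (inner ℂ (freeResolvent hζ (couplingMap mu w)) (couplingMap mu w) : ℂ).re - ‖w‖ ^ 2
      = (inner ℂ (faddeev l mu K ζ (sqrtDetVec mu hζ w)) (sqrtDetVec mu hζ w) : ℂ).re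
        - ‖sqrtDetVec mu hζ w‖ ^ 2 := by
  have hdiag : ∀ a, (((√(coupling mu a) : ℝ) : ℂ) * ((√(coupling mu a) : ℝ) : ℂ)
      * inner ℂ (freeResolvent hζ (liftCoord a (w a))) (liftCoord a (w a))).re
      = ‖w a‖ ^ 2 - ‖sqrtDet mu hζ a (w a)‖ ^ 2 := fun a => by
    rw [← Complex.ofReal_mul, Real.mul_self_sqrt (coupling_pos hmu a).le,
      inner_freeResolvent_diag, Complex.ofReal_re, sq_norm_sqrtDet hζ (hΔ a)]
  have h1 : (inner ℂ (freeResolvent hζ (couplingMap mu w)) (couplingMap mu w) : ℂ)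
      = ∑ a, ∑ b, ((√(coupling mu a) : ℝ) : ℂ) * ((√(coupling mu b) : ℝ) : ℂ)
        * inner ℂ (freeResolvent hζ (liftCoord a (w a))) (liftCoord b (w b)) := by
    rw [couplingMap_apply, map_sum, sum_inner]
    refine Finset.sum_congr rfl fun a _ => ?_
    rw [inner_sum]
    refine Finset.sum_congr rfl fun b _ => ?_
    rw [map_smul, inner_smul_left, inner_smul_right, Complex.conj_ofReal, mul_assoc]
  have h2 : (inner ℂ (faddeev l mu K ζ (sqrtDetVec mu hζ w)) (sqrtDetVec mu hζ w) : ℂ)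
      = ∑ b, ∑ a, inner ℂ (faddeevEntry l mu K ζ b a (sqrtDet mu hζ a (w a)))
        (sqrtDet mu hζ b (w b)) := by
    rw [PiLp.inner_apply]
    refine Finset.sum_congr rfl fun b _ => ?_
    rw [faddeev_apply, sum_inner]
    simp only [sqrtDetVec_apply]
  have h3 : ∀ a b, a ≠ b → inner ℂ (faddeevEntry l mu K ζ b a (sqrtDet mu hζ a (w a)))
        (sqrtDet mu hζ b (w b)) = ((√(coupling mu a) : ℝ) : ℂ) * ((√(coupling mu b) : ℝ) : ℂ)
        * inner ℂ (freeResolvent hζ (liftCoord a (w a))) (liftCoord b (w b)) :=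
    fun a b hab => (inner_freeResolvent_offDiag hmu hζ hΔ hHS hab _ _).symm
  rw [h1, h2, PiLp.norm_sq_eq_of_L2, PiLp.norm_sq_eq_of_L2]
  simp only [Fin.sum_univ_three, faddeevEntry_self, inner_zero_left, Complex.add_re, hdiag,
    sqrtDetVec_apply]
  rw [h3 1 0 (by decide), h3 2 0 (by decide), h3 0 1 (by decide), h3 2 1 (by decide),
    h3 0 2 (by decide), h3 1 2 (by decide)]
  simp only [Complex.zero_re]
  ring

/-- The Birman-Schwinger principle: the negative directions of `H(K) - ζ` are counted by the
Faddeev type operator `T(K, ζ)`. -/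
theorem countBelow_hamiltonian_eq_countAbove (hmu : ∀ a, 0 < mu a) (hζ : ∀ z, ζ < energy l K z)
    (hΔ : ∀ a, ∀ᵐ p, 0 < channelDet l mu a K p ζ) (hHS : HilbertSchmidtKernels l mu K ζ) :
    countBelow (hamiltonian l mu K) ζ = countAbove 1 (faddeev l mu K ζ) := by
  rw [countBelow_hamiltonian_eq_posIndex hmu hζ]
  exact posIndex_eq_countAbove (denseRange_sqrtDetVec hζ hΔ) (birmanSchwinger_form hmu hζ hΔ hHS)

end LatticeThreeBody

namespace LatticeThreeBody

variable {l mu : Fin 3 → ℝ} {K : EuclideanSpace ℝ (Fin 3)} {ζ : ℝ}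

/-! ### Self-adjointness and compactness -/

theorem isSelfAdjoint_hamiltonian (hmu : ∀ a, 0 < mu a) :
    IsSelfAdjoint (hamiltonian l mu K) := by
  rw [ContinuousLinearMap.isSelfAdjoint_iff_isSymmetric]
  intro f g
  have h : ∀ f, hamiltonian l mu K f = freeHamiltonian l K f
      - couplingMap mu (ContinuousLinearMap.adjoint (couplingMap mu) f) := fun f => by
    rw [couplingMap_adjoint hmu]
    simp only [hamiltonian, sub_apply]
    abel
  have h1 : inner ℂ (freeHamiltonian l K f) g = inner ℂ f (freeHamiltonian l K g) :=
    IntegralOperator.inner_multiplication_comm (memLp_kinetic l K) f g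
  simp only [ContinuousLinearMap.coe_coe, h]
  rw [inner_sub_left, inner_sub_right, h1, ← ContinuousLinearMap.adjoint_inner_right,
    ← ContinuousLinearMap.adjoint_inner_left (couplingMap mu)]

theorem kinetic_swap (l : Fin 3 → ℝ) (K : EuclideanSpace ℝ (Fin 3)) (a b : Fin 3) (p q : Torus) :
    kinetic l K a b p q = kinetic l K b a q p := by
  unfold kinetic
  rw [show third a b = third b a by rw [third, third, add_comm],
    show toTorus (massRatio l (third b a) • K) + p + q
      = toTorus (massRatio l (third b a) • K) + q + p by abel]
  ring

theorem faddeevKernel_symm (l mu : Fin 3 → ℝ) (K : EuclideanSpace ℝ (Fin 3)) (ζ : ℝ) (a b : Fin 3)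
    (p q : Torus) : faddeevKernel l mu K ζ b a (q, p)
      = (starRingEnd ℂ) (faddeevKernel l mu K ζ a b (p, q)) := by
  unfold faddeevKernel
  by_cases hab : a = b
  · simp [hab]
  · rw [if_neg hab, if_neg (Ne.symm hab), Complex.conj_ofReal, kinetic_swap l K b a,
      mul_comm (mu b), mul_comm (√(channelDet l mu b K q ζ))⁻¹]

theorem isSelfAdjoint_faddeev (hHS : HilbertSchmidtKernels l mu K ζ) :
    IsSelfAdjoint (faddeev l mu K ζ) := by
  rw [ContinuousLinearMap.isSelfAdjoint_iff_isSymmetric]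
  intro w v
  have h : ∀ a b (f g : L2Torus), inner ℂ (faddeevEntry l mu K ζ a b f) g
      = inner ℂ f (faddeevEntry l mu K ζ b a g) := fun a b f g => by
    unfold faddeevEntry
    rw [dif_pos (hHS a b), dif_pos (hHS b a)]
    exact IntegralOperator.inner_ofKernel_left _ _ (faddeevKernel_symm l mu K ζ a b) f g
  simp only [ContinuousLinearMap.coe_coe, PiLp.inner_apply, faddeev_apply, sum_inner, inner_sum, h]
  exact Finset.sum_comm

/-- The part of the kernel `T_{ab}` that is regular for `ζ` below the kinetic energy. -/
noncomputable def regularKernel (l mu : Fin 3 → ℝ) (K : EuclideanSpace ℝ (Fin 3)) (ζ : ℝ)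
    (a b : Fin 3) (p : Torus × Torus) : ℂ :=
  ((√(mu a * mu b) / (2 * Real.pi) ^ 3 / (kinetic l K a b p.1 p.2 - ζ) : ℝ) : ℂ)

theorem lt_kinetic (hζ : ∀ z, ζ < energy l K z) {a b : Fin 3} (hab : a ≠ b) (p q : Torus) :
    ζ < kinetic l K a b p q := by
  have h := hζ (pairPoint a b (p, q))
  rwa [energy_pairPoint l K hab] at h

theorem continuous_regularKernel (hζ : ∀ z, ζ < energy l K z) {a b : Fin 3} (hab : a ≠ b) :
    Continuous (regularKernel l mu K ζ a b) :=
  Complex.continuous_ofReal.comp (continuous_const.div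
    ((continuous_kinetic l K a b).sub continuous_const)
    fun z => (sub_pos.2 (lt_kinetic hζ hab z.1 z.2)).ne')

theorem faddeevKernel_eq {a b : Fin 3} (hab : a ≠ b) (z : Torus × Torus) :
    faddeevKernel l mu K ζ a b z = (((√(channelDet l mu a K z.1 ζ))⁻¹ : ℝ) : ℂ)
      * (((√(channelDet l mu b K z.2 ζ))⁻¹ : ℝ) : ℂ) * regularKernel l mu K ζ a b z := by
  unfold faddeevKernel regularKernel
  rw [if_neg hab]
  push_cast
  ring

theorem hilbertSchmidtKernels_of_memLp (hζ : ∀ z, ζ < energy l K z)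
    (hL : ∀ a, MemLp (fun p => (((√(channelDet l mu a K p ζ))⁻¹ : ℝ) : ℂ)) 2) :
    HilbertSchmidtKernels l mu K ζ := by
  intro a b
  by_cases hab : a = b
  · have h : faddeevKernel l mu K ζ a b = 0 := by
      ext z
      simp [faddeevKernel, hab]
    rw [h]
    exact MemLp.zero
  · have hg := continuous_regularKernel (mu := mu) hζ hab
    obtain ⟨B, hB⟩ := isCompact_univ.exists_bound_of_continuousOn hg.continuousOn
    have huv := IntegralOperator.memLp_tensor (hL a) (hL b)
    have h : faddeevKernel l mu K ζ a b = fun z => (((√(channelDet l mu a K z.1 ζ))⁻¹ : ℝ) : ℂ)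
      * (((√(channelDet l mu b K z.2 ζ))⁻¹ : ℝ) : ℂ) * regularKernel l mu K ζ a b z :=
      funext fun z => faddeevKernel_eq hab z
    rw [h]
    refine MemLp.of_le_mul (c := B) huv (huv.1.mul hg.aestronglyMeasurable)
      (Eventually.of_forall fun z => ?_)
    rw [norm_mul _ (regularKernel l mu K ζ a b z), mul_comm]
    exact mul_le_mul_of_nonneg_right (hB _ trivial) (norm_nonneg _)

theorem faddeev_mem_closure_finiteRankOperators (hζ : ∀ z, ζ < energy l K z)
    (hL : ∀ a, MemLp (fun p => (((√(channelDet l mu a K p ζ))⁻¹ : ℝ) : ℂ)) 2) :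
    faddeev l mu K ζ ∈ (finiteRankOperators L2Vec L2Vec).topologicalClosure := by
  have hHS := hilbertSchmidtKernels_of_memLp hζ hL
  have hentry : ∀ a b, faddeevEntry l mu K ζ a b
      ∈ (finiteRankOperators L2Torus L2Torus).topologicalClosure := fun a b => by
    by_cases hab : a = b
    · have h : faddeevEntry l mu K ζ a b = 0 := by
        ext1 u
        rw [hab, faddeevEntry_self]
        rfl
      rw [h]
      exact Submodule.zero_mem _
    · unfold faddeevEntry
      rw [dif_pos (hHS a b)]
      exact IntegralOperator.ofKernel_mem_closure_finiteRankOperators (hL a) (hL b)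
        (continuous_regularKernel hζ hab) (hHS a b) (faddeevKernel_eq hab)
  set ι : Fin 3 → L2Torus →L[ℂ] L2Vec := fun a =>
    ((PiLp.continuousLinearEquiv 2 ℂ (fun _ : Fin 3 => L2Torus)).symm :
      (Fin 3 → L2Torus) →L[ℂ] L2Vec).comp
      (ContinuousLinearMap.single ℂ (fun _ : Fin 3 => L2Torus) a) with hι
  have hsum : faddeev l mu K ζ = ∑ a, ∑ b, (ι a).comp ((faddeevEntry l mu K ζ a b).comp
      (PiLp.proj 2 (fun _ : Fin 3 => L2Torus) b)) := by
    ext1 w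
    ext1 c
    rw [faddeev_apply]
    simp only [sum_apply, ContinuousLinearMap.comp_apply, WithLp.ofLp_sum, Finset.sum_apply, hι]
    refine Eq.trans ?_ (Finset.sum_eq_single c ?_ ?_).symm
    · refine Finset.sum_congr rfl fun b _ => ?_
      simp
    · intro a _ hac
      refine Finset.sum_eq_zero fun b _ => ?_
      simp [hac.symm]
    · simp
  rw [hsum]
  exact Submodule.sum_mem _ fun a _ => Submodule.sum_mem _ fun b _ =>
    comp_comp_mem_closure_finiteRankOperators _ _ (hentry a b)

theorem memLp_inv_sqrt_of_pos (hζ : ∀ z, ζ < energy l K z) {a : Fin 3}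
    (hΔ : ∀ p, 0 < channelDet l mu a K p ζ) :
    MemLp (fun p => (((√(channelDet l mu a K p ζ))⁻¹ : ℝ) : ℂ)) 2 :=
  (memLp_top_ofReal (μ := (volume : Measure Torus)) ((continuous_channelDet hζ a).sqrt.inv₀
    fun p => (Real.sqrt_pos.2 (hΔ p)).ne')).mono_exponent le_top

theorem countBelow_hamiltonian_ne_top (hmu : ∀ a, 0 < mu a) (hζ : ∀ z, ζ < energy l K z)
    (hΔ : ∀ a p, 0 < channelDet l mu a K p ζ) : countBelow (hamiltonian l mu K) ζ ≠ ⊤ := by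
  have hL := fun a => memLp_inv_sqrt_of_pos hζ (hΔ a)
  rw [countBelow_hamiltonian_eq_countAbove hmu hζ (fun a => Eventually.of_forall (hΔ a))
    (hilbertSchmidtKernels_of_memLp hζ hL)]
  exact countAbove_ne_top_of_mem_closure_finiteRankOperators
    (faddeev_mem_closure_finiteRankOperators hζ hL) one_pos

/-! ### Infinitely many negative directions -/

theorem volume_singleton_circle (x : AddCircle (2 * Real.pi)) :
    volume ({x} : Set (AddCircle (2 * Real.pi))) = 0 := by
  have := AddCircle.volume_closedBall (2 * Real.pi) (x := x) 0
  rw [Metric.closedBall_zero] at this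
  rw [this]
  simp [Real.pi_pos.le]

theorem volume_singleton_torus (p : Torus) : (volume : Measure Torus) {p} = 0 := by
  rw [volume_pi, Measure.pi_singleton]
  simp [volume_singleton_circle]

theorem exists_linearIndependent_supported {U : Set Torus} (hU : IsOpen U) (hne : U.Nonempty) :
    ∃ v : ℕ → L2Torus, LinearIndependent ℂ v ∧ ∀ n, ∀ᵐ p, p ∉ U → v n p = 0 := by
  have hinf : U.Infinite := fun hfin =>
    (hU.measure_pos volume hne).ne' <| by
    rw [← Set.biUnion_of_singleton U]
    exact (measure_biUnion_null_iff hfin.countable).2 fun p _ => volume_singleton_torus p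
  have : Infinite U := hinf.to_subtype
  obtain ⟨V, hVi, hVo, hVd⟩ := exists_seq_infinite_isOpen_pairwise_disjoint U
  set W : ℕ → Set Torus := fun n => Subtype.val '' V n with hW
  have hWo : ∀ n, IsOpen (W n) := fun n => hU.isOpenMap_subtype_val _ (hVo n)
  have hWd : ∀ i j, i ≠ j → Disjoint (W i) (W j) := fun i j hij =>
    (Set.disjoint_image_iff Subtype.val_injective).2 (hVd hij)
  set v : ℕ → L2Torus := fun n =>
    indicatorConstLp 2 (hWo n).measurableSet (measure_ne_top volume _) (1 : ℂ) with hv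
  have hcoe : ∀ n, v n =ᵐ[volume] (W n).indicator fun _ => 1 := fun n => indicatorConstLp_coeFn
  refine ⟨v, linearIndependent_of_ne_zero_of_inner_eq_zero (fun n h0 => ?_) fun i j hij => ?_,
    fun n => ?_⟩
  · have h1 : ∀ᵐ p : Torus, p ∉ W n := by
      have h2 := hcoe n
      rw [h0] at h2
      filter_upwards [h2, Lp.coeFn_zero ℂ 2 (volume : Measure Torus)] with p hp hz hpW
      rw [hz, Set.indicator_of_mem hpW] at hp
      simp at hp
    have h3 : volume (W n) = 0 := by simpa [ae_iff] using h1
    exact ((hWo n).measure_pos volume ((hVi n).nonempty.image _)).ne' h3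
  · change inner ℂ (v i) (v j) = 0
    rw [L2.inner_def, ← integral_zero Torus ℂ]
    refine integral_congr_ae ?_
    filter_upwards [hcoe i, hcoe j] with p h1 h2
    rw [h1, h2, RCLike.inner_apply]
    by_cases hp : p ∈ W i
    · rw [Set.indicator_of_notMem ((hWd i j hij).notMem_of_mem_left hp), zero_mul]
    · rw [Set.indicator_of_notMem hp, map_zero, mul_zero]
  · filter_upwards [hcoe n] with p hp hpU
    rw [hp, Set.indicator_of_notMem]
    rintro ⟨x, -, rfl⟩
    exact hpU x.2

/-- If some `Δ_a(K, ·, ζ)` is negative somewhere, the functions of `p_a` supported where it is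
negative give infinitely many negative directions of `H(K) - ζ`. -/
theorem countBelow_hamiltonian_eq_top (hmu : ∀ a, 0 < mu a) (hζ : ∀ z, ζ < energy l K z)
    {a : Fin 3} {p₀ : Torus} (hΔ : channelDet l mu a K p₀ ζ < 0) :
    countBelow (hamiltonian l mu K) ζ = ⊤ := by
  rw [countBelow_hamiltonian_eq_posIndex hmu hζ]
  have hc := continuous_channelDet (mu := mu) hζ a
  set U : Set Torus := {p | channelDet l mu a K p ζ < 0} with hU
  have hUo : IsOpen U := isOpen_lt hc continuous_const
  obtain ⟨v, hv, hvU⟩ := exists_linearIndependent_supported hUo ⟨p₀, hΔ⟩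
  set S : Submodule ℂ L2Torus :=
    { carrier := {u | ∀ᵐ p, p ∉ U → u p = 0}
      zero_mem' := by
        filter_upwards [Lp.coeFn_zero ℂ 2 (volume : Measure Torus)] with p hp _
        rw [hp]; rfl
      add_mem' := by
        intro u u' hu hu'
        filter_upwards [hu, hu', Lp.coeFn_add u u'] with p h1 h2 h3 hp
        rw [h3, Pi.add_apply, h1 hp, h2 hp, add_zero]
      smul_mem' := by
        intro c u hu
        filter_upwards [hu, Lp.coeFn_smul c u] with p h1 h3 hp
        rw [h3, Pi.smul_apply, h1 hp, smul_zero] } with hS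
  have htop : posIndex (fun u : L2Torus => -∫ p, channelDet l mu a K p ζ * ‖u p‖ ^ 2) = ⊤ := by
    refine posIndex_eq_top_of_linearIndependent S (fun u hu hu0 => ?_) v hv hvU
    have hu' : ∀ᵐ p, p ∉ U → u p = 0 := hu
    have hint : Integrable fun p => -(channelDet l mu a K p ζ * ‖u p‖ ^ 2) := by
      obtain ⟨C, hC⟩ := isCompact_univ.exists_bound_of_continuousOn hc.continuousOn
      exact ((integrable_sq_norm u).bdd_mul hc.aestronglyMeasurable
        (Eventually.of_forall fun z => hC z trivial)).neg
    have hnn : 0 ≤ᵐ[volume] fun p => -(channelDet l mu a K p ζ * ‖u p‖ ^ 2) := by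
      filter_upwards [hu'] with p hp
      by_cases h : p ∈ U
      · have h1 : channelDet l mu a K p ζ < 0 := h
        simp only [Pi.zero_apply]
        nlinarith [sq_nonneg ‖u p‖]
      · simp [hp h]
    rw [← integral_neg]
    refine lt_of_le_of_ne (integral_nonneg_of_ae hnn) fun h0 => hu0 (Lp.ext ?_)
    have h1 := (integral_eq_zero_iff_of_nonneg_ae hnn hint).1 h0.symm
    filter_upwards [h1, hu', Lp.coeFn_zero ℂ 2 (volume : Measure Torus)] with p h2 h3 h4
    rw [h4]
    by_cases h : p ∈ U
    · have h5 : channelDet l mu a K p ζ ≠ 0 := ne_of_lt h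
      simpa [h5] using h2
    · simpa using h3 h
  rw [← top_le_iff, ← htop]
  refine posIndex_le_of_map (((PiLp.continuousLinearEquiv 2 ℂ (fun _ : Fin 3 => L2Torus)).symm :
      (Fin 3 → L2Torus) →ₗ[ℂ] L2Vec).comp (LinearMap.single ℂ (fun _ : Fin 3 => L2Torus) a))
    (fun u _ hu => ?_) (by simp)
  set w : L2Vec := (((PiLp.continuousLinearEquiv 2 ℂ (fun _ : Fin 3 => L2Torus)).symm :
      (Fin 3 → L2Torus) →ₗ[ℂ] L2Vec).comp (LinearMap.single ℂ (fun _ : Fin 3 => L2Torus) a)) u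
    with hw
  have hwa : ∀ b, w b = (Pi.single a u : Fin 3 → L2Torus) b := fun b => rfl
  have h1 : couplingMap mu w = ((√(coupling mu a) : ℝ) : ℂ) • liftCoord a u := by
    rw [couplingMap_apply, Finset.sum_eq_single a]
    · rw [hwa, Pi.single_eq_same]
    · intro b _ hb
      rw [hwa, Pi.single_eq_of_ne hb, map_zero, smul_zero]
    · simp
  have h2 : ‖w‖ ^ 2 = ‖u‖ ^ 2 := by
    rw [PiLp.norm_sq_eq_of_L2, Finset.sum_eq_single a]
    · rw [hwa, Pi.single_eq_same]
    · intro b _ hb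
      rw [hwa, Pi.single_eq_of_ne hb]
      simp
    · simp
  rw [h1, h2, map_smul, inner_smul_left, inner_smul_right, Complex.conj_ofReal, ← mul_assoc,
    ← Complex.ofReal_mul, Real.mul_self_sqrt (coupling_pos hmu a).le, inner_freeResolvent_diag,
    Complex.ofReal_re]
  linarith

/-! ### The bottom of the essential spectrum -/

theorem channelDet_strictAnti (hmu : ∀ a, 0 < mu a) {ζ' : ℝ} (h : ζ < ζ')
    (hζ' : ∀ z, ζ' < energy l K z) (a : Fin 3) (p : Torus) :
    channelDet l mu a K p ζ' < channelDet l mu a K p ζ := by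
  have hζ : ∀ z, ζ < energy l K z := fun z => h.trans (hζ' z)
  rw [channelDet_eq, channelDet_eq]
  have hlt : ∫ s : Torus, (energy l K (pairPoint a (a + 1) (p, s)) - ζ)⁻¹
      < ∫ s : Torus, (energy l K (pairPoint a (a + 1) (p, s)) - ζ')⁻¹ := by
    rw [← sub_pos, ← integral_sub (integrable_fibre hζ' a p) (integrable_fibre hζ a p)]
    have hpos : ∀ s : Torus, 0 < (energy l K (pairPoint a (a + 1) (p, s)) - ζ')⁻¹
        - (energy l K (pairPoint a (a + 1) (p, s)) - ζ)⁻¹ := fun s =>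
      sub_pos.2 (inv_strictAnti₀ (sub_pos.2 (hζ' _)) (by linarith))
    exact integral_pos_of_ae_pos ((integrable_fibre hζ' a p).sub (integrable_fibre hζ a p))
      (Eventually.of_forall hpos)
  have := coupling_pos hmu a
  unfold coupling at this
  nlinarith

theorem channelDet_sub_le (hmu : ∀ a, 0 < mu a) {ζ' g : ℝ} (h : ζ ≤ ζ') (hg : 0 < g)
    (hζ' : ∀ z, ζ' + g ≤ energy l K z) (a : Fin 3) (p : Torus) :
    channelDet l mu a K p ζ - channelDet l mu a K p ζ'
      ≤ coupling mu a * ((ζ' - ζ) / g ^ 2 * (volume : Measure Torus).real Set.univ) := by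
  have hζ1 : ∀ z, ζ' < energy l K z := fun z => by linarith [hζ' z]
  have hζ : ∀ z, ζ < energy l K z := fun z => by linarith [hζ' z]
  rw [channelDet_eq, channelDet_eq, coupling]
  have h1 : (∫ s : Torus, (energy l K (pairPoint a (a + 1) (p, s)) - ζ')⁻¹)
      - ∫ s : Torus, (energy l K (pairPoint a (a + 1) (p, s)) - ζ)⁻¹
      ≤ (ζ' - ζ) / g ^ 2 * (volume : Measure Torus).real Set.univ := by
    rw [← integral_sub (integrable_fibre hζ1 a p) (integrable_fibre hζ a p)]
    have h2 := integral_mono (μ := (volume : Measure Torus))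
      ((integrable_fibre hζ1 a p).sub (integrable_fibre hζ a p))
      (integrable_const ((ζ' - ζ) / g ^ 2)) (fun s => by
        set e := energy l K (pairPoint a (a + 1) (p, s))
        have he : ζ' + g ≤ e := hζ' _
        have e1 : 0 < e - ζ' := by linarith
        have e2 : 0 < e - ζ := by linarith
        simp only [Pi.sub_apply]
        rw [inv_sub_inv e1.ne' e2.ne', show e - ζ - (e - ζ') = ζ' - ζ by ring]
        refine div_le_div_of_nonneg_left (sub_nonneg.2 h) (by positivity) ?_
        nlinarith)
    rw [integral_const, smul_eq_mul, mul_comm (volume.real Set.univ)] at h2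
    exact h2
  have := coupling_pos hmu a
  unfold coupling at this
  nlinarith

theorem exists_energy_min (l : Fin 3 → ℝ) (K : EuclideanSpace ℝ (Fin 3)) :
    ∃ z₀, ∀ z, energy l K z₀ ≤ energy l K z := by
  obtain ⟨z₀, -, h⟩ := isCompact_univ.exists_isMinOn Set.univ_nonempty
    (continuous_energy l K).continuousOn
  exact ⟨z₀, fun z => h trivial⟩

theorem exists_channelDet_pos (hmu : ∀ a, 0 < mu a) (l : Fin 3 → ℝ)
    (K : EuclideanSpace ℝ (Fin 3)) :
    ∃ ζ, (∀ z, ζ < energy l K z) ∧ ∀ a p, 0 < channelDet l mu a K p ζ := by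
  obtain ⟨z₀, hz₀⟩ := exists_energy_min l K
  set V := (volume : Measure Torus).real Set.univ with hV
  have hV0 : 0 ≤ V := measureReal_nonneg
  set X := (∑ a, coupling mu a) * V + 1 with hX
  have hc : ∀ a, coupling mu a ≤ ∑ a, coupling mu a := fun a =>
    Finset.single_le_sum (fun b _ => (coupling_pos hmu b).le) (Finset.mem_univ a)
  have hs0 : 0 ≤ ∑ a, coupling mu a := Finset.sum_nonneg fun b _ => (coupling_pos hmu b).le
  have hX0 : 0 < X := by positivity
  refine ⟨energy l K z₀ - X, fun z => by linarith [hz₀ z], fun a p => ?_⟩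
  have hζ : ∀ z, energy l K z₀ - X < energy l K z := fun z => by linarith [hz₀ z]
  rw [channelDet_eq]
  have h1 : ∫ s : Torus, (energy l K (pairPoint a (a + 1) (p, s)) - (energy l K z₀ - X))⁻¹
      ≤ V * X⁻¹ := by
    have h2 := integral_mono (μ := (volume : Measure Torus)) (integrable_fibre hζ a p)
      (integrable_const X⁻¹) (fun s => inv_anti₀ hX0 (by linarith [hz₀ (pairPoint a (a + 1) (p, s))]))
    rwa [integral_const, smul_eq_mul] at h2
  have h3 := coupling_pos hmu a
  have h4 : coupling mu a * (V * X⁻¹) < 1 := by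
    rw [← mul_assoc, ← div_eq_mul_inv, div_lt_one hX0, hX]
    have := mul_le_mul_of_nonneg_right (hc a) hV0
    linarith
  have h5 := mul_le_mul_of_nonneg_left h1 h3.le
  unfold coupling at h4 h5
  linarith

/-- If some channel determinant is negative somewhere below the free spectrum, then `τ_ess(K)` is
the largest `τ` such that all channel determinants are nonnegative at `τ`. -/
theorem tauEss_spec (hmu : ∀ a, 0 < mu a) {ζ₁ : ℝ} (hζ₁ : ∀ z, ζ₁ < energy l K z)
    (hneg : ∃ a p, channelDet l mu a K p ζ₁ < 0) :
    (∀ z, tauEss l mu K < energy l K z) ∧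
      (∀ a p, 0 ≤ channelDet l mu a K p (tauEss l mu K)) ∧
      ∀ t ∈ essSpectrum (hamiltonian l mu K), tauEss l mu K ≤ t := by
  have hsa := isSelfAdjoint_hamiltonian (l := l) (K := K) hmu
  -- `Z` is a lower set bounded by `ζ₁`; `H(K)` has finitely many negative directions relative to the
  -- points of `Z` and infinitely many relative to the points above its supremum.
  set Z : Set ℝ := {ζ | (∀ z, ζ < energy l K z) ∧ ∀ a p, 0 < channelDet l mu a K p ζ} with hZ
  obtain ⟨a₁, p₁, h₁⟩ := hneg
  have hdown : ∀ ζ ∈ Z, ∀ ζ' < ζ, ζ' ∈ Z := fun ζ hζ ζ' h =>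
    ⟨fun z => h.trans (hζ.1 z), fun a p =>
      (hζ.2 a p).trans (channelDet_strictAnti hmu h hζ.1 a p)⟩
  have hub : ∀ ζ ∈ Z, ζ ≤ ζ₁ := fun ζ hζ => by
    by_contra! h
    exact absurd ((hdown ζ hζ ζ₁ h).2 a₁ p₁) h₁.not_gt
  have hbdd : BddAbove Z := ⟨ζ₁, hub⟩
  have hne : Z.Nonempty := exists_channelDet_pos hmu l K
  set τ := sSup Z with hτ
  have hτ₁ : τ ≤ ζ₁ := csSup_le hne hub
  have hτE : ∀ z, τ < energy l K z := fun z => hτ₁.trans_lt (hζ₁ z)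
  have hlt : ∀ ζ < τ, ζ ∈ Z := fun ζ h => by
    obtain ⟨ζ', hζ', hlt⟩ := exists_lt_of_lt_csSup hne h
    exact hdown ζ' hζ' ζ hlt
  have hlow : ∀ t ∈ essSpectrum (hamiltonian l mu K), τ ≤ t := fun t ht => by
    by_contra! h
    obtain ⟨ζ, h1, h2⟩ := exists_between h
    have h3 := hlt ζ h2
    have h4 := le_of_mem_essSpectrum_of_countBelow_ne_top hsa
      (countBelow_hamiltonian_ne_top hmu h3.1 h3.2) t ht
    linarith
  obtain ⟨z₀, hz₀⟩ := exists_energy_min l K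
  have hess : ∀ ζ, τ < ζ → ζ < energy l K z₀ → ∃ t ∈ essSpectrum (hamiltonian l mu K), t ≤ ζ := by
    intro ζ h1 h2
    have hζ : ∀ z, ζ < energy l K z := fun z => h2.trans_le (hz₀ z)
    obtain ⟨ζ', h3, h4⟩ := exists_between h1
    have h5 : ζ' ∉ Z := fun h => (le_csSup hbdd h).not_gt h3
    have h6 : ∃ a p, channelDet l mu a K p ζ' ≤ 0 := by
      by_contra! h
      exact h5 ⟨fun z => h4.trans (hζ z), h⟩
    obtain ⟨a, p, h7⟩ := h6
    exact exists_essSpectrum_le_of_countBelow_eq_top hsa (countBelow_hamiltonian_eq_top hmu hζ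
      ((channelDet_strictAnti hmu h4 hζ a p).trans_le h7))
  have heq : tauEss l mu K = τ := by
    refine le_antisymm (le_of_forall_gt_imp_ge_of_dense fun ζ h => ?_) ?_
    · obtain ⟨ζ', h1, h2⟩ := exists_between (lt_min h (hτE z₀))
      obtain ⟨t, ht, htζ⟩ := hess ζ' h1 (h2.trans_le (min_le_right _ _))
      exact (csInf_le ⟨τ, hlow⟩ ht).trans (htζ.trans (h2.le.trans (min_le_left _ _)))
    · obtain ⟨ζ', h1, h2⟩ := exists_between (hτE z₀)
      obtain ⟨t, ht, -⟩ := hess ζ' h1 h2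
      exact le_csInf ⟨t, ht⟩ hlow
  rw [heq]
  -- `Δ_a` is Lipschitz in `ζ` below the free spectrum, so nonnegativity persists at the supremum.
  refine ⟨hτE, fun a p => ?_, hlow⟩
  by_contra! hneg
  set g := energy l K z₀ - τ with hg
  have hg0 : 0 < g := sub_pos.2 (hτE z₀)
  set C := coupling mu a * (volume : Measure Torus).real Set.univ / g ^ 2 with hC
  have hC0 : 0 ≤ C := div_nonneg (mul_nonneg (coupling_pos hmu a).le measureReal_nonneg) (by positivity)
  set η := -channelDet l mu a K p τ / (C + 1) with hη
  have hη0 : 0 < η := div_pos (neg_pos.2 hneg) (by linarith)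
  have h1 := channelDet_sub_le (ζ := τ - η) (ζ' := τ) (K := K) (l := l) hmu (by linarith) hg0
    (fun z => by linarith [hz₀ z]) a p
  have h2 := (hlt (τ - η) (by linarith)).2 a p
  have h3 : coupling mu a * ((τ - (τ - η)) / g ^ 2 * (volume : Measure Torus).real Set.univ)
      = C * η := by rw [hC]; ring
  have h4 : (C + 1) * η = -channelDet l mu a K p τ := by
    rw [hη]; field_simp
  rw [h3] at h1
  linarith

end LatticeThreeBody

namespace LatticeThreeBody

/-! ### The dispersion on the torus -/

theorem cosCircle_coe (x : ℝ) : cosCircle (x : AddCircle (2 * Real.pi)) = Real.cos x := rfl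

theorem continuous_cosCircle : Continuous cosCircle :=
  continuous_coinduced_dom.mpr Real.continuous_cos

theorem exists_coe_eq_circle (q : AddCircle (2 * Real.pi)) :
    ∃ x : ℝ, (x : AddCircle (2 * Real.pi)) = q ∧ |x| ≤ Real.pi ∧ ‖q‖ = |x| := by
  set y := AddCircle.equivIoc (2 * Real.pi) (-Real.pi) q
  have h1 : ((y : ℝ) : AddCircle (2 * Real.pi)) = q := AddCircle.coe_equivIoc
  have h2 : |(y : ℝ)| ≤ Real.pi := by
    have := y.2
    rw [abs_le]
    constructor <;> linarith [this.1, this.2]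
  refine ⟨y, h1, h2, ?_⟩
  rw [← h1, AddCircle.norm_coe_eq_abs_iff _ Real.two_pi_pos.ne', abs_of_pos Real.two_pi_pos]
  linarith

theorem one_sub_cosCircle_le (q : AddCircle (2 * Real.pi)) : 1 - cosCircle q ≤ ‖q‖ ^ 2 / 2 := by
  obtain ⟨x, rfl, -, hn⟩ := exists_coe_eq_circle q
  rw [hn, sq_abs, cosCircle_coe]
  linarith [Real.one_sub_sq_div_two_le_cos (x := x)]

theorem le_one_sub_cosCircle (q : AddCircle (2 * Real.pi)) :
    2 / Real.pi ^ 2 * ‖q‖ ^ 2 ≤ 1 - cosCircle q := by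
  obtain ⟨x, rfl, hx, hn⟩ := exists_coe_eq_circle q
  rw [hn, sq_abs, cosCircle_coe]
  linarith [Real.cos_le_one_sub_mul_cos_sq hx]

theorem cosCircle_le_one (q : AddCircle (2 * Real.pi)) : cosCircle q ≤ 1 := by
  obtain ⟨x, rfl, -⟩ := exists_coe_eq_circle q
  exact Real.cos_le_one x

theorem neg_one_le_cosCircle (q : AddCircle (2 * Real.pi)) : -1 ≤ cosCircle q := by
  obtain ⟨x, rfl, -⟩ := exists_coe_eq_circle q
  exact Real.neg_one_le_cos x

theorem cosCircle_lt_one {q : AddCircle (2 * Real.pi)} (hq : q ≠ 0) : cosCircle q < 1 := by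
  have h := le_one_sub_cosCircle q
  have h1 : 0 < ‖q‖ := norm_pos_iff.2 hq
  have h2 : 0 < 2 / Real.pi ^ 2 * ‖q‖ ^ 2 := by positivity
  linarith

theorem cosCircle_zero : cosCircle 0 = 1 := by
  have := cosCircle_coe 0
  simpa using this

theorem disp_nonneg (q : Torus) : 0 ≤ disp q :=
  Finset.sum_nonneg fun _ _ => sub_nonneg.2 (cosCircle_le_one _)

theorem disp_pos {q : Torus} (hq : q ≠ 0) : 0 < disp q := by
  obtain ⟨i, hi⟩ := Function.ne_iff.1 hq
  exact Finset.sum_pos' (fun _ _ => sub_nonneg.2 (cosCircle_le_one _))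
    ⟨i, Finset.mem_univ _, sub_pos.2 (cosCircle_lt_one hi)⟩

theorem ae_torus_ne (p : Torus) : ∀ᵐ q : Torus, ∀ i, q i ≠ p i := by
  rw [ae_all_iff]
  intro i
  have h : ∀ᵐ x : AddCircle (2 * Real.pi), x ≠ p i := by
    simp [ae_iff, volume_singleton_circle]
  exact (Measure.quasiMeasurePreserving_eval
    (fun _ : Fin 3 => (volume : Measure (AddCircle (2 * Real.pi)))) i).ae h

theorem integrable_norm_circle_rpow :
    Integrable fun q : AddCircle (2 * Real.pi) => ‖q‖ ^ (-(2 / 3) : ℝ) := by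
  have hmp := AddCircle.measurePreserving_mk (2 * Real.pi) (-Real.pi)
  have hm : Measurable fun q : AddCircle (2 * Real.pi) => ‖q‖ ^ (-(2 / 3) : ℝ) :=
    continuous_norm.measurable.pow_const _
  rw [← hmp.integrable_comp hm.aestronglyMeasurable]
  have hpos : IntervalIntegrable (fun x : ℝ => |x| ^ (-(2 / 3) : ℝ)) volume 0 Real.pi := by
    refine (intervalIntegral.intervalIntegrable_rpow' (r := -(2 / 3)) (by norm_num)).congr ?_
    rw [Set.uIoc_of_le Real.pi_pos.le]
    intro x hx
    simp only
    rw [abs_of_pos hx.1]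
  have hneg : IntervalIntegrable (fun x : ℝ => |x| ^ (-(2 / 3) : ℝ)) volume (-Real.pi) 0 := by
    have h := (IntervalIntegrable.iff_comp_neg (by simp)).1 hpos
    simp only [abs_neg, neg_zero] at h
    exact h.symm
  have h := hneg.trans hpos
  rw [intervalIntegrable_iff_integrableOn_Ioc_of_le (by linarith [Real.pi_pos])] at h
  rw [show -Real.pi + 2 * Real.pi = Real.pi by ring]
  refine h.congr_fun ?_ measurableSet_Ioc
  intro x hx
  have h1 : ‖((x : ℝ) : AddCircle (2 * Real.pi))‖ = |x| := by
    rw [AddCircle.norm_coe_eq_abs_iff _ Real.two_pi_pos.ne', abs_of_pos Real.two_pi_pos, abs_le]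
    constructor <;> linarith [hx.1, hx.2]
  simp only [Function.comp_apply, h1]

/-- `1 / ε` is integrable on the three dimensional torus: by the inequality of the arithmetic and
geometric means it is dominated by the product of the functions `|q_i|^(-2/3)`. -/
theorem integrable_inv_disp : Integrable fun q : Torus => (disp q)⁻¹ := by
  have hprod : Integrable fun q : Torus => ∏ i, ‖q i‖ ^ (-(2 / 3) : ℝ) :=
    Integrable.fintype_prod (f := fun _ (q : AddCircle (2 * Real.pi)) => ‖q‖ ^ (-(2 / 3) : ℝ))
      fun _ => integrable_norm_circle_rpow
  refine (hprod.const_mul (Real.pi ^ 2 / 2)).mono'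
    (continuous_disp.measurable.inv.aestronglyMeasurable) ?_
  filter_upwards [ae_torus_ne 0] with q hq
  have hq' : ∀ i, 0 < ‖q i‖ := fun i => norm_pos_iff.2 (hq i)
  have h1 : ∏ i, ‖q i‖ ^ (2 / 3 : ℝ) ≤ ∑ i, ‖q i‖ ^ 2 := by
    have h2 := Real.geom_mean_le_arith_mean3_weighted (w₁ := 1 / 3) (w₂ := 1 / 3) (w₃ := 1 / 3)
      (by norm_num) (by norm_num) (by norm_num) (sq_nonneg ‖q 0‖) (sq_nonneg ‖q 1‖)
      (sq_nonneg ‖q 2‖) (by norm_num)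
    have h3 : ∀ i, (‖q i‖ ^ 2) ^ (1 / 3 : ℝ) = ‖q i‖ ^ (2 / 3 : ℝ) := fun i => by
      rw [← Real.rpow_natCast, ← Real.rpow_mul (hq' i).le]
      norm_num
    rw [h3, h3, h3] at h2
    rw [Fin.prod_univ_three, Fin.sum_univ_three]
    refine h2.trans ?_
    nlinarith [sq_nonneg ‖q 0‖, sq_nonneg ‖q 1‖, sq_nonneg ‖q 2‖]
  have h4 : 2 / Real.pi ^ 2 * ∑ i, ‖q i‖ ^ 2 ≤ disp q := by
    rw [Finset.mul_sum]
    exact Finset.sum_le_sum fun i _ => le_one_sub_cosCircle (q i)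
  have h5 : 0 < ∏ i, ‖q i‖ ^ (2 / 3 : ℝ) :=
    Finset.prod_pos fun i _ => Real.rpow_pos_of_pos (hq' i) _
  have h6 : ∏ i, ‖q i‖ ^ (-(2 / 3) : ℝ) = (∏ i, ‖q i‖ ^ (2 / 3 : ℝ))⁻¹ := by
    rw [← Finset.prod_inv_distrib]
    exact Finset.prod_congr rfl fun i _ => Real.rpow_neg (hq' i).le _
  have hpi : 0 < 2 / Real.pi ^ 2 := by positivity
  rw [Real.norm_of_nonneg (inv_nonneg.2 (disp_nonneg q)), h6,
    show Real.pi ^ 2 / 2 = (2 / Real.pi ^ 2)⁻¹ by rw [inv_div], ← mul_inv]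
  exact inv_anti₀ (by positivity) ((mul_le_mul_of_nonneg_left h1 hpi.le).trans h4)

theorem ae_disp_pos : ∀ᵐ q : Torus, 0 < disp q :=
  (ae_torus_ne 0).mono fun _ hq => disp_pos fun h => hq 0 (congrFun h 0)

theorem integral_inv_disp_pos : 0 < ∫ q : Torus, (disp q)⁻¹ :=
  integral_pos_of_ae_pos integrable_inv_disp (ae_disp_pos.mono fun _ h => inv_pos.2 h)

/-! ### The energy of a pair after removal of the phase -/

/-- The amplitude `√(l_β² + l_γ² + 2 l_β l_γ cos k)` of `q ↦ l_β cos q + l_γ cos (k - q)`. -/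
noncomputable def pairAmp (l : Fin 3 → ℝ) (a : Fin 3) (k : AddCircle (2 * Real.pi)) : ℝ :=
  √(l (a + 1) ^ 2 + l (a + 2) ^ 2 + 2 * (l (a + 1) * l (a + 2)) * cosCircle k)

/-- The total mass parameter `l_β + l_γ` of a pair. -/
noncomputable def pairSum (l : Fin 3 → ℝ) (a : Fin 3) : ℝ := l (a + 1) + l (a + 2)

/-- A combination of `cos q` and `cos (k - q)` is a single cosine with shifted phase. -/
theorem exists_phase (u v : ℝ) (k : AddCircle (2 * Real.pi)) :
    ∃ θ : AddCircle (2 * Real.pi), ∀ q, u * cosCircle q + v * cosCircle (k - q)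
      = √(u ^ 2 + v ^ 2 + 2 * (u * v) * cosCircle k) * cosCircle (q - θ) := by
  obtain ⟨x, rfl, -⟩ := exists_coe_eq_circle k
  set w : ℂ := ⟨u + v * Real.cos x, v * Real.sin x⟩ with hw
  have hn : ‖w‖ = √(u ^ 2 + v ^ 2 + 2 * (u * v) * cosCircle x) := by
    rw [Complex.norm_def, Complex.normSq_mk, cosCircle_coe]
    congr 1
    nlinarith [Real.sin_sq_add_cos_sq x]
  refine ⟨(Complex.arg w : ℝ), fun q => ?_⟩
  obtain ⟨y, rfl, -⟩ := exists_coe_eq_circle q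
  rw [← hn, ← AddCircle.coe_sub, ← AddCircle.coe_sub, cosCircle_coe, cosCircle_coe, cosCircle_coe,
    Real.cos_sub y, mul_add]
  have h1 : ‖w‖ * Real.cos (Complex.arg w) = u + v * Real.cos x := Complex.norm_mul_cos_arg w
  have h2 : ‖w‖ * Real.sin (Complex.arg w) = v * Real.sin x := Complex.norm_mul_sin_arg w
  rw [show ‖w‖ * (Real.cos y * Real.cos w.arg) + ‖w‖ * (Real.sin y * Real.sin w.arg)
    = Real.cos y * (‖w‖ * Real.cos w.arg) + Real.sin y * (‖w‖ * Real.sin w.arg) by ring, h1, h2,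
    Real.cos_sub]
  ring

theorem sq_pairAmp (l : Fin 3 → ℝ) (a : Fin 3) (x : ℝ) : pairAmp l a x ^ 2
    = l (a + 1) ^ 2 + l (a + 2) ^ 2 + 2 * (l (a + 1) * l (a + 2)) * Real.cos x := by
  rw [pairAmp, cosCircle_coe, Real.sq_sqrt]
  nlinarith [sq_nonneg (l (a + 1) + l (a + 2) * Real.cos x), Real.sin_sq_add_cos_sq x,
    mul_nonneg (sq_nonneg (l (a + 2))) (sq_nonneg (Real.sin x))]

theorem pairAmp_nonneg (l : Fin 3 → ℝ) (a : Fin 3) (k : AddCircle (2 * Real.pi)) :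
    0 ≤ pairAmp l a k := Real.sqrt_nonneg _

theorem pairSum_pos {l : Fin 3 → ℝ} (hl : ∀ a, 0 < l a) (a : Fin 3) : 0 < pairSum l a :=
  add_pos (hl _) (hl _)

theorem pairAmp_le {l : Fin 3 → ℝ} (hl : ∀ a, 0 < l a) (a : Fin 3) (k : AddCircle (2 * Real.pi)) :
    pairAmp l a k ≤ pairSum l a := by
  rw [pairAmp, Real.sqrt_le_left (pairSum_pos hl a).le, pairSum]
  nlinarith [mul_pos (hl (a + 1)) (hl (a + 2)), cosCircle_le_one k]

theorem pairAmp_lt {l : Fin 3 → ℝ} (hl : ∀ a, 0 < l a) (a : Fin 3) {k : AddCircle (2 * Real.pi)}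
    (hk : k ≠ 0) : pairAmp l a k < pairSum l a := by
  rw [pairAmp, Real.sqrt_lt' (pairSum_pos hl a), pairSum]
  nlinarith [mul_pos (hl (a + 1)) (hl (a + 2)), cosCircle_lt_one hk]

theorem pairAmp_zero {l : Fin 3 → ℝ} (hl : ∀ a, 0 < l a) (a : Fin 3) :
    pairAmp l a 0 = pairSum l a := by
  rw [pairAmp, cosCircle_zero, show l (a + 1) ^ 2 + l (a + 2) ^ 2 + 2 * (l (a + 1) * l (a + 2)) * 1
    = (pairSum l a) ^ 2 by rw [pairSum]; ring, Real.sqrt_sq (pairSum_pos hl a).le]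

/-- The energy when the particle `a` has quasi-momentum `κ`, as a function of the relative
momentum `q` of the other two, translated so that its minimum is at `q = 0`. -/
noncomputable def channelEnergy (l : Fin 3 → ℝ) (a : Fin 3) (K : EuclideanSpace ℝ (Fin 3))
    (κ q : Torus) : ℝ :=
  ∑ i, (pairSum l a - pairAmp l a ((toTorus K - κ) i) * cosCircle (q i)) + l a * disp κ

theorem massRatio_sum {l : Fin 3 → ℝ} (hl : ∀ a, 0 < l a) (a : Fin 3) :
    massRatio l a + (massRatio l (a + 1) + massRatio l (a + 2)) = 1 := by
  have h0 := (hl 0).ne'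
  have h1 := (hl 1).ne'
  have h2 := (hl 2).ne'
  have hM : totalMass l ≠ 0 := by
    have : 0 < totalMass l := Finset.sum_pos (fun a _ => one_div_pos.2 (hl a)) Finset.univ_nonempty
    exact this.ne'
  have h : massRatio l 0 + massRatio l 1 + massRatio l 2 = 1 := by
    have e : totalMass l = 1 / l 0 + 1 / l 1 + 1 / l 2 := Fin.sum_univ_three _
    have e2 : massRatio l 0 + massRatio l 1 + massRatio l 2
        = (1 / l 0 + 1 / l 1 + 1 / l 2) / totalMass l := by
      simp only [massRatio]
      field_simp
    rw [e2, ← e, div_self hM]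
  fin_cases a
  · change massRatio l 0 + (massRatio l 1 + massRatio l 2) = 1
    linarith
  · change massRatio l 1 + (massRatio l 2 + massRatio l 0) = 1
    linarith
  · change massRatio l 2 + (massRatio l 0 + massRatio l 1) = 1
    linarith

/-- On the fibre `p_a = p` the energy is a translate of `channelEnergy`. -/
theorem exists_energy_fibre {l : Fin 3 → ℝ} (hl : ∀ a, 0 < l a) (K : EuclideanSpace ℝ (Fin 3))
    (a : Fin 3) (p : Torus) : ∃ c : Torus, ∀ s, energy l K (pairPoint a (a + 1) (p, s))
      = channelEnergy l a K (toTorus (massRatio l a • K) - p) (c - s) := by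
  have hk : toTorus K - (toTorus (massRatio l a • K) - p)
      = toTorus (massRatio l (a + 1) • K) + toTorus (massRatio l (a + 2) • K) + p := by
    have h : toTorus K = toTorus (massRatio l a • K) + (toTorus (massRatio l (a + 1) • K)
        + toTorus (massRatio l (a + 2) • K)) := by
      rw [← toTorus_add, ← toTorus_add, ← add_smul, ← add_smul, massRatio_sum hl, one_smul]
    rw [h]
    abel
  choose θ hθ using fun i => exists_phase (l (a + 1)) (l (a + 2))
    ((toTorus K - (toTorus (massRatio l a • K) - p)) i)
  refine ⟨toTorus (massRatio l (a + 1) • K) - θ, fun s => ?_⟩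
  have h3 : third a (a + 1) = a + 2 := by fin_cases a <;> rfl
  rw [energy_pairPoint l K (ne_add_one a), kinetic, h3]
  have h4 : ∀ i, pairSum l a - pairAmp l a ((toTorus K - (toTorus (massRatio l a • K) - p)) i)
      * cosCircle ((toTorus (massRatio l (a + 1) • K) - θ - s) i)
      = l (a + 1) * (1 - cosCircle ((toTorus (massRatio l (a + 1) • K) - s) i))
        + l (a + 2) * (1 - cosCircle ((toTorus (massRatio l (a + 2) • K) + p + s) i)) := by
    intro i
    have e1 : (toTorus (massRatio l (a + 1) • K) - θ - s) i
        = (toTorus (massRatio l (a + 1) • K) - s) i - θ i := by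
      simp only [Pi.sub_apply]
      abel
    have e2 : (toTorus (massRatio l (a + 2) • K) + p + s) i
        = (toTorus K - (toTorus (massRatio l a • K) - p)) i
          - (toTorus (massRatio l (a + 1) • K) - s) i := by
      rw [hk]
      simp only [Pi.add_apply, Pi.sub_apply]
      abel
    rw [e1, pairAmp, ← hθ i, e2, pairSum]
    ring
  simp only [channelEnergy, h4, disp, Finset.sum_add_distrib, Finset.mul_sum]
  ring

theorem exists_energy_eq {l : Fin 3 → ℝ} (hl : ∀ a, 0 < l a) (K : EuclideanSpace ℝ (Fin 3))
    (a : Fin 3) (κ q : Torus) : ∃ z, energy l K z = channelEnergy l a K κ q := by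
  obtain ⟨c, hc⟩ := exists_energy_fibre hl K a (toTorus (massRatio l a • K) - κ)
  refine ⟨_, (hc (c - q)).trans ?_⟩
  rw [sub_sub_cancel, sub_sub_cancel]

theorem exists_channelEnergy_eq {l : Fin 3 → ℝ} (hl : ∀ a, 0 < l a)
    (K : EuclideanSpace ℝ (Fin 3)) (a : Fin 3) (z : Torus × Torus) :
    ∃ κ q, channelEnergy l a K κ q = energy l K z := by
  obtain ⟨c, hc⟩ := exists_energy_fibre hl K a (coord a z)
  refine ⟨_, _, (hc (coord (a + 1) z)).symm.trans ?_⟩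
  congr 1
  fin_cases a <;> ext1 <;> simp [pairPoint, pairCoord, coord]

/-- In terms of the quasi-momentum `κ = m_a K - p` of the particle `a`, the channel determinant is
given by the resolvent integral of `channelEnergy`. -/
theorem channelDet_eq_channelEnergy {l : Fin 3 → ℝ} (hl : ∀ a, 0 < l a) (mu : Fin 3 → ℝ)
    (a : Fin 3) (K : EuclideanSpace ℝ (Fin 3)) (p : Torus) (ζ : ℝ) :
    channelDet l mu a K p ζ = 1 - coupling mu a *
      ∫ q, (channelEnergy l a K (toTorus (massRatio l a • K) - p) q - ζ)⁻¹ := by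
  obtain ⟨c, hc⟩ := exists_energy_fibre hl K a p
  rw [channelDet_eq, coupling]
  simp only [hc]
  rw [integral_sub_left_eq_self (fun q =>
    (channelEnergy l a K (toTorus (massRatio l a • K) - p) q - ζ)⁻¹) (volume : Measure Torus) c]

end LatticeThreeBody

namespace LatticeThreeBody

/-! ### Monotonicity of the resolvent integral in the amplitudes -/

theorem cosCircle_add_pi (q : AddCircle (2 * Real.pi)) :
    cosCircle (q + ((Real.pi : ℝ) : AddCircle (2 * Real.pi))) = -cosCircle q := by
  obtain ⟨x, rfl, -⟩ := exists_coe_eq_circle q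
  rw [← AddCircle.coe_add, cosCircle_coe, cosCircle_coe, Real.cos_add_pi]

theorem abs_cosCircle_le_one (q : AddCircle (2 * Real.pi)) : |cosCircle q| ≤ 1 :=
  abs_le.2 ⟨neg_one_le_cosCircle q, cosCircle_le_one q⟩

theorem sum_mul_cosCircle_le {r : Fin 3 → ℝ} (hr : ∀ i, 0 ≤ r i) (q : Torus) :
    ∑ i, r i * cosCircle (q i) ≤ ∑ i, r i :=
  Finset.sum_le_sum fun i _ => mul_le_of_le_one_right (hr i) (cosCircle_le_one _)

theorem integrable_inv_sub_cos {r : Fin 3 → ℝ} {A : ℝ} (hr : ∀ i, 0 ≤ r i) (hA : ∑ i, r i < A) :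
    Integrable fun q : Torus => (A - ∑ i, r i * cosCircle (q i))⁻¹ := by
  have := continuous_cosCircle
  refine integrable_of_continuous (Continuous.inv₀ (by fun_prop) fun q => ?_)
  have := sum_mul_cosCircle_le hr q
  linarith

/-- Increasing one amplitude `r_i` increases the integral of `1 / (A - ∑ r_j cos q_j)`: after
averaging over the shift of `q_i` by `π` the integrand has the form `B / (B² - r_i² cos² q_i)`. -/
theorem integral_inv_sub_cos_update_le {r : Fin 3 → ℝ} {A t : ℝ} {i : Fin 3} (hr : ∀ j, 0 ≤ r j)
    (hit : r i ≤ t) (hA : ∑ j, Function.update r i t j < A) :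
    ∫ q : Torus, (A - ∑ j, r j * cosCircle (q j))⁻¹
      ≤ ∫ q : Torus, (A - ∑ j, Function.update r i t j * cosCircle (q j))⁻¹ := by
  set r' := Function.update r i t with hr'
  have hr0 : ∀ j, 0 ≤ r' j := fun j => by
    by_cases hj : j = i
    · subst hj
      rw [hr', Function.update_self]
      exact (hr j).trans hit
    · rw [hr', Function.update_of_ne hj]
      exact hr j
  have hle : ∀ j, r j ≤ r' j := fun j => by
    by_cases hj : j = i
    · subst hj
      rwa [hr', Function.update_self]
    · rw [hr', Function.update_of_ne hj]
  have hA' : ∑ j, r j < A := (Finset.sum_le_sum fun j _ => hle j).trans_lt hA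
  set v : Torus := Pi.single i ((Real.pi : ℝ) : AddCircle (2 * Real.pi)) with hv
  have hdec : ∀ u : Fin 3 → ℝ, ∀ q : Torus, ∑ j, u j * cosCircle (q j)
      = u i * cosCircle (q i) + ∑ j ∈ Finset.univ.erase i, u j * cosCircle (q j) := fun u q =>
    (Finset.add_sum_erase _ _ (Finset.mem_univ i)).symm
  have hvi : ∀ q : Torus, cosCircle ((q + v) i) = -cosCircle (q i) := fun q => by
    rw [Pi.add_apply, hv, Pi.single_eq_same, cosCircle_add_pi]
  have hvj : ∀ u : Fin 3 → ℝ, ∀ q : Torus,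
      ∑ j ∈ Finset.univ.erase i, u j * cosCircle ((q + v) j)
        = ∑ j ∈ Finset.univ.erase i, u j * cosCircle (q j) := fun u q =>
    Finset.sum_congr rfl fun j hj => by
      rw [Pi.add_apply, hv, Pi.single_eq_of_ne (Finset.ne_of_mem_erase hj), add_zero]
  have hrr : ∀ q : Torus, ∑ j ∈ Finset.univ.erase i, r' j * cosCircle (q j)
      = ∑ j ∈ Finset.univ.erase i, r j * cosCircle (q j) := fun q =>
    Finset.sum_congr rfl fun j hj => by
      rw [hr', Function.update_of_ne (Finset.ne_of_mem_erase hj)]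
  have hsym : ∀ u : Fin 3 → ℝ, (∀ j, 0 ≤ u j) → ∑ j, u j < A →
      2 * ∫ q : Torus, (A - ∑ j, u j * cosCircle (q j))⁻¹
        = ∫ q : Torus, ((A - ∑ j, u j * cosCircle (q j))⁻¹
          + (A - ∑ j, u j * cosCircle ((q + v) j))⁻¹) := fun u hu huA => by
    have h1 := integrable_inv_sub_cos hu huA
    rw [integral_add h1 (h1.comp_add_right v),
      integral_add_right_eq_self (fun q : Torus => (A - ∑ j, u j * cosCircle (q j))⁻¹)]
    ring
  have h2 := hsym r hr hA'
  have h3 := hsym r' hr0 hA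
  suffices h : ∫ q : Torus, ((A - ∑ j, r j * cosCircle (q j))⁻¹
      + (A - ∑ j, r j * cosCircle ((q + v) j))⁻¹)
      ≤ ∫ q : Torus, ((A - ∑ j, r' j * cosCircle (q j))⁻¹
        + (A - ∑ j, r' j * cosCircle ((q + v) j))⁻¹) by linarith
  have h1 := integrable_inv_sub_cos hr hA'
  have h1' := integrable_inv_sub_cos hr0 hA
  refine integral_mono (h1.add (h1.comp_add_right v)) (h1'.add (h1'.comp_add_right v)) fun q => ?_
  have hp1 : 0 < A - ∑ j, r' j * cosCircle (q j) := by linarith [sum_mul_cosCircle_le hr0 q]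
  have hp2 : 0 < A - ∑ j, r' j * cosCircle ((q + v) j) := by
    linarith [sum_mul_cosCircle_le hr0 (q + v)]
  have hp3 : 0 < A - ∑ j, r j * cosCircle (q j) := by linarith [sum_mul_cosCircle_le hr q]
  have hp4 : 0 < A - ∑ j, r j * cosCircle ((q + v) j) := by
    linarith [sum_mul_cosCircle_le hr (q + v)]
  have hri : r' i = t := by rw [hr', Function.update_self]
  simp only [hdec, hvi, hvj, hrr, hri] at hp1 hp2 hp3 hp4 ⊢
  set c := cosCircle (q i)
  set S := ∑ j ∈ Finset.univ.erase i, r j * cosCircle (q j)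
  have e : ∀ u, A - (u * c + S) + (A - (u * -c + S)) = 2 * (A - S) := fun u => by ring
  rw [inv_add_inv hp3.ne' hp4.ne', inv_add_inv hp1.ne' hp2.ne', e, e]
  refine div_le_div_of_nonneg_left (by linarith) (mul_pos hp1 hp2) ?_
  nlinarith [mul_nonneg (sub_nonneg.2 hit) (mul_nonneg (add_nonneg ((hr i).trans hit) (hr i))
    (sq_nonneg c))]

/-- The resolvent integral increases when all amplitudes are raised to their common upper bound. -/
theorem integral_inv_sub_cos_le {r : Fin 3 → ℝ} {A t : ℝ} (hr : ∀ i, 0 ≤ r i) (hrt : ∀ i, r i ≤ t)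
    (hA : 3 * t < A) :
    ∫ q : Torus, (A - ∑ i, r i * cosCircle (q i))⁻¹
      ≤ ∫ q : Torus, (A - ∑ i, t * cosCircle (q i))⁻¹ := by
  have ht : 0 ≤ t := (hr 0).trans (hrt 0)
  set r1 := Function.update r 0 t with h1
  set r2 := Function.update r1 1 t with h2
  set r3 := Function.update r2 2 t with h3
  have e1 : r1 0 = t ∧ r1 1 = r 1 ∧ r1 2 = r 2 := by simp [h1]
  have e2 : r2 0 = t ∧ r2 1 = t ∧ r2 2 = r 2 := by simp [h2, e1]
  have e3 : ∀ i, r3 i = t := by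
    intro i
    fin_cases i <;> simp [h3, e2]
  have n1 : ∀ i, 0 ≤ r1 i := by
    intro i
    fin_cases i <;> simp [e1, hr, ht]
  have n2 : ∀ i, 0 ≤ r2 i := by
    intro i
    fin_cases i <;> simp [e2, hr, ht]
  refine (integral_inv_sub_cos_update_le (i := 0) (t := t) hr (hrt 0) ?_).trans
    ((integral_inv_sub_cos_update_le (i := 1) (t := t) n1 (e1.2.1.trans_le (hrt 1)) ?_).trans
    ((integral_inv_sub_cos_update_le (i := 2) (t := t) n2 (e2.2.2.trans_le (hrt 2)) ?_).trans ?_))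
  · rw [← h1, Fin.sum_univ_three, e1.1, e1.2.1, e1.2.2]
    linarith [hrt 1, hrt 2]
  · rw [← h2, Fin.sum_univ_three, e2.1, e2.2.1, e2.2.2]
    linarith [hrt 1, hrt 2]
  · rw [← h3, Fin.sum_univ_three, e3, e3, e3]
    linarith
  · rw [← h3]
    simp only [e3, le_refl]

/-! ### Channel determinants that are negative below the free spectrum -/

theorem pairSum_sub_pairAmp_le {l : Fin 3 → ℝ} (hl : ∀ a, 0 < l a) (a : Fin 3) (x : ℝ) :
    pairSum l a - pairAmp l a x ≤ pairSum l a * x ^ 2 := by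
  have hs := pairSum_pos hl a
  have h0 := pairAmp_nonneg l a x
  have h1 : pairAmp l a x ^ 2 = pairSum l a ^ 2
      - 2 * (l (a + 1) * l (a + 2)) * (1 - Real.cos x) := by
    rw [sq_pairAmp, pairSum]
    ring
  have h2 := Real.one_sub_sq_div_two_le_cos (x := x)
  have h3 : l (a + 1) * l (a + 2) ≤ pairSum l a ^ 2 := by
    rw [pairSum]
    nlinarith [mul_pos (hl (a + 1)) (hl (a + 2)), sq_nonneg (l (a + 1)), sq_nonneg (l (a + 2))]
  have h4 : 2 * (l (a + 1) * l (a + 2)) * (1 - Real.cos x) ≤ pairSum l a ^ 2 * x ^ 2 := by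
    nlinarith [mul_pos (hl (a + 1)) (hl (a + 2)), sq_nonneg x]
  have h5 : (pairSum l a - pairAmp l a x) * (pairSum l a + pairAmp l a x)
      ≤ pairSum l a ^ 2 * x ^ 2 := by nlinarith
  have h6 : (pairSum l a - pairAmp l a x) * pairSum l a
      ≤ (pairSum l a - pairAmp l a x) * (pairSum l a + pairAmp l a x) :=
    mul_le_mul_of_nonneg_left (by linarith) (sub_nonneg.2 (pairAmp_le hl a x))
  refine le_of_mul_le_mul_right ?_ hs
  nlinarith

/-- Shrinking a momentum `x` by the factor `1 - η` lowers `1 - cos x` to first order in `η`. -/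
theorem cos_add_le_cos_one_sub_mul {x η : ℝ} (hx : |x| ≤ 1) (h0 : 0 ≤ η) (h1 : η ≤ 1) :
    Real.cos x + (η / 4 - η ^ 2 / 2) * x ^ 2 ≤ Real.cos ((1 - η) * x) := by
  rw [← Real.cos_abs x, ← sq_abs x, ← Real.cos_abs ((1 - η) * x), abs_mul,
    abs_of_nonneg (sub_nonneg.2 h1)]
  set y := |x|
  have hy : 0 ≤ y := abs_nonneg x
  have hpi := Real.pi_gt_three
  have hpi4 := Real.pi_le_four
  have hs : ∀ u, 0 ≤ u → u ≤ 1 → u / 2 ≤ Real.sin u := fun u hu hu1 => by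
    refine le_trans ?_ (Real.mul_le_sin hu (by linarith))
    have : 1 / 2 ≤ 2 / Real.pi := by
      rw [div_le_div_iff₀ (by norm_num) Real.pi_pos]
      linarith
    nlinarith
  have hηy : 0 ≤ η * y := mul_nonneg h0 hy
  have hηy1 : η * y ≤ 1 := by nlinarith
  have e1 := hs y hy hx
  have e2 := hs (η * y) hηy hηy1
  have e3 : y / 2 * (η * y / 2) ≤ Real.sin y * Real.sin (η * y) :=
    mul_le_mul e1 e2 (by positivity) (by linarith)
  have e4 := Real.one_sub_sq_div_two_le_cos (x := η * y)
  have e5 : Real.cos (η * y) - 1 ≤ Real.cos y * (Real.cos (η * y) - 1) := by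
    nlinarith [Real.cos_le_one y, Real.cos_le_one (η * y)]
  rw [show (1 - η) * y = y - η * y by ring, Real.cos_sub]
  nlinarith

/-- For small `K ≠ 0` the free energy has values below the energy of the configuration in which
the particle `a` carries the whole momentum: it is favourable to pass a small fraction of the
momentum to another particle. -/
theorem exists_energy_lt_disp {l : Fin 3 → ℝ} (hl : ∀ a, 0 < l a) {K : EuclideanSpace ℝ (Fin 3)}
    (hK : K ≠ 0) (hK1 : ‖K‖ ≤ 1) (a : Fin 3) : ∃ z, energy l K z < l a * disp (toTorus K) := by
  set s := pairSum l a with hs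
  have hs0 : 0 < s := pairSum_pos hl a
  have hla := hl a
  -- The particle `a` keeps the fraction `1 - η`; the gain is of order `η` and the cost of order `η²`.
  set η := l a / (8 * (s + l a)) with hη
  have hη0 : 0 < η := by positivity
  have hη1 : η ≤ 1 := by
    rw [hη, div_le_one (by positivity)]
    linarith
  have hηe : (s + l a) * η = l a / 8 := by
    rw [hη]
    field_simp
  obtain ⟨z, hz⟩ := exists_energy_eq hl K a (toTorus ((1 - η) • K)) 0
  refine ⟨z, hz.trans_lt ?_⟩
  have hk : toTorus K - toTorus ((1 - η) • K) = toTorus (η • K) := by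
    rw [sub_eq_iff_eq_add, ← toTorus_add, ← add_smul, add_sub_cancel, one_smul]
  have hKi : ∀ i, |K i| ≤ 1 := fun i => (PiLp.norm_apply_le K i).trans hK1
  rw [channelEnergy, hk, disp, disp, Finset.mul_sum, Finset.mul_sum, ← Finset.sum_add_distrib]
  have hterm : ∀ i, s - pairAmp l a (toTorus (η • K) i) * cosCircle ((0 : Torus) i)
      + l a * (1 - cosCircle (toTorus ((1 - η) • K) i))
      ≤ l a * (1 - cosCircle (toTorus K i)) - l a * η / 8 * K i ^ 2 := fun i => by
    have h1 := pairSum_sub_pairAmp_le hl a (η * K i)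
    have h2 := cos_add_le_cos_one_sub_mul (hKi i) hη0.le hη1
    rw [Pi.zero_apply, cosCircle_zero, mul_one]
    change s - pairAmp l a ((η * K i : ℝ) : AddCircle (2 * Real.pi))
      + l a * (1 - cosCircle (((1 - η) * K i : ℝ) : AddCircle (2 * Real.pi)))
      ≤ l a * (1 - cosCircle ((K i : ℝ) : AddCircle (2 * Real.pi))) - l a * η / 8 * K i ^ 2
    rw [cosCircle_coe, cosCircle_coe]
    have h3 := mul_le_mul_of_nonneg_left h2 hla.le
    have h4 : s * (η * K i) ^ 2 + l a * (η ^ 2 / 2 * K i ^ 2) ≤ l a * η / 8 * K i ^ 2 := by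
      have h5 : s * (η * K i) ^ 2 + l a * (η ^ 2 / 2 * K i ^ 2)
          ≤ (s + l a) * η * (η * K i ^ 2) := by
        nlinarith [mul_nonneg hla.le (mul_nonneg (sq_nonneg η) (sq_nonneg (K i)))]
      rw [hηe] at h5
      linarith
    nlinarith
  obtain ⟨i, hi⟩ : ∃ i, K i ≠ 0 := by
    by_contra! h
    exact hK (by ext i; exact h i)
  refine Finset.sum_lt_sum (fun i _ => (hterm i).trans ?_) ⟨i, Finset.mem_univ i,
    (hterm i).trans_lt ?_⟩
  · have : 0 ≤ l a * η / 8 * K i ^ 2 := by positivity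
    linarith
  · have : 0 < l a * η / 8 * K i ^ 2 := by positivity
    linarith

theorem disp_le_six (q : Torus) : disp q ≤ 6 := by
  have h : disp q ≤ ∑ _i : Fin 3, (2 : ℝ) :=
    Finset.sum_le_sum fun i _ => by linarith [neg_one_le_cosCircle (q i)]
  norm_num at h
  exact h

theorem tendsto_integral_inv_disp_add {s : ℝ} (hs : 0 < s) :
    Tendsto (fun η : ℝ => ∫ q : Torus, (s * disp q + η)⁻¹) (𝓝[>] 0)
      (𝓝 (s⁻¹ * ∫ q : Torus, (disp q)⁻¹)) := by
  rw [← integral_const_mul]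
  refine tendsto_integral_filter_of_dominated_convergence (fun q => s⁻¹ * (disp q)⁻¹) ?_ ?_
    (integrable_inv_disp.const_mul _) ?_
  · refine Eventually.of_forall fun η => ?_
    have := continuous_disp
    exact (by fun_prop : Continuous fun q => s * disp q + η).measurable.inv.aestronglyMeasurable
  · filter_upwards [self_mem_nhdsWithin] with η hη
    filter_upwards [ae_disp_pos] with q hq
    have hη : 0 < η := hη
    rw [Real.norm_of_nonneg (by positivity), ← mul_inv]
    exact inv_anti₀ (by positivity) (by linarith)
  · filter_upwards [ae_disp_pos] with q hq
    rw [← mul_inv]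
    refine Tendsto.inv₀ ?_ (by positivity)
    have h : Tendsto (fun η : ℝ => s * disp q + η) (𝓝 0) (𝓝 (s * disp q + 0)) :=
      tendsto_const_nhds.add tendsto_id
    rw [add_zero] at h
    exact h.mono_left nhdsWithin_le_nhds

/-- If one of the amplitudes is smaller than `s`, the resolvent integral close to the threshold
exceeds the threshold value of the integral with all amplitudes equal to `s`. -/
theorem exists_lt_integral_inv {R : Fin 3 → ℝ} {s : ℝ} (hs : 0 < s) (hR : ∀ i, 0 ≤ R i)
    (hRs : ∀ i, R i ≤ s) (hlt : ∃ i, R i < s) :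
    ∃ η : ℝ, 0 < η ∧ s⁻¹ * ∫ q : Torus, (disp q)⁻¹
      < ∫ q : Torus, (∑ i, R i * (1 - cosCircle (q i)) + η)⁻¹ := by
  have hcc := continuous_cosCircle
  have hcd := continuous_disp
  set X : Torus → ℝ := fun q => ∑ i, R i * (1 - cosCircle (q i)) with hX
  have hXc : Continuous X := by fun_prop
  have hX0 : ∀ q, 0 ≤ X q := fun q =>
    Finset.sum_nonneg fun i _ => mul_nonneg (hR i) (sub_nonneg.2 (cosCircle_le_one _))
  have hXs : ∀ q, X q ≤ s * disp q := fun q => by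
    rw [disp, Finset.mul_sum]
    exact Finset.sum_le_sum fun i _ =>
      mul_le_mul_of_nonneg_right (hRs i) (sub_nonneg.2 (cosCircle_le_one _))
  -- `X + η` and `s ε + η` are at most `6 s + 1` for `η ≤ 1`, so this is a lower bound for the
  -- difference of their inverses that does not depend on `η`.
  have hY : ∀ᵐ q : Torus, 0 < (s * disp q - X q) / (6 * s + 1) ^ 2 := by
    filter_upwards [ae_torus_ne 0] with q hq
    refine div_pos (sub_pos.2 ?_) (by positivity)
    rw [disp, Finset.mul_sum]
    obtain ⟨i, hi⟩ := hlt
    exact Finset.sum_lt_sum (fun i _ =>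
      mul_le_mul_of_nonneg_right (hRs i) (sub_nonneg.2 (cosCircle_le_one _)))
      ⟨i, Finset.mem_univ i, mul_lt_mul_of_pos_right hi (sub_pos.2 (cosCircle_lt_one (hq i)))⟩
  have hYi : Integrable fun q : Torus => (s * disp q - X q) / (6 * s + 1) ^ 2 :=
    integrable_of_continuous (by fun_prop)
  have hc := integral_pos_of_ae_pos hYi hY
  obtain ⟨η, hη1, hη2, hη3⟩ := ((tendsto_integral_inv_disp_add hs).eventually
    (lt_mem_nhds (sub_lt_self _ hc))).and (Ioc_mem_nhdsGT one_pos) |>.exists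
  refine ⟨η, hη2, ?_⟩
  have hp : ∀ q, 0 < X q + η := fun q => by linarith [hX0 q]
  have hp' : ∀ q, 0 < s * disp q + η := fun q => by linarith [hX0 q, hXs q]
  have h1 : Integrable fun q : Torus => (s * disp q + η)⁻¹ :=
    integrable_of_continuous (Continuous.inv₀ (by fun_prop) fun q => (hp' q).ne')
  have h2 : Integrable fun q : Torus => (X q + η)⁻¹ :=
    integrable_of_continuous (Continuous.inv₀ (by fun_prop) fun q => (hp q).ne')
  have h3 := integral_mono (h1.add hYi) h2 fun q => by
    have e1 : s * disp q + η ≤ 6 * s + 1 := by nlinarith [disp_le_six q]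
    have e2 : X q + η ≤ 6 * s + 1 := by linarith [hXs q]
    have e3 : (s * disp q - X q) / (6 * s + 1) ^ 2
        ≤ (s * disp q - X q) / ((X q + η) * (s * disp q + η)) := by
      refine div_le_div_of_nonneg_left (sub_nonneg.2 (hXs q)) (mul_pos (hp q) (hp' q)) ?_
      rw [sq]
      exact mul_le_mul e2 e1 (hp' q).le (by positivity)
    have e4 : (s * disp q - X q) / ((X q + η) * (s * disp q + η))
        = (X q + η)⁻¹ - (s * disp q + η)⁻¹ := by
      rw [inv_sub_inv (hp q).ne' (hp' q).ne']
      ring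
    simp only [Pi.add_apply]
    linarith
  rw [integral_add' h1 hYi] at h3
  linarith

/-- Critical coupling in terms of the threshold value `∫ (s ε)⁻¹` of the resolvent integral. -/
theorem coupling_criticalCoupling (l : Fin 3 → ℝ) (a : Fin 3) :
    coupling (criticalCoupling l) a = ((pairSum l a)⁻¹ * ∫ q : Torus, (disp q)⁻¹)⁻¹ := by
  have h : (2 * Real.pi) ^ 3 ≠ 0 := by positivity
  rw [coupling, criticalCoupling, pairSum, mul_inv, inv_inv]
  field_simp

/-- A resonant channel has a bound state below the free spectrum as soon as the minimum of the free
energy is not attained with the whole momentum carried by the third particle. -/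
theorem exists_channelDet_neg {l mu : Fin 3 → ℝ} {K : EuclideanSpace ℝ (Fin 3)}
    (hl : ∀ a, 0 < l a) {a : Fin 3} (hcrit : mu a = criticalCoupling l a)
    (hlt : ∃ z, energy l K z < l a * disp (toTorus K)) :
    ∃ ζ, (∀ z, ζ < energy l K z) ∧ ∃ p, channelDet l mu a K p ζ < 0 := by
  obtain ⟨z₀, hz₀⟩ := exists_energy_min l K
  obtain ⟨z₁, hz₁⟩ := hlt
  obtain ⟨κ, q₀, hκ⟩ := exists_channelEnergy_eq hl K a z₀
  obtain ⟨z₂, hz₂⟩ := exists_energy_eq hl K a κ 0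
  set R : Fin 3 → ℝ := fun i => pairAmp l a ((toTorus K - κ) i) with hR
  have hR0 : ∀ i, 0 ≤ R i := fun i => pairAmp_nonneg l a _
  have h1 : channelEnergy l a K κ 0 ≤ channelEnergy l a K κ q₀ := by
    unfold channelEnergy
    refine add_le_add_left (Finset.sum_le_sum fun i _ => sub_le_sub_left ?_ _) _
    exact mul_le_mul_of_nonneg_left ((cosCircle_le_one _).trans_eq cosCircle_zero.symm) (hR0 i)
  have hmin : channelEnergy l a K κ 0 = energy l K z₀ :=
    le_antisymm (h1.trans_eq hκ) ((hz₀ z₂).trans_eq hz₂)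
  have hκK : toTorus K - κ ≠ 0 := fun h => by
    have h2 : channelEnergy l a K κ 0 = l a * disp (toTorus K) := by
      simp [channelEnergy, cosCircle_zero, pairAmp_zero hl, ← sub_eq_zero.1 h]
    linarith [hz₀ z₁]
  obtain ⟨i, hi⟩ := Function.ne_iff.1 hκK
  obtain ⟨η, hη, hη'⟩ := exists_lt_integral_inv (pairSum_pos hl a) hR0
    (fun i => pairAmp_le hl a _) ⟨i, pairAmp_lt hl a hi⟩
  refine ⟨energy l K z₀ - η, fun z => by linarith [hz₀ z], toTorus (massRatio l a • K) - κ, ?_⟩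
  rw [channelDet_eq_channelEnergy hl, sub_sub_cancel]
  have h3 : ∀ q, channelEnergy l a K κ q - (energy l K z₀ - η)
      = ∑ i, R i * (1 - cosCircle (q i)) + η := fun q => by
    rw [← hmin]
    simp only [channelEnergy, Pi.zero_apply, cosCircle_zero, mul_sub, mul_one,
      Finset.sum_sub_distrib, hR]
    ring
  simp only [h3]
  have h4 : coupling mu a = ((pairSum l a)⁻¹ * ∫ q : Torus, (disp q)⁻¹)⁻¹ := by
    rw [← coupling_criticalCoupling, coupling, coupling, hcrit]
  have h5 : 0 < (pairSum l a)⁻¹ * ∫ q : Torus, (disp q)⁻¹ :=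
    mul_pos (inv_pos.2 (pairSum_pos hl a)) integral_inv_disp_pos
  rw [h4, sub_neg, lt_inv_mul_iff₀ h5, mul_one]
  exact hη'

end LatticeThreeBody

namespace LatticeThreeBody

/-! ### Second order expansion of the resolvent integral -/

theorem volume_closedBall_torus {r : ℝ} (hr : 0 ≤ r) (hr' : r ≤ Real.pi) :
    (volume : Measure Torus).real (Metric.closedBall 0 r) = (2 * r) ^ 3 := by
  rw [closedBall_pi _ hr, measureReal_def, volume_pi_pi]
  simp only [AddCircle.volume_closedBall]
  rw [min_eq_right (by linarith), Finset.prod_const, Finset.card_univ, Fintype.card_fin,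
    ENNReal.toReal_pow, ENNReal.toReal_ofReal (by linarith)]

/-- The function `f + ∑ R_i (1 - cos q_i)`, with minimum `f` at `q = 0`. -/
noncomputable def wellEnergy (R : Fin 3 → ℝ) (f : ℝ) (q : Torus) : ℝ :=
  f + ∑ i, R i * (1 - cosCircle (q i))

theorem continuous_wellEnergy (R : Fin 3 → ℝ) (f : ℝ) : Continuous (wellEnergy R f) := by
  have := continuous_cosCircle
  unfold wellEnergy
  fun_prop

theorem mul_one_sub_cos_le_wellEnergy {R : Fin 3 → ℝ} {f : ℝ} (hR : ∀ i, 0 ≤ R i) (hf : 0 < f)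
    (i : Fin 3) (q : Torus) : R i * (1 - cosCircle (q i)) ≤ wellEnergy R f q := by
  have h := Finset.single_le_sum (f := fun i => R i * (1 - cosCircle (q i)))
    (fun i _ => mul_nonneg (hR i) (sub_nonneg.2 (cosCircle_le_one _))) (Finset.mem_univ i)
  rw [wellEnergy]
  linarith

theorem le_wellEnergy {R : Fin 3 → ℝ} {f : ℝ} (hR : ∀ i, 0 ≤ R i) (q : Torus) :
    f ≤ wellEnergy R f q :=
  le_add_of_nonneg_right (Finset.sum_nonneg fun i _ =>
    mul_nonneg (hR i) (sub_nonneg.2 (cosCircle_le_one _)))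

theorem integrable_inv_pow_of_pos {D : Torus → ℝ} (hDc : Continuous D) (hD : ∀ q, 0 < D q)
    {φ : Torus → ℝ} (hφ : Continuous φ) (n : ℕ) : Integrable fun q => φ q * (D q ^ n)⁻¹ :=
  integrable_of_continuous (hφ.mul ((hDc.pow n).inv₀ fun q => (pow_pos (hD q) n).ne'))

/-- In three dimensions `∫ (f + ∑ R_i (1 - cos q_i))⁻²` diverges like `f ^ (-1 / 2)` as `f → 0`. -/
theorem le_mul_sq_integral_inv_sq {R : Fin 3 → ℝ} {s f : ℝ} (hR : ∀ i, 0 ≤ R i)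
    (hRs : ∀ i, R i ≤ s) (hf : 0 < f) (hf1 : f ≤ 1) :
    (8 / (1 + 3 * s / 2) ^ 2) ^ 2 ≤ f * (∫ q, (wellEnergy R f q ^ 2)⁻¹) ^ 2 := by
  have hs : 0 ≤ s := (hR 0).trans (hRs 0)
  have hD : ∀ q, 0 < wellEnergy R f q := fun q => hf.trans_le (le_wellEnergy hR q)
  have hint : Integrable fun q => (wellEnergy R f q ^ 2)⁻¹ := by
    simpa using integrable_inv_pow_of_pos (continuous_wellEnergy R f) hD continuous_const
      (φ := fun _ => 1) 2
  have hsf : √f ^ 2 = f := Real.sq_sqrt hf.le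
  have hsf0 : 0 < √f := Real.sqrt_pos.2 hf
  have hsf1 : √f ≤ 1 := Real.sqrt_le_one.2 hf1
  set ε := ((f * (1 + 3 * s / 2)) ^ 2)⁻¹ with hε
  have hε0 : 0 ≤ ε := by positivity
  -- On the cube `|q_i| ≤ √f` the function is at most `f (1 + 3 s / 2)`.
  have hsub : Metric.closedBall (0 : Torus) √f ⊆ {q | ε ≤ (wellEnergy R f q ^ 2)⁻¹} := fun q hq => by
    have hq' : ∀ i, ‖q i‖ ≤ √f := fun i =>
      (norm_le_pi_norm q i).trans (mem_closedBall_zero_iff.1 hq)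
    have h1 : ∀ i, R i * (1 - cosCircle (q i)) ≤ s * (f / 2) := fun i => by
      refine mul_le_mul (hRs i) ?_ (sub_nonneg.2 (cosCircle_le_one _)) hs
      have h2 := one_sub_cosCircle_le (q i)
      have h3 : ‖q i‖ ^ 2 ≤ √f ^ 2 := pow_le_pow_left₀ (norm_nonneg _) (hq' i) 2
      linarith
    have h4 : wellEnergy R f q ≤ f * (1 + 3 * s / 2) := by
      have h5 := Finset.sum_le_sum fun i (_ : i ∈ Finset.univ) => h1 i
      rw [Finset.sum_const, Finset.card_univ, Fintype.card_fin, nsmul_eq_mul] at h5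
      rw [wellEnergy]
      push_cast at h5
      linarith
    exact inv_anti₀ (pow_pos (hD q) 2) (pow_le_pow_left₀ (hD q).le h4 2)
  have h1 := mul_meas_ge_le_integral_of_nonneg (μ := volume)
    (Eventually.of_forall fun q => inv_nonneg.2 (sq_nonneg (wellEnergy R f q))) hint ε
  have h2 : (2 * √f) ^ 3 ≤ (volume : Measure Torus).real {q | ε ≤ (wellEnergy R f q ^ 2)⁻¹} := by
    rw [← volume_closedBall_torus hsf0.le (by linarith [Real.pi_gt_three])]
    exact measureReal_mono hsub
  have h3 := (mul_le_mul_of_nonneg_left h2 hε0).trans h1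
  have h4 : (ε * (2 * √f) ^ 3) ^ 2 * f = (8 / (1 + 3 * s / 2) ^ 2) ^ 2 := by
    have : (2 * √f) ^ 3 = 8 * (√f ^ 2) * √f := by ring
    rw [this, hsf, hε, mul_pow, mul_pow (8 * f), hsf]
    field_simp
  rw [← h4, mul_comm f]
  exact mul_le_mul_of_nonneg_right (pow_le_pow_left₀ (by positivity) h3 2) hf.le

/-- First order condition at a maximum of the resolvent integral. -/
theorem integral_sub_mul_inv_sq_nonneg {D D' : Torus → ℝ} (hDc : Continuous D)
    (hDc' : Continuous D') (hD : ∀ q, 0 < D q) (hD' : ∀ q, 0 < D' q)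
    (h : ∫ q, (D' q)⁻¹ ≤ ∫ q, (D q)⁻¹) : 0 ≤ ∫ q, (D' q - D q) * (D q ^ 2)⁻¹ := by
  have h1 : Integrable fun q => (D q)⁻¹ :=
    integrable_of_continuous (hDc.inv₀ fun q => (hD q).ne')
  have h2 : Integrable fun q => (D' q)⁻¹ :=
    integrable_of_continuous (hDc'.inv₀ fun q => (hD' q).ne')
  have h3 := integral_mono (h1.sub h2) (integrable_inv_pow_of_pos hDc hD (hDc'.sub hDc) 2)
    fun q => by
      simp only [Pi.sub_apply]
      rw [inv_sub_inv (hD q).ne' (hD' q).ne', ← div_eq_mul_inv,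
        div_le_div_iff₀ (mul_pos (hD q) (hD' q)) (pow_pos (hD q) 2)]
      nlinarith [mul_nonneg (hD q).le (sq_nonneg (D' q - D q))]
  rw [integral_sub' h1 h2] at h3
  simp only [Pi.sub_apply] at h3
  linarith

theorem integral_affine_mul_inv_sq {R : Fin 3 → ℝ} {f : ℝ} (hR : ∀ i, 0 ≤ R i) (hf : 0 < f)
    (lam rho : Fin 3 → ℝ) :
    ∫ q : Torus, (∑ i, (lam i - rho i * cosCircle (q i))) * (wellEnergy R f q ^ 2)⁻¹
      = ∑ i, (lam i * (∫ q, (wellEnergy R f q ^ 2)⁻¹)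
        - rho i * ∫ q : Torus, cosCircle (q i) * (wellEnergy R f q ^ 2)⁻¹) := by
  have hcc := continuous_cosCircle
  have hD : ∀ q, 0 < wellEnergy R f q := fun q => hf.trans_le (le_wellEnergy hR q)
  have hi := fun {φ : Torus → ℝ} (hφ : Continuous φ) =>
    integrable_inv_pow_of_pos (continuous_wellEnergy R f) hD hφ 2
  have h1 : Integrable fun q => (wellEnergy R f q ^ 2)⁻¹ := by
    simpa using hi (φ := fun _ => 1) continuous_const
  simp only [Finset.sum_mul]
  rw [integral_finsetSum _ fun i _ => hi (by fun_prop)]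
  refine Finset.sum_congr rfl fun i _ => ?_
  simp only [sub_mul, mul_assoc]
  rw [integral_sub (h1.const_mul _) ((hi (φ := fun q => cosCircle (q i)) (by fun_prop)).const_mul _),
    integral_const_mul, integral_const_mul]

/-- The function `1 - cos q_i` gains one power of the energy: its integral against the inverse square
is controlled by the integral of the inverse. -/
theorem sub_integral_cos_le {R : Fin 3 → ℝ} {s f : ℝ} (hs : 0 < s) (hR : ∀ i, s / 2 ≤ R i)
    (hf : 0 < f) (i : Fin 3) :
    s * ((∫ q, (wellEnergy R f q ^ 2)⁻¹) - ∫ q : Torus, cosCircle (q i) * (wellEnergy R f q ^ 2)⁻¹)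
      ≤ 2 * ∫ q, (wellEnergy R f q)⁻¹ := by
  have hcc := continuous_cosCircle
  have hR0 : ∀ i, 0 ≤ R i := fun i => by linarith [hR i]
  have hD : ∀ q, 0 < wellEnergy R f q := fun q => hf.trans_le (le_wellEnergy hR0 q)
  have hi := fun {φ : Torus → ℝ} (hφ : Continuous φ) =>
    integrable_inv_pow_of_pos (continuous_wellEnergy R f) hD hφ 2
  have h1 : Integrable fun q => (wellEnergy R f q ^ 2)⁻¹ := by
    simpa using hi (φ := fun _ => 1) continuous_const
  have h2 := hi (φ := fun q => cosCircle (q i)) (by fun_prop)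
  have h3 : Integrable fun q => (wellEnergy R f q)⁻¹ :=
    integrable_of_continuous ((continuous_wellEnergy R f).inv₀ fun q => (hD q).ne')
  rw [← integral_sub h1 h2, ← integral_const_mul, ← integral_const_mul]
  refine integral_mono ((h1.sub h2).const_mul _) (h3.const_mul _) fun q => ?_
  have h4 := mul_one_sub_cos_le_wellEnergy hR0 hf i q
  have h5 : s * (1 - cosCircle (q i)) ≤ 2 * wellEnergy R f q := by
    nlinarith [hR i, cosCircle_le_one (q i)]
  have h6 : (wellEnergy R f q)⁻¹ = wellEnergy R f q * (wellEnergy R f q ^ 2)⁻¹ := by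
    have := (hD q).ne'
    field_simp
  simp only
  rw [h6, ← one_sub_mul, ← mul_assoc, ← mul_assoc]
  exact mul_le_mul_of_nonneg_right h5 (by positivity)

/-- Lower bound for the decrease of the resolvent integral under the perturbation
`∑ (λ_i - ρ_i cos q_i)`, with `A` and `M` the integrals of `D⁻²` and `D⁻¹` for the unperturbed
`D`. The terms `g_i` of first order are kept; the quadratic remainder is
controlled by `g_i²` and by `ρ_i² A`, because `λ_i - ρ_i cos q_i` differs from `g_i / A` by `ρ_i`
times a function that vanishes at `q = 0` up to a small constant. -/
theorem le_integral_inv_sub {R : Fin 3 → ℝ} {s f A M c₂ : ℝ} (hs : 0 < s)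
    (hR : ∀ i, s / 2 ≤ R i) (hf : 0 < f)
    (hA : A = ∫ q, (wellEnergy R f q ^ 2)⁻¹) (hM : M = ∫ q, (wellEnergy R f q)⁻¹)
    (hc₂ : 0 < c₂) (hAc : c₂ ≤ A) (hAf : c₂ ^ 2 ≤ f * A ^ 2)
    {lam rho g : Fin 3 → ℝ} (hg : ∀ i, g i = lam i * A
      - rho i * ∫ q : Torus, cosCircle (q i) * (wellEnergy R f q ^ 2)⁻¹)
    {D' : Torus → ℝ}
    (hD' : ∀ q, D' q = wellEnergy R f q + ∑ i, (lam i - rho i * cosCircle (q i)))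
    (hhalf : ∀ q, wellEnergy R f q / 2 ≤ D' q) :
    ∑ i, (g i - 12 * (g i ^ 2 / (A * f)) - 96 * (M / c₂ + M ^ 2 / c₂ ^ 2) / s ^ 2 * rho i ^ 2 * A)
      ≤ M - ∫ q, (D' q)⁻¹ := by
  have hcc := continuous_cosCircle
  have hDc := continuous_wellEnergy R f
  have hR0 : ∀ i, 0 ≤ R i := fun i => by linarith [hR i]
  have hfD : ∀ q, f ≤ wellEnergy R f q := le_wellEnergy hR0
  have hD : ∀ q, 0 < wellEnergy R f q := fun q => hf.trans_le (hfD q)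
  have hDp : ∀ q, 0 < D' q := fun q => (half_pos (hD q)).trans_le (hhalf q)
  have hDc' : Continuous D' := by
    rw [funext hD']
    fun_prop
  have hA0 : 0 < A := hc₂.trans_le hAc
  have hi1 : Integrable fun q => (wellEnergy R f q)⁻¹ :=
    integrable_of_continuous (hDc.inv₀ fun q => (hD q).ne')
  have hi1' : Integrable fun q => (D' q)⁻¹ :=
    integrable_of_continuous (hDc'.inv₀ fun q => (hDp q).ne')
  have hi2 : Integrable fun q => (wellEnergy R f q ^ 2)⁻¹ := by
    simpa using integrable_inv_pow_of_pos hDc hD (φ := fun _ => 1) continuous_const 2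
  have hM0 : 0 ≤ M := by
    rw [hM]
    exact integral_nonneg fun q => inv_nonneg.2 (hD q).le
  set Ac : Fin 3 → ℝ := fun i => ∫ q : Torus, cosCircle (q i) * (wellEnergy R f q ^ 2)⁻¹ with hAcdef
  set β : Fin 3 → ℝ := fun i => (A - Ac i) / A with hβ
  have hβ0 : ∀ i, 0 ≤ β i := fun i => by
    refine div_nonneg (sub_nonneg.2 ?_) hA0.le
    rw [hA]
    refine integral_mono (integrable_inv_pow_of_pos hDc hD (by fun_prop) 2) hi2 fun q => ?_
    exact mul_le_of_le_one_left (by positivity) (cosCircle_le_one _)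
  have hβA : ∀ i, s * (β i * A) ≤ 2 * M := fun i => by
    rw [hβ, div_mul_cancel₀ _ hA0.ne', hA, hM]
    exact sub_integral_cos_le hs hR hf i
  have hδ : ∀ i (q : Torus), lam i - rho i * cosCircle (q i)
      = g i / A + rho i * (1 - cosCircle (q i) - β i) := fun i q => by
    have h1 : β i = (A - Ac i) / A := rfl
    have h2 : g i = lam i * A - rho i * Ac i := hg i
    rw [h1, h2]
    field_simp
    ring
  set P : Fin 3 → ℝ := fun i => 12 * (g i / A) ^ 2 / f + 24 * rho i ^ 2 * β i ^ 2 / f with hP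
  set Q : Fin 3 → ℝ := fun i => 96 * rho i ^ 2 / s ^ 2 with hQ
  -- With `δ = D' - D` one has `1 / D - 1 / D' = δ / D² - δ² / (D² D')`, and `D' ≥ D / 2` bounds the
  -- last term by `2 δ² / D³`.
  have hpt : ∀ q, (∑ i, (lam i - rho i * cosCircle (q i))) * (wellEnergy R f q ^ 2)⁻¹
      - ∑ i, (P i * (wellEnergy R f q ^ 2)⁻¹ + Q i * (wellEnergy R f q)⁻¹)
      ≤ (wellEnergy R f q)⁻¹ - (D' q)⁻¹ := by
    intro q
    set D := wellEnergy R f q with hDdef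
    have hDq : 0 < D := hD q
    set δ := ∑ i, (lam i - rho i * cosCircle (q i)) with hδdef
    have e1 : D⁻¹ - (D' q)⁻¹ = δ * (D ^ 2)⁻¹ - δ ^ 2 * (D ^ 2)⁻¹ * (D' q)⁻¹ := by
      have h1 : D' q = D + δ := hD' q
      have h2 := (hDp q).ne'
      have h3 := hDq.ne'
      rw [h1] at h2 ⊢
      field_simp
      ring
    have e2 : (D' q)⁻¹ ≤ 2 * D⁻¹ := by
      have := inv_anti₀ (half_pos hDq) (hhalf q)
      rwa [inv_div, div_eq_mul_inv] at this
    have e3 : δ ^ 2 ≤ ∑ i, (6 * (g i / A) ^ 2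
        + 12 * rho i ^ 2 * ((1 - cosCircle (q i)) ^ 2 + β i ^ 2)) := by
      have h1 : δ ^ 2 ≤ 3 * ∑ i, (lam i - rho i * cosCircle (q i)) ^ 2 := by
        have h2 := sq_sum_le_card_mul_sum_sq (s := Finset.univ)
          (f := fun i => lam i - rho i * cosCircle (q i))
        rw [Finset.card_univ, Fintype.card_fin] at h2
        exact_mod_cast h2
      rw [Finset.mul_sum] at h1
      refine h1.trans (Finset.sum_le_sum fun i _ => ?_)
      rw [hδ i q]
      have h2 : (g i / A + rho i * (1 - cosCircle (q i) - β i)) ^ 2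
          ≤ 2 * (g i / A) ^ 2 + 2 * (rho i ^ 2 * (1 - cosCircle (q i) - β i) ^ 2) := by
        nlinarith [sq_nonneg (g i / A - rho i * (1 - cosCircle (q i) - β i))]
      have h3 : (1 - cosCircle (q i) - β i) ^ 2
          ≤ 2 * ((1 - cosCircle (q i)) ^ 2 + β i ^ 2) := by
        nlinarith [sq_nonneg (1 - cosCircle (q i) + β i)]
      have h4 := mul_le_mul_of_nonneg_left h3 (sq_nonneg (rho i))
      linarith
    have e4 : δ ^ 2 * (D ^ 2)⁻¹ * (D' q)⁻¹ ≤ ∑ i, (P i * (D ^ 2)⁻¹ + Q i * D⁻¹) := by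
      have h1 : δ ^ 2 * (D ^ 2)⁻¹ * (D' q)⁻¹ ≤ δ ^ 2 * (D ^ 2)⁻¹ * (2 * D⁻¹) :=
        mul_le_mul_of_nonneg_left e2 (by positivity)
      have h2 : δ ^ 2 * (D ^ 2)⁻¹ * (2 * D⁻¹) = δ ^ 2 * (2 * ((D ^ 2)⁻¹ * D⁻¹)) := by ring
      rw [h2] at h1
      refine h1.trans ((mul_le_mul_of_nonneg_right e3 (by positivity)).trans ?_)
      rw [Finset.sum_mul]
      refine Finset.sum_le_sum fun i _ => ?_
      have h3 : D⁻¹ ≤ f⁻¹ := inv_anti₀ hf (hfD q)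
      have h4 : (1 - cosCircle (q i)) ^ 2 * (s ^ 2) ≤ 4 * D ^ 2 := by
        have h5 := mul_one_sub_cos_le_wellEnergy hR0 hf i q
        have h6 : s * (1 - cosCircle (q i)) ≤ 2 * D := by
          nlinarith [hR i, cosCircle_le_one (q i)]
        have h7 : 0 ≤ s * (1 - cosCircle (q i)) :=
          mul_nonneg hs.le (sub_nonneg.2 (cosCircle_le_one _))
        nlinarith
      have h5 : (1 - cosCircle (q i)) ^ 2 * ((D ^ 2)⁻¹ * D⁻¹) ≤ 4 / s ^ 2 * D⁻¹ := by
        rw [← mul_assoc]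
        refine mul_le_mul_of_nonneg_right ?_ (by positivity)
        rw [← div_eq_mul_inv, div_le_div_iff₀ (by positivity) (by positivity)]
        exact h4
      have h6 : (D ^ 2)⁻¹ * D⁻¹ ≤ (D ^ 2)⁻¹ * f⁻¹ :=
        mul_le_mul_of_nonneg_left h3 (by positivity)
      have h7 := mul_le_mul_of_nonneg_left h5 (by positivity : 0 ≤ 24 * rho i ^ 2)
      have h8 := mul_le_mul_of_nonneg_left h6
        (by positivity : 0 ≤ 12 * (g i / A) ^ 2 + 24 * rho i ^ 2 * β i ^ 2)
      have h9 : P i * (D ^ 2)⁻¹ + Q i * D⁻¹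
          = (12 * (g i / A) ^ 2 + 24 * rho i ^ 2 * β i ^ 2) * ((D ^ 2)⁻¹ * f⁻¹)
            + 24 * rho i ^ 2 * (4 / s ^ 2 * D⁻¹) := by
        rw [hP, hQ]
        ring
      rw [h9]
      linarith
    rw [e1]
    linarith
  have hPQi : ∀ i, Integrable fun q => P i * (wellEnergy R f q ^ 2)⁻¹
      + Q i * (wellEnergy R f q)⁻¹ := fun i => (hi2.const_mul _).add (hi1.const_mul _)
  have hsumi : Integrable fun q => ∑ i, (P i * (wellEnergy R f q ^ 2)⁻¹
      + Q i * (wellEnergy R f q)⁻¹) := integrable_finsetSum _ fun i _ => hPQi i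
  have haff := integrable_inv_pow_of_pos hDc hD
    (φ := fun q => ∑ i, (lam i - rho i * cosCircle (q i))) (by fun_prop) 2
  have hint := integral_mono (haff.sub hsumi) (hi1.sub hi1') hpt
  rw [integral_sub' haff hsumi, integral_sub' hi1 hi1', integral_affine_mul_inv_sq hR0 hf,
    integral_finsetSum _ fun i _ => hPQi i] at hint
  have hPQ : ∀ i, ∫ q, (P i * (wellEnergy R f q ^ 2)⁻¹ + Q i * (wellEnergy R f q)⁻¹)
      = P i * A + Q i * M := fun i => by
    rw [integral_add (hi2.const_mul _) (hi1.const_mul _), integral_const_mul, integral_const_mul,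
      ← hA, ← hM]
  simp only [hPQ, ← hA, ← hM, ← hg] at hint
  refine le_trans ?_ hint
  rw [← Finset.sum_sub_distrib]
  refine Finset.sum_le_sum fun i _ => ?_
  have k1 : M ≤ M / c₂ * A := by
    rw [div_mul_eq_mul_div, le_div_iff₀ hc₂]
    exact mul_le_mul_of_nonneg_left hAc hM0
  have k2 : β i ^ 2 / f * A ≤ 4 * M ^ 2 / (s ^ 2 * c₂ ^ 2) * A := by
    refine mul_le_mul_of_nonneg_right ?_ hA0.le
    rw [div_le_div_iff₀ hf (by positivity)]
    have h1 : (s * (β i * A)) ^ 2 ≤ (2 * M) ^ 2 :=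
      pow_le_pow_left₀ (mul_nonneg hs.le (mul_nonneg (hβ0 i) hA0.le)) (hβA i) 2
    have h2 : β i ^ 2 * s ^ 2 * c₂ ^ 2 ≤ β i ^ 2 * s ^ 2 * (f * A ^ 2) :=
      mul_le_mul_of_nonneg_left hAf (by positivity)
    have h3 := mul_le_mul_of_nonneg_left h1 hf.le
    nlinarith
  have k3 : P i * A + Q i * M ≤ 12 * (g i ^ 2 / (A * f))
      + 96 * (M / c₂ + M ^ 2 / c₂ ^ 2) / s ^ 2 * rho i ^ 2 * A := by
    have h1 : P i * A = 12 * (g i ^ 2 / (A * f)) + 24 * rho i ^ 2 * (β i ^ 2 / f * A) := by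
      rw [hP]
      field_simp
    have h2 := mul_le_mul_of_nonneg_left k2 (by positivity : 0 ≤ 24 * rho i ^ 2)
    have h3 := mul_le_mul_of_nonneg_left k1 (by positivity : 0 ≤ 96 * rho i ^ 2 / s ^ 2)
    have h4 : 96 * (M / c₂ + M ^ 2 / c₂ ^ 2) / s ^ 2 * rho i ^ 2 * A
        = 96 * rho i ^ 2 / s ^ 2 * (M / c₂ * A)
          + 24 * rho i ^ 2 * (4 * M ^ 2 / (s ^ 2 * c₂ ^ 2) * A) := by
      field_simp
      ring
    rw [h1, h4]
    linarith
  linarith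

end LatticeThreeBody

namespace LatticeThreeBody

/-! ### The amplitude of a pair at small momenta -/

theorem abs_cos_sub_cos_le (x y : ℝ) : |Real.cos x - Real.cos y| ≤ |x + y| * |x - y| / 2 := by
  rw [Real.cos_sub_cos, abs_mul, abs_mul, abs_neg, abs_two]
  have h1 : |Real.sin ((x + y) / 2)| ≤ |x + y| / 2 :=
    Real.abs_sin_le_abs.trans_eq (by rw [abs_div, abs_two])
  have h2 : |Real.sin ((x - y) / 2)| ≤ |x - y| / 2 :=
    Real.abs_sin_le_abs.trans_eq (by rw [abs_div, abs_two])
  have h3 := mul_le_mul h1 h2 (abs_nonneg _) (by positivity)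
  linarith

variable {l : Fin 3 → ℝ}

theorem half_le_pairAmp (hl : ∀ a, 0 < l a) (a : Fin 3) {x : ℝ} (hx : |x| ≤ 1 / 2) :
    pairSum l a / 2 ≤ pairAmp l a x := by
  have h := pairSum_sub_pairAmp_le hl a x
  have h1 : x ^ 2 ≤ 1 / 2 := by
    rw [← sq_abs]
    nlinarith [abs_nonneg x]
  nlinarith [pairSum_pos hl a]

theorem abs_pairAmp_sub_le (hl : ∀ a, 0 < l a) (a : Fin 3) {x y : ℝ} (hx : |x| ≤ 1 / 2)
    (hy : |y| ≤ 1 / 2) :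
    |pairAmp l a x - pairAmp l a y| ≤ pairSum l a * (|x + y| * |x - y|) := by
  have hs := pairSum_pos hl a
  have h1 := half_le_pairAmp hl a hx
  have h2 := half_le_pairAmp hl a hy
  have h3 : (pairAmp l a x - pairAmp l a y) * (pairAmp l a x + pairAmp l a y)
      = 2 * (l (a + 1) * l (a + 2)) * (Real.cos x - Real.cos y) := by
    linear_combination sq_pairAmp l a x - sq_pairAmp l a y
  have h4 : |pairAmp l a x - pairAmp l a y| * (pairAmp l a x + pairAmp l a y)
      = 2 * (l (a + 1) * l (a + 2)) * |Real.cos x - Real.cos y| := by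
    have h5 := congrArg abs h3
    rwa [abs_mul, abs_mul, abs_of_pos (by linarith : 0 < pairAmp l a x + pairAmp l a y),
      abs_of_pos (mul_pos two_pos (mul_pos (hl (a + 1)) (hl (a + 2))))] at h5
  have h5 : l (a + 1) * l (a + 2) ≤ pairSum l a ^ 2 := by
    rw [pairSum]
    nlinarith [mul_pos (hl (a + 1)) (hl (a + 2)), sq_nonneg (l (a + 1)), sq_nonneg (l (a + 2))]
  have h6 := abs_cos_sub_cos_le x y
  have h7 : |pairAmp l a x - pairAmp l a y| * pairSum l a
      ≤ |pairAmp l a x - pairAmp l a y| * (pairAmp l a x + pairAmp l a y) :=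
    mul_le_mul_of_nonneg_left (by linarith) (abs_nonneg _)
  have h8 : 2 * (l (a + 1) * l (a + 2)) * |Real.cos x - Real.cos y|
      ≤ 2 * pairSum l a ^ 2 * (|x + y| * |x - y| / 2) :=
    mul_le_mul (by linarith) h6 (abs_nonneg _) (by positivity)
  refine le_of_mul_le_mul_right ?_ hs
  linarith

/-- Midpoint concavity of the amplitude near zero momentum. -/
theorem pairAmp_add_le (hl : ∀ a, 0 < l a) (a : Fin 3) {x h : ℝ}
    (hx : 0 ≤ Real.cos (x + h / 2)) :
    pairAmp l a (x + h : ℝ) + pairAmp l a x ≤ 2 * pairAmp l a (x + h / 2 : ℝ) := by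
  have h1 : Real.cos (x + h) + Real.cos x ≤ 2 * Real.cos (x + h / 2) := by
    rw [Real.cos_add_cos, show (x + h + x) / 2 = x + h / 2 by ring]
    nlinarith [Real.cos_le_one ((x + h - x) / 2)]
  refine le_of_sq_le_sq ?_ (by linarith [pairAmp_nonneg l a (x + h / 2 : ℝ)])
  have e1 := sq_pairAmp l a (x + h)
  have e2 := sq_pairAmp l a x
  have e3 := sq_pairAmp l a (x + h / 2)
  have h2 := mul_le_mul_of_nonneg_left h1
    (mul_pos two_pos (mul_pos (hl (a + 1)) (hl (a + 2)))).le
  nlinarith [sq_nonneg (pairAmp l a (x + h : ℝ) - pairAmp l a x)]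

/-! ### Nondegeneracy of the zeros of the channel determinants -/

/-- The function `channelEnergy - τ` for the momentum `κ = y - h` and pair momentum `x + h`. -/
noncomputable def localEnergy (l : Fin 3 → ℝ) (a : Fin 3) (x y : Fin 3 → ℝ) (τ : ℝ)
    (h : Fin 3 → ℝ) (q : Torus) : ℝ :=
  ∑ i, (pairSum l a - pairAmp l a (x i + h i : ℝ) * cosCircle (q i)
    + l a * (1 - Real.cos (y i - h i))) - τ

theorem continuous_localEnergy (a : Fin 3) (x y : Fin 3 → ℝ) (τ : ℝ) (h : Fin 3 → ℝ) :
    Continuous (localEnergy l a x y τ h) := by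
  have := continuous_cosCircle
  unfold localEnergy
  fun_prop

theorem localEnergy_zero (a : Fin 3) (x y : Fin 3 → ℝ) (τ : ℝ) (q : Torus) :
    localEnergy l a x y τ 0 q
      = wellEnergy (fun i => pairAmp l a (x i)) (localEnergy l a x y τ 0 0) q := by
  simp only [localEnergy, wellEnergy, Pi.zero_apply, add_zero, sub_zero, cosCircle_zero, mul_one,
    mul_sub, Finset.sum_add_distrib, Finset.sum_sub_distrib]
  ring

/-- The change of `l_a (1 - cos y_i)` under `y_i ↦ y_i - h`. -/
noncomputable def kineticShift (l : Fin 3 → ℝ) (a : Fin 3) (y h : ℝ) : ℝ :=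
  l a * (Real.cos y - Real.cos (y - h))

/-- The change of the amplitude under `x_i ↦ x_i + h`. -/
noncomputable def ampShift (l : Fin 3 → ℝ) (a : Fin 3) (x h : ℝ) : ℝ :=
  pairAmp l a (x + h : ℝ) - pairAmp l a x

theorem localEnergy_eq (a : Fin 3) (x y : Fin 3 → ℝ) (τ : ℝ) (h : Fin 3 → ℝ) (q : Torus) :
    localEnergy l a x y τ h q = localEnergy l a x y τ 0 q
      + ∑ i, (kineticShift l a (y i) (h i) - ampShift l a (x i) (h i) * cosCircle (q i)) := by
  simp only [localEnergy, kineticShift, ampShift, Pi.zero_apply, add_zero, sub_zero]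
  rw [sub_add_eq_add_sub, ← Finset.sum_add_distrib]
  congr 1
  refine Finset.sum_congr rfl fun i _ => ?_
  ring

theorem abs_kineticShift_le (hl : ∀ a, 0 < l a) (a : Fin 3) {y h B : ℝ} (hB : B ≤ 1 / 8)
    (hy : |y| ≤ B) (hh : |h| ≤ B) : |kineticShift l a y h| ≤ l a * |h| := by
  rw [kineticShift, abs_mul, abs_of_pos (hl a)]
  refine mul_le_mul_of_nonneg_left ((abs_cos_sub_cos_le _ _).trans ?_) (hl a).le
  rw [show y - (y - h) = h by ring]
  have h1 : |y + (y - h)| ≤ 2 := by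
    rw [abs_le] at *
    constructor <;> linarith [hy.1, hy.2, hh.1, hh.2]
  nlinarith [abs_nonneg h]

theorem abs_ampShift_le (hl : ∀ a, 0 < l a) (a : Fin 3) {x h B : ℝ} (hB : B ≤ 1 / 8)
    (hx : |x| ≤ B) (hh : |h| ≤ B) : |ampShift l a x h| ≤ pairSum l a * (3 * B) * |h| := by
  have h1 : |x + h| ≤ 1 / 2 := by
    rw [abs_le] at *
    constructor <;> linarith [hx.1, hx.2, hh.1, hh.2]
  refine (abs_pairAmp_sub_le hl a h1 (by linarith)).trans ?_
  rw [show x + h - x = h by ring, mul_assoc]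
  refine mul_le_mul_of_nonneg_left (mul_le_mul_of_nonneg_right ?_ (abs_nonneg h))
    (pairSum_pos hl a).le
  rw [abs_le] at *
  constructor <;> linarith [hx.1, hx.2, hh.1, hh.2]

/-- The midpoint inequality that makes the terms of first order quadratically large: the kinetic
part is strictly convex and the amplitude is concave. -/
theorem midpoint_le (hl : ∀ a, 0 < l a) (a : Fin 3) {x y h B A Ac : ℝ} (hB : B ≤ 1 / 8)
    (hx : |x| ≤ B) (hy : |y| ≤ B) (hh : |h| ≤ B) (hA : 0 ≤ A) (hAc : 0 ≤ Ac) :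
    2 * (kineticShift l a y (h / 2) * A - ampShift l a x (h / 2) * Ac) + l a / 20 * A * h ^ 2
      ≤ kineticShift l a y h * A - ampShift l a x h * Ac := by
  have hcos : ∀ u, |u| ≤ 1 → 1 / 2 ≤ Real.cos u := fun u hu => by
    have h1 := Real.one_sub_sq_div_two_le_cos (x := u)
    have h2 : u ^ 2 ≤ 1 := (sq_le_one_iff_abs_le_one u).2 hu
    linarith
  have h1 : 1 / 2 ≤ Real.cos (x + h / 2) := hcos _ (by
    rw [abs_le] at *
    constructor <;> linarith [hx.1, hx.2, hh.1, hh.2])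
  have h2 : 1 / 2 ≤ Real.cos (y - h / 2) := hcos _ (by
    rw [abs_le] at *
    constructor <;> linarith [hy.1, hy.2, hh.1, hh.2])
  have h3 := pairAmp_add_le hl a (x := x) (h := h) (by linarith)
  have h4 : h ^ 2 / 20 ≤ 1 - Real.cos (h / 2) := by
    have h5 := Real.cos_le_one_sub_mul_cos_sq (x := h / 2) (by
      have := Real.pi_gt_three
      rw [abs_le] at *
      constructor <;> linarith [hh.1, hh.2])
    have h6 : 1 / 5 ≤ 2 / Real.pi ^ 2 := by
      rw [div_le_div_iff₀ (by norm_num) (by positivity)]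
      nlinarith [Real.pi_lt_d2, Real.pi_pos]
    nlinarith [mul_le_mul_of_nonneg_right h6 (sq_nonneg (h / 2))]
  have h5 : Real.cos y + Real.cos (y - h) = 2 * Real.cos (y - h / 2) * Real.cos (h / 2) := by
    rw [Real.cos_add_cos, show (y + (y - h)) / 2 = y - h / 2 by ring,
      show (y - (y - h)) / 2 = h / 2 by ring]
  have h6 : kineticShift l a y h - 2 * kineticShift l a y (h / 2)
      = l a * (2 * Real.cos (y - h / 2) * (1 - Real.cos (h / 2))) := by
    rw [kineticShift, kineticShift]
    linear_combination (-(l a)) * h5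
  have h7 : h ^ 2 / 20 ≤ 2 * Real.cos (y - h / 2) * (1 - Real.cos (h / 2)) := by
    nlinarith [sq_nonneg h]
  have h8 : l a / 20 * h ^ 2 ≤ kineticShift l a y h - 2 * kineticShift l a y (h / 2) := by
    rw [h6]
    nlinarith [hl a]
  have h9 : ampShift l a x h ≤ 2 * ampShift l a x (h / 2) := by
    rw [ampShift, ampShift]
    linarith
  nlinarith [mul_le_mul_of_nonneg_right h8 hA, mul_le_mul_of_nonneg_right h9 hAc]

theorem exists_pos_forall_mul_sq_le {ι : Type*} [Finite ι] (k : ι → ℝ) {b : ι → ℝ}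
    (hb : ∀ i, 0 < b i) {t₀ : ℝ} (ht₀ : 0 < t₀) :
    ∃ t : ℝ, 0 < t ∧ t ≤ t₀ ∧ ∀ i, k i * t ^ 2 ≤ b i := by
  have hev : ∀ᶠ t : ℝ in 𝓝[>] 0, ∀ i, k i * t ^ 2 ≤ b i := eventually_all.2 fun i => by
    have h1 : Tendsto (fun t : ℝ => k i * t ^ 2) (𝓝 0) (𝓝 (k i * 0 ^ 2)) :=
      (continuous_const.mul (continuous_id.pow 2)).tendsto 0
    rw [zero_pow two_ne_zero, mul_zero] at h1
    exact (h1.mono_left nhdsWithin_le_nhds).eventually (ge_mem_nhds (hb i))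
  have hI : ∀ᶠ t : ℝ in 𝓝[>] 0, t ∈ Set.Ioc 0 t₀ := Ioc_mem_nhdsGT ht₀
  obtain ⟨t, h1, h2⟩ := (hI.and hev).exists
  exact ⟨t, h1.1, h1.2, h2⟩

/-- The first order term `g ≥ (m / 20) A h²` dominates the remainder of `le_integral_inv_sub`. -/
theorem mul_sq_le_of_first_order {m g A f C ρ h : ℝ} (hA : 0 < A) (hf : 0 < f) (hg : 0 ≤ g)
    (hgf : g ≤ A * (f / 24)) (hρ : C * ρ ^ 2 ≤ m / 80 * h ^ 2) (hlow : m / 20 * A * h ^ 2 ≤ g) :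
    m / 80 * A * h ^ 2 ≤ g - 12 * (g ^ 2 / (A * f)) - C * ρ ^ 2 * A := by
  have h1 : 12 * (g ^ 2 / (A * f)) ≤ g / 2 := by
    rw [← mul_div_assoc, div_le_iff₀ (by positivity)]
    nlinarith
  have h2 := mul_le_mul_of_nonneg_right hρ hA.le
  linarith

/-- Near a maximum, at small momenta, the resolvent integral decreases at least quadratically. The
bound `B₀` on the momenta depends only on `l` and on the maximal value `M`, while the constants `c`
and `r` depend on the maximum. -/
theorem exists_sq_le_integral_inv_sub (hl : ∀ a, 0 < l a) (a : Fin 3) {M : ℝ} (hM : 0 < M) :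
    ∃ B₀ : ℝ, 0 < B₀ ∧ ∀ (x y : Fin 3 → ℝ) (τ B : ℝ), B ≤ B₀ → 0 < B → (∀ i, |x i| ≤ B) →
      (∀ i, |y i| ≤ B) → (∀ h q, 0 < localEnergy l a x y τ h q) →
      localEnergy l a x y τ 0 0 ≤ 3 * pairSum l a * B ^ 2 →
      M = ∫ q, (localEnergy l a x y τ 0 q)⁻¹ →
      (∀ h, ∫ q, (localEnergy l a x y τ h q)⁻¹ ≤ M) →
      ∃ c r : ℝ, 0 < c ∧ 0 < r ∧ ∀ h : Fin 3 → ℝ, (∀ i, |h i| ≤ r) →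
        c * ∑ i, h i ^ 2 ≤ M - ∫ q, (localEnergy l a x y τ h q)⁻¹ := by
  set s := pairSum l a with hs
  have hs0 : 0 < s := pairSum_pos hl a
  have hla := hl a
  set c₂ := 8 / (1 + 3 * s / 2) ^ 2 with hc₂
  have hc₂0 : 0 < c₂ := by positivity
  set C := 96 * (M / c₂ + M ^ 2 / c₂ ^ 2) / s ^ 2 with hC
  have hC0 : 0 < C := by positivity
  obtain ⟨B₀, hB₀, hB1, hB2, hB3, hB4⟩ : ∃ B₀ : ℝ, 0 < B₀ ∧ B₀ ≤ 1 / 8 ∧ 3 * s * B₀ ^ 2 ≤ 1 ∧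
      (2 * M / s) ^ 2 * (3 * s * B₀ ^ 2) ≤ c₂ ^ 2 ∧ C * (s * (3 * B₀)) ^ 2 ≤ l a / 80 := by
    obtain ⟨t, h1, h2, h3⟩ := exists_pos_forall_mul_sq_le
      ![3 * s, (2 * M / s) ^ 2 * (3 * s), C * (s * 3) ^ 2] (b := ![1, c₂ ^ 2, l a / 80])
      (by intro i; fin_cases i <;> simp <;> positivity) (by norm_num : (0 : ℝ) < 1 / 8)
    have e0 : 3 * s * t ^ 2 ≤ 1 := h3 0
    have e1 : (2 * M / s) ^ 2 * (3 * s) * t ^ 2 ≤ c₂ ^ 2 := h3 1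
    have e2 : C * (s * 3) ^ 2 * t ^ 2 ≤ l a / 80 := h3 2
    exact ⟨t, h1, h2, e0, by linarith, by linarith⟩
  refine ⟨B₀, hB₀, fun x y τ B hBB hB hx hy hpos hf hMeq hmax => ?_⟩
  have hBsq : B ^ 2 ≤ B₀ ^ 2 := pow_le_pow_left₀ hB.le hBB 2
  have hB8 : B ≤ 1 / 8 := hBB.trans hB1
  set f := localEnergy l a x y τ 0 0 with hfdef
  have hf0 : 0 < f := hpos 0 0
  have hfB : f ≤ 3 * s * B₀ ^ 2 := hf.trans (mul_le_mul_of_nonneg_left hBsq (by positivity))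
  have hf1 : f ≤ 1 := hfB.trans hB2
  set R : Fin 3 → ℝ := fun i => pairAmp l a (x i) with hR
  have hRs : ∀ i, R i ≤ s := fun i => pairAmp_le hl a _
  have hRh : ∀ i, s / 2 ≤ R i := fun i => half_le_pairAmp hl a (by linarith [hx i])
  have hR0 : ∀ i, 0 ≤ R i := fun i => by linarith [hRh i]
  have hwell : ∀ q, localEnergy l a x y τ 0 q = wellEnergy R f q := localEnergy_zero a x y τ
  set A := ∫ q, (wellEnergy R f q ^ 2)⁻¹ with hA
  have hM' : M = ∫ q, (wellEnergy R f q)⁻¹ := by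
    rw [hMeq]
    simp only [hwell]
  have hAf : c₂ ^ 2 ≤ f * A ^ 2 := le_mul_sq_integral_inv_sq hR0 hRs hf0 hf1
  have hA0 : 0 ≤ A := integral_nonneg fun q => inv_nonneg.2 (sq_nonneg _)
  have hAc : c₂ ≤ A := by
    refine le_of_sq_le_sq (hAf.trans ?_) hA0
    nlinarith [sq_nonneg A]
  have hApos : 0 < A := hc₂0.trans_le hAc
  -- `A` is large because `f` is small; this gives `A_i ≥ 0` below.
  have hAM : 2 * M / s ≤ A := by
    refine le_of_sq_le_sq ?_ hA0
    have h1 : (2 * M / s) ^ 2 * f ≤ f * A ^ 2 :=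
      ((mul_le_mul_of_nonneg_left hfB (by positivity)).trans hB3).trans hAf
    rw [mul_comm] at h1
    exact le_of_mul_le_mul_left h1 hf0
  set Ac : Fin 3 → ℝ := fun i => ∫ q : Torus, cosCircle (q i) * (wellEnergy R f q ^ 2)⁻¹ with hAcd
  have hAc0 : ∀ i, 0 ≤ Ac i := fun i => by
    have h1 : s * (A - Ac i) ≤ 2 * M := by
      rw [hM']
      exact sub_integral_cos_le hs0 hRh hf0 i
    rw [div_le_iff₀ hs0] at hAM
    nlinarith
  have hAcA : ∀ i, Ac i ≤ A := fun i => by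
    have hcc := continuous_cosCircle
    have hD : ∀ q, 0 < wellEnergy R f q := fun q => hf0.trans_le (le_wellEnergy hR0 q)
    have h1 := integrable_inv_pow_of_pos (continuous_wellEnergy R f) hD
      (φ := fun q => cosCircle (q i)) (by fun_prop) 2
    have h2 := integrable_inv_pow_of_pos (continuous_wellEnergy R f) hD
      (φ := fun _ => 1) continuous_const 2
    simp only [one_mul] at h2
    exact integral_mono h1 h2 fun q => mul_le_of_le_one_left (by positivity) (cosCircle_le_one _)
  set g : Fin 3 → ℝ → ℝ := fun i t => kineticShift l a (y i) t * A - ampShift l a (x i) t * Ac i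
    with hg
  -- The first order condition, applied to shifts of a single component.
  have hg0 : ∀ i t, 0 ≤ g i t := fun i t => by
    have h1 := integral_sub_mul_inv_sq_nonneg (continuous_localEnergy a x y τ 0)
      (continuous_localEnergy a x y τ (Pi.single i t)) (hpos 0) (hpos _)
      ((hmax (Pi.single i t)).trans_eq hMeq)
    simp only [localEnergy_eq a x y τ (Pi.single i t), add_sub_cancel_left, hwell] at h1
    rw [integral_affine_mul_inv_sq hR0 hf0, Finset.sum_eq_single i] at h1
    · simpa only [Pi.single_eq_same] using h1
    · intro j _ hj
      simp [Pi.single_eq_of_ne hj, kineticShift, ampShift]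
    · simp
  have hglow : ∀ i t, |t| ≤ B → l a / 20 * A * t ^ 2 ≤ g i t := fun i t ht => by
    have h1 := midpoint_le hl a hB8 (hx i) (hy i) ht hA0 (hAc0 i)
    have h2 := hg0 i (t / 2)
    simp only [hg] at h2 ⊢
    linarith
  -- For `|h_i| ≤ r` the perturbation is at most `f / 8`, hence at most half of the energy, and
  -- `12 g_i² / (A f) ≤ g_i / 2`.
  set r := min B (f / (24 * (l a + s))) with hr
  have hr0 : 0 < r := lt_min hB (by positivity)
  have hrf : (l a + s) * r ≤ f / 24 := by
    have h1 := min_le_right B (f / (24 * (l a + s)))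
    rw [← hr, le_div_iff₀ (by positivity)] at h1
    linarith
  refine ⟨l a / 80 * A, r, by positivity, hr0, fun h hh => ?_⟩
  have hhB : ∀ i, |h i| ≤ B := fun i => (hh i).trans (min_le_left _ _)
  have hlam : ∀ i, |kineticShift l a (y i) (h i)| ≤ l a * |h i| := fun i =>
    abs_kineticShift_le hl a hB8 (hy i) (hhB i)
  have hrho : ∀ i, |ampShift l a (x i) (h i)| ≤ s * (3 * B) * |h i| := fun i =>
    abs_ampShift_le hl a hB8 (hx i) (hhB i)
  have hrho1 : ∀ i, |ampShift l a (x i) (h i)| ≤ s * |h i| := fun i =>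
    (hrho i).trans (mul_le_mul_of_nonneg_right (by nlinarith) (abs_nonneg _))
  have hsmall : ∀ i, |kineticShift l a (y i) (h i)| + |ampShift l a (x i) (h i)| ≤ f / 24 :=
    fun i => by
      have h1 : (l a + s) * |h i| ≤ (l a + s) * r := mul_le_mul_of_nonneg_left (hh i) (by positivity)
      linarith [hlam i, hrho1 i]
  have hD' : ∀ q, localEnergy l a x y τ h q = wellEnergy R f q
      + ∑ i, (kineticShift l a (y i) (h i) - ampShift l a (x i) (h i) * cosCircle (q i)) :=
    fun q => by rw [localEnergy_eq, hwell]
  have hhalf : ∀ q, wellEnergy R f q / 2 ≤ localEnergy l a x y τ h q := fun q => by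
    have h1 : ∀ i, -(f / 24)
        ≤ kineticShift l a (y i) (h i) - ampShift l a (x i) (h i) * cosCircle (q i) := fun i => by
      have h2 : |ampShift l a (x i) (h i) * cosCircle (q i)| ≤ |ampShift l a (x i) (h i)| := by
        rw [abs_mul]
        exact mul_le_of_le_one_right (abs_nonneg _) (abs_cosCircle_le_one _)
      linarith [neg_abs_le (kineticShift l a (y i) (h i)),
        le_abs_self (ampShift l a (x i) (h i) * cosCircle (q i)), hsmall i]
    have h3 := Finset.sum_le_sum fun i (_ : i ∈ Finset.univ) => h1 i
    rw [Finset.sum_const, Finset.card_univ, Fintype.card_fin, nsmul_eq_mul] at h3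
    push_cast at h3
    rw [hD']
    linarith [le_wellEnergy (f := f) hR0 q]
  have hkey := le_integral_inv_sub (lam := fun i => kineticShift l a (y i) (h i))
    (rho := fun i => ampShift l a (x i) (h i)) (g := fun i => g i (h i)) hs0 hRh hf0 hA hM' hc₂0 hAc
    hAf (fun i => rfl) hD' hhalf
  refine le_trans ?_ hkey
  rw [Finset.mul_sum]
  refine Finset.sum_le_sum fun i _ => ?_
  change l a / 80 * A * h i ^ 2 ≤ g i (h i) - 12 * (g i (h i) ^ 2 / (A * f))
    - C * ampShift l a (x i) (h i) ^ 2 * A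
  have k1 : g i (h i) ≤ A * (f / 24) := by
    have h1 : kineticShift l a (y i) (h i) * A ≤ |kineticShift l a (y i) (h i)| * A :=
      mul_le_mul_of_nonneg_right (le_abs_self _) hA0
    have h2 : -ampShift l a (x i) (h i) * Ac i ≤ |ampShift l a (x i) (h i)| * A :=
      mul_le_mul (neg_le_abs _) (hAcA i) (hAc0 i) (abs_nonneg _)
    have h3 := mul_le_mul_of_nonneg_right (hsmall i) hA0
    simp only [hg]
    linarith
  have k3 : C * ampShift l a (x i) (h i) ^ 2 ≤ l a / 80 * h i ^ 2 := by
    have h1 : ampShift l a (x i) (h i) ^ 2 ≤ (s * (3 * B₀) * |h i|) ^ 2 := by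
      rw [← sq_abs (ampShift l a (x i) (h i))]
      refine pow_le_pow_left₀ (abs_nonneg _) ((hrho i).trans ?_) 2
      exact mul_le_mul_of_nonneg_right
        (mul_le_mul_of_nonneg_left (by linarith) hs0.le) (abs_nonneg _)
    rw [mul_pow, sq_abs] at h1
    calc C * ampShift l a (x i) (h i) ^ 2 ≤ C * ((s * (3 * B₀)) ^ 2 * h i ^ 2) :=
          mul_le_mul_of_nonneg_left h1 hC0.le
      _ = C * (s * (3 * B₀)) ^ 2 * h i ^ 2 := by ring
      _ ≤ l a / 80 * h i ^ 2 := mul_le_mul_of_nonneg_right hB4 (sq_nonneg (h i))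
  exact mul_sq_le_of_first_order hApos hf0 (hg0 i (h i)) k1 k3 (hglow i (h i) (hhB i))

end LatticeThreeBody

namespace LatticeThreeBody

variable {l mu : Fin 3 → ℝ} {K : EuclideanSpace ℝ (Fin 3)} {τ : ℝ}

/-- A zero `p` of the channel determinant at most critical coupling satisfies `ε_a(m_a K - p) ≤ τ`:
otherwise raising the amplitudes to `s` bounds the resolvent integral strictly by its value at the
two-particle threshold, which is at most `1 / coupling mu a`. -/
theorem mul_disp_le_of_channelDet_eq_zero (hl : ∀ a, 0 < l a) {a : Fin 3}
    (hmu : 0 < mu a) (hcrit : mu a ≤ criticalCoupling l a) {p : Torus}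
    (hp : channelDet l mu a K p τ = 0) :
    l a * disp (toTorus (massRatio l a • K) - p) ≤ τ := by
  by_contra! hlt
  set κ := toTorus (massRatio l a • K) - p with hκ
  set s := pairSum l a with hs
  have hs0 : 0 < s := pairSum_pos hl a
  set e := l a * disp κ - τ with he
  have he0 : 0 < e := sub_pos.2 hlt
  rw [channelDet_eq_channelEnergy hl, sub_eq_zero] at hp
  have h1 : ∀ q, channelEnergy l a K κ q - τ
      = 3 * s + e - ∑ i, pairAmp l a ((toTorus K - κ) i) * cosCircle (q i) := fun q => by
    rw [channelEnergy, Finset.sum_sub_distrib, Finset.sum_const, Finset.card_univ, Fintype.card_fin,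
      nsmul_eq_mul, he]
    push_cast
    ring
  have h2 := integral_inv_sub_cos_le (A := 3 * s + e) (t := s)
    (r := fun i => pairAmp l a ((toTorus K - κ) i)) (fun i => pairAmp_nonneg l a _)
    (fun i => pairAmp_le hl a _) (by linarith)
  have h3 : ∀ q : Torus, 3 * s + e - ∑ i, s * cosCircle (q i) = s * disp q + e := fun q => by
    rw [disp, ← Finset.mul_sum, Finset.sum_sub_distrib, Finset.sum_const, Finset.card_univ,
      Fintype.card_fin, nsmul_eq_mul]
    push_cast
    ring
  simp only [h3, ← h1] at h2
  have hcd := continuous_disp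
  have h4 : Integrable fun q : Torus => (s * disp q + e)⁻¹ :=
    integrable_of_continuous (Continuous.inv₀ (by fun_prop) fun q => by
      have := disp_nonneg q
      positivity)
  have h5 : ∫ q : Torus, (s * disp q + e)⁻¹ < s⁻¹ * ∫ q : Torus, (disp q)⁻¹ := by
    rw [← integral_const_mul, ← sub_pos, ← integral_sub (integrable_inv_disp.const_mul _) h4]
    refine integral_pos_of_ae_pos ((integrable_inv_disp.const_mul _).sub h4) ?_
    filter_upwards [ae_disp_pos] with q hq
    rw [← mul_inv, sub_pos]
    exact inv_strictAnti₀ (by positivity) (by linarith)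
  have h6 : 0 < s⁻¹ * ∫ q : Torus, (disp q)⁻¹ := mul_pos (inv_pos.2 hs0) integral_inv_disp_pos
  have h7 : coupling mu a ≤ (s⁻¹ * ∫ q : Torus, (disp q)⁻¹)⁻¹ := by
    rw [← coupling_criticalCoupling]
    exact div_le_div_of_nonneg_right hcrit (by positivity)
  have h8 : 0 < coupling mu a := div_pos hmu (by positivity)
  have h9 := mul_lt_mul_of_pos_left (h2.trans_lt h5) h8
  have h10 := mul_le_mul_of_nonneg_right h7 h6.le
  rw [inv_mul_cancel₀ h6.ne'] at h10
  linarith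

/-- At small nonzero total momentum the zeros of the channel determinants at the bottom of the
essential spectrum are nondegenerate minima. -/
theorem exists_mul_disp_le_channelDet (hl : ∀ a, 0 < l a) {a : Fin 3} (hmu : 0 < mu a)
    (hcrit : mu a ≤ criticalCoupling l a) :
    ∃ δ : ℝ, 0 < δ ∧ ∀ (K : EuclideanSpace ℝ (Fin 3)) (τ : ℝ), K ≠ 0 → ‖K‖ < δ →
      (∀ z, τ < energy l K z) → (∃ z, energy l K z < l a * disp (toTorus K)) →
      (∀ p, 0 ≤ channelDet l mu a K p τ) → ∀ p₀, channelDet l mu a K p₀ τ = 0 →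
      ∃ c : ℝ, 0 < c ∧ ∀ᶠ p in 𝓝 p₀, c * disp (p - p₀) ≤ channelDet l mu a K p τ := by
  have hc0 : 0 < coupling mu a := div_pos hmu (by positivity)
  have hla := hl a
  obtain ⟨B₀, hB₀, hB⟩ := exists_sq_le_integral_inv_sub hl a (inv_pos.2 hc0)
  refine ⟨B₀ / 3, by positivity, fun K τ hK hKB hτ hlt hnn p₀ hp₀ => ?_⟩
  have hK0 : 0 < ‖K‖ := norm_pos_iff.2 hK
  set κ := toTorus (massRatio l a • K) - p₀ with hκ
  have hκτ : l a * disp κ ≤ τ := mul_disp_le_of_channelDet_eq_zero hl hmu hcrit hp₀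
  have hKi : ∀ i, |K i| ≤ ‖K‖ := fun i => PiLp.norm_apply_le K i
  -- `l_a ε(κ) ≤ τ < min E < l_a ε(K)`, so `κ` is of the order of `K`.
  have hdisp : disp κ ≤ ‖K‖ ^ 2 / 2 := by
    obtain ⟨z, hz⟩ := hlt
    have h1 : l a * disp κ ≤ l a * disp (toTorus K) := by linarith [hτ z]
    refine (le_of_mul_le_mul_left h1 hla).trans ?_
    rw [EuclideanSpace.real_norm_sq_eq, Finset.sum_div]
    refine Finset.sum_le_sum fun i _ => ?_
    change 1 - cosCircle ((K i : ℝ) : AddCircle (2 * Real.pi)) ≤ _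
    rw [cosCircle_coe]
    linarith [Real.one_sub_sq_div_two_le_cos (x := K i)]
  choose y hyκ _ hyn using fun i => exists_coe_eq_circle (κ i)
  have hy : ∀ i, |y i| ≤ 2 * ‖K‖ := fun i => by
    have h1 : 2 / Real.pi ^ 2 * ‖κ i‖ ^ 2 ≤ ‖K‖ ^ 2 / 2 :=
      ((le_one_sub_cosCircle (κ i)).trans (Finset.single_le_sum
        (f := fun i => 1 - cosCircle (κ i)) (fun i _ => sub_nonneg.2 (cosCircle_le_one _))
        (Finset.mem_univ i))).trans hdisp
    have h2 : 1 / 8 ≤ 2 / Real.pi ^ 2 := by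
      rw [div_le_div_iff₀ (by norm_num) (by positivity)]
      nlinarith [Real.pi_le_four, Real.pi_pos]
    rw [← hyn i]
    refine le_of_sq_le_sq ?_ (by positivity)
    nlinarith [mul_le_mul_of_nonneg_right h2 (sq_nonneg ‖κ i‖)]
  set x : Fin 3 → ℝ := fun i => K i - y i with hx
  set B := 3 * ‖K‖ with hBdef
  have hxB : ∀ i, |x i| ≤ B := fun i => (abs_sub _ _).trans (by linarith [hKi i, hy i])
  have hyB : ∀ i, |y i| ≤ B := fun i => by linarith [hy i]
  set ι : (Fin 3 → ℝ) → Torus := fun h i => (h i : AddCircle (2 * Real.pi)) with hι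
  have hloc : ∀ h q, localEnergy l a x y τ h q = channelEnergy l a K (κ - ι h) q - τ := fun h q => by
    have h1 : ∀ i, (toTorus K - (κ - ι h)) i = ((x i + h i : ℝ) : AddCircle (2 * Real.pi)) :=
      fun i => by
        simp only [Pi.sub_apply, toTorus, ← hyκ, hι, hx, ← AddCircle.coe_sub]
        congr 1
        ring
    have h2 : ∀ i, cosCircle ((κ - ι h) i) = Real.cos (y i - h i) := fun i => by
      rw [Pi.sub_apply, ← hyκ, ← AddCircle.coe_sub, cosCircle_coe]
    simp only [localEnergy, channelEnergy, disp, h1, h2, Finset.sum_add_distrib, Finset.mul_sum]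
  have hdet : ∀ h, channelDet l mu a K (p₀ + ι h) τ
      = 1 - coupling mu a * ∫ q, (localEnergy l a x y τ h q)⁻¹ := fun h => by
    rw [channelDet_eq_channelEnergy hl, ← sub_sub]
    simp only [hloc, hκ]
  have hpos : ∀ h q, 0 < localEnergy l a x y τ h q := fun h q => by
    obtain ⟨z, hz⟩ := exists_energy_eq hl K a (κ - ι h) q
    rw [hloc, ← hz]
    exact sub_pos.2 (hτ z)
  have hι0 : ι 0 = 0 := by
    ext i
    simp [hι]
  have hf : localEnergy l a x y τ 0 0 ≤ 3 * pairSum l a * B ^ 2 := by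
    have h1 : ∀ i, pairSum l a - pairAmp l a (x i) ≤ pairSum l a * B ^ 2 := fun i => by
      refine (pairSum_sub_pairAmp_le hl a (x i)).trans
        (mul_le_mul_of_nonneg_left ?_ (pairSum_pos hl a).le)
      rw [← sq_abs]
      exact pow_le_pow_left₀ (abs_nonneg _) (hxB i) 2
    have h2 := Finset.sum_le_sum fun i (_ : i ∈ Finset.univ) => h1 i
    rw [Finset.sum_const, Finset.card_univ, Fintype.card_fin, nsmul_eq_mul] at h2
    push_cast at h2
    have h3 : localEnergy l a x y τ 0 0
        = ∑ i, (pairSum l a - pairAmp l a (x i)) + (l a * disp κ - τ) := by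
      rw [localEnergy, disp]
      simp only [Pi.zero_apply, cosCircle_zero, add_zero, sub_zero, mul_one, ← hyκ, cosCircle_coe,
        Finset.sum_add_distrib, Finset.mul_sum]
      ring
    rw [h3]
    linarith
  have hM : (coupling mu a)⁻¹ = ∫ q, (localEnergy l a x y τ 0 q)⁻¹ := by
    have h1 := hdet 0
    rw [hι0, add_zero, hp₀] at h1
    exact inv_eq_of_mul_eq_one_right (by linarith)
  have hmax : ∀ h, ∫ q, (localEnergy l a x y τ h q)⁻¹ ≤ (coupling mu a)⁻¹ := fun h => by
    have h1 := hnn (p₀ + ι h)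
    rw [hdet] at h1
    rw [← one_div, le_div_iff₀ hc0]
    linarith
  obtain ⟨c, r, hc, hr, hcr⟩ := hB x y τ B (by linarith) (by positivity) hxB hyB hpos hf hM hmax
  refine ⟨coupling mu a * c, mul_pos hc0 hc, ?_⟩
  filter_upwards [Metric.closedBall_mem_nhds p₀ hr] with p hp
  choose h hhp _ hhn using fun i => exists_coe_eq_circle ((p - p₀) i)
  have hpn : ∀ i, |h i| ≤ r := fun i => by
    rw [← hhn i]
    refine (norm_le_pi_norm (p - p₀) i).trans ?_
    rwa [← dist_eq_norm]
  have hph : p = p₀ + ι h := by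
    have h1 : ι h = p - p₀ := funext hhp
    rw [h1]
    abel
  have h1 : disp (p - p₀) ≤ ∑ i, h i ^ 2 := Finset.sum_le_sum fun i _ => by
    have h2 := one_sub_cosCircle_le ((p - p₀) i)
    rw [hhn i, sq_abs] at h2
    nlinarith [sq_nonneg (h i)]
  have h2 : channelDet l mu a K p τ
      = coupling mu a * ((coupling mu a)⁻¹ - ∫ q, (localEnergy l a x y τ h q)⁻¹) := by
    rw [mul_sub, mul_inv_cancel₀ hc0.ne', hph, hdet]
  rw [h2, mul_assoc]
  refine mul_le_mul_of_nonneg_left ?_ hc0.le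
  exact (mul_le_mul_of_nonneg_left h1 hc.le).trans (hcr h hpn)

/-! ### Integrability of the inverse channel determinants -/

/-- In three dimensions the inverse of a function with nondegenerate zeros is integrable. -/
theorem ae_pos_and_integrable_inv {F : Torus → ℝ} (hF : Continuous F) (hF0 : ∀ p, 0 ≤ F p)
    (hz : ∀ p₀, F p₀ = 0 → ∃ c : ℝ, 0 < c ∧ ∀ᶠ p in 𝓝 p₀, c * disp (p - p₀) ≤ F p) :
    (∀ᵐ p, 0 < F p) ∧ Integrable fun p => (F p)⁻¹ := by
  constructor
  · have h : volume {p | F p = 0} = 0 := measure_null_of_locally_null _ fun p₀ hp₀ => by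
      obtain ⟨c, hc, hcp⟩ := hz p₀ hp₀
      refine ⟨_, inter_mem_nhdsWithin _ hcp, measure_mono_null (fun p hp => ?_)
        (volume_singleton_torus p₀)⟩
      by_contra hne
      have h1 : 0 < c * disp (p - p₀) := mul_pos hc (disp_pos (sub_ne_zero.2 hne))
      have h2 : c * disp (p - p₀) ≤ F p := hp.2
      have h3 : F p = 0 := hp.1
      linarith
    filter_upwards [(show ∀ᵐ p, F p ≠ 0 by simpa [ae_iff] using h)] with p hp
    exact (hF0 p).lt_of_ne' hp
  · have hm : AEStronglyMeasurable (fun p => (F p)⁻¹) volume :=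
      hF.measurable.inv.aestronglyMeasurable
    have hloc : LocallyIntegrable (fun p => (F p)⁻¹) volume := fun p₀ => by
      by_cases hp₀ : F p₀ = 0
      · obtain ⟨c, hc, hcp⟩ := hz p₀ hp₀
        refine ⟨_, hcp, ?_⟩
        have h1 : Integrable fun p => c⁻¹ * (disp (p - p₀))⁻¹ :=
          (integrable_inv_disp.comp_sub_right p₀).const_mul _
        refine h1.integrableOn.mono' hm.restrict ?_
        have hms : MeasurableSet {p | c * disp (p - p₀) ≤ F p} := by
          have := continuous_disp
          exact (isClosed_le (by fun_prop) hF).measurableSet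
        filter_upwards [ae_restrict_mem hms] with p hp
        rw [Real.norm_of_nonneg (inv_nonneg.2 (hF0 p))]
        by_cases hpp : p = p₀
        · rw [hpp, hp₀, inv_zero]
          exact mul_nonneg (inv_nonneg.2 hc.le) (inv_nonneg.2 (disp_nonneg _))
        · rw [← mul_inv]
          exact inv_anti₀ (mul_pos hc (disp_pos (sub_ne_zero.2 hpp))) hp
      · have h1 : 0 < F p₀ / 2 := half_pos ((hF0 p₀).lt_of_ne' hp₀)
        refine ⟨{p | F p₀ / 2 ≤ F p},
          (hF.continuousAt.eventually (lt_mem_nhds (half_lt_self (by linarith)))).mono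
            fun p hp => le_of_lt hp, ?_⟩
        refine (integrable_const (F p₀ / 2)⁻¹).integrableOn.mono' hm.restrict ?_
        filter_upwards [ae_restrict_mem (isClosed_le continuous_const hF).measurableSet] with p hp
        rw [Real.norm_of_nonneg (inv_nonneg.2 (hF0 p))]
        exact inv_anti₀ h1 hp
    exact integrableOn_univ.1 (hloc.integrableOn_isCompact isCompact_univ)

theorem memLp_inv_sqrt_of_integrable_inv {F : Torus → ℝ} (hF : Continuous F) (hF0 : ∀ p, 0 ≤ F p)
    (hi : Integrable fun p => (F p)⁻¹) : MemLp (fun p => (((√(F p))⁻¹ : ℝ) : ℂ)) 2 := by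
  have hm : AEStronglyMeasurable (fun p => (((√(F p))⁻¹ : ℝ) : ℂ)) volume :=
    (Complex.measurable_ofReal.comp hF.sqrt.measurable.inv).aestronglyMeasurable
  rw [memLp_two_iff_integrable_sq_norm hm]
  refine hi.congr (Eventually.of_forall fun p => ?_)
  simp only [Complex.norm_real, Real.norm_eq_abs, sq_abs, inv_pow, Real.sq_sqrt (hF0 p)]

end LatticeThreeBody

theorem mainTheorem6 (l mu : Fin 3 → ℝ) (hl : ∀ a, 0 < l a) (hmu : ∀ a, 0 < mu a)
    (hres : ∃ c, (∀ a, a ≠ c → mu a = criticalCoupling l a) ∧ mu c ≤ criticalCoupling l c) :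
    ∃ δ : ℝ, 0 < δ ∧ ∀ K : EuclideanSpace ℝ (Fin 3), 0 < ‖K‖ → ‖K‖ < δ →
      (∀ a b p q, a ≠ b → tauEss l mu K < kinetic l K a b p q) ∧
      (∀ a, ∀ᵐ p : Torus, 0 < channelDet l mu a K p (tauEss l mu K)) ∧
      HilbertSchmidtKernels l mu K (tauEss l mu K) ∧
      IsSelfAdjoint (faddeev l mu K (tauEss l mu K)) ∧
      IsCompactOperator (faddeev l mu K (tauEss l mu K)) ∧
      numEigenvaluesBelow (hamiltonian l mu K) (tauEss l mu K)
        = countAbove 1 (faddeev l mu K (tauEss l mu K)) ∧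
      ∃ L : ℕ, Tendsto (fun γ : ℝ => countAbove (1 - γ) (faddeev l mu K (tauEss l mu K)))
          (𝓝[>] 0) (𝓝 (L : ℕ∞)) ∧
        countAbove 1 (faddeev l mu K (tauEss l mu K)) ≤ L := by
  obtain ⟨c, hc, hcc⟩ := hres
  have hcrit : ∀ a, mu a ≤ criticalCoupling l a := fun a => by
    by_cases h : a = c
    · rw [h]
      exact hcc
    · exact (hc a h).le
  choose δ hδ hΔ using fun a => exists_mul_disp_le_channelDet hl (hmu a) (hcrit a)
  obtain ⟨a₀, ha₀⟩ := Finite.exists_min δ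
  refine ⟨min 1 (δ a₀), lt_min one_pos (hδ a₀), fun K hK0 hKδ => ?_⟩
  have hK : K ≠ 0 := norm_pos_iff.1 hK0
  have hlt := exists_energy_lt_disp hl hK (hKδ.le.trans (min_le_left _ _))
  obtain ⟨ζ, hζ, p₁, hp₁⟩ := exists_channelDet_neg hl (hc (c + 1) (ne_add_one c).symm) (hlt (c + 1))
  obtain ⟨hτ, hnn, hess⟩ := tauEss_spec hmu hζ ⟨_, p₁, hp₁⟩
  set τ := tauEss l mu K
  have hcont := fun a => continuous_channelDet (mu := mu) hτ a
  have hmain := fun a => ae_pos_and_integrable_inv (hcont a) (hnn a) (hΔ a K τ hK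
    (hKδ.trans_le ((min_le_right _ _).trans (ha₀ a))) hτ (hlt a) (hnn a))
  have hL := fun a => memLp_inv_sqrt_of_integrable_inv (hcont a) (hnn a) (hmain a).2
  have hHS := hilbertSchmidtKernels_of_memLp hτ hL
  have hcl := faddeev_mem_closure_finiteRankOperators hτ hL
  refine ⟨fun a b p q hab => lt_kinetic hτ hab p q, fun a => (hmain a).1, hHS,
    isSelfAdjoint_faddeev hHS, isCompactOperator_of_mem_closure_finiteRankOperators hcl, ?_,
    exists_tendsto_countAbove fun z hz =>
      countAbove_ne_top_of_mem_closure_finiteRankOperators hcl hz⟩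
  rw [numEigenvaluesBelow_eq_countBelow (isSelfAdjoint_hamiltonian hmu) hess]
  exact countBelow_hamiltonian_eq_countAbove hmu hτ (fun a => (hmain a).1) hHS
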